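/- Let $m\ge 2$, $1\le n\le m$, let $\alpha_1,\dots,\alpha_n$ be real with $0<2\alpha_j<1$, and let $\lambda$ be real or purely imaginary. On $R_m^{n+}=\{x\in\mathbb R^m: x_1>0,\dots,x_n>0\}$ consider the equation $$Lu:=\sum_{i=1}^m\frac{\partial^2u}{\partial x_i^2}+\sum_{j=1}^n\frac{2\alpha_j}{x_j}\frac{\partial u}{\partial x_j}-\lambda^2u=0 .$$ Write $(\kappa)_\nu=\Gamma(\kappa+\nu)/\Gamma(\kappa)$ and, for $|\xi_1|+\dots+|\xi_n|<1$, $$\mathrm H_A^{(n,1)}(a,b_1,\dots,b_n;c_1,\dots,c_n;\xi,\eta)=\sum_{m_1,\dots,m_{n+1}\ge0}\frac{(a)_{m_1+\dots+m_n-m_{n+1}}(b_1)_{m_1}\cdots(b_n)_{m_n}}{m_1!\cdots m_{n+1}!\,(c_1)_{m_1}\cdots(c_n)_{m_n}}\,\xi_1^{m_1}\cdots\xi_n^{m_n}\eta^{m_{n+1}} .$$ Fix $x_0\in R_m^{n+}$ and an integer $0\le k\le n$, and put $$\tilde\alpha_k=\frac m2+k-1-\sum_{i=1}^k\alpha_i+\sum_{i=k+1}^n\alpha_i,\qquad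 \gamma_k=2^{2\tilde\alpha_k-m}\frac{\Gamma(\tilde\alpha_k)}{\pi^{m/2}}\prod_{j=1}^k\frac{\Gamma(1-\alpha_j)}{\Gamma(2-2\alpha_j)}\prod_{i=k+1}^n\frac{\Gamma(\alpha_i)}{\Gamma(2\alpha_i)},$$ $$r^2=\sum_{i=1}^m(x_i-x_{0i})^2,\quad r_j^2=(x_j+x_{0j})^2+\sum_{i\ne j}(x_i-x_{0i})^2,\quad \xi_j=\frac{r^2-r_j^2}{r^2}\ (1\le j\le n),\quad \eta_1=-\tfrac14\lambda^2r^2 .$$ Assume that $\lambda=0$ or $\tilde\alpha_k\notin\mathbb N$ (so that all coefficients of the series that enter are defined; for $\lambda=0$ only the terms with $m_{n+1}=0$ enter). Then, for each $x\in R_m^{n+}\setminus\{x_0\}$, the series for $$\mathrm H_A^{(n,1)}\bigl(\tilde\alpha_k,1-\alpha_1,\dots,1-\alpha_k,\alpha_{k+1},\dots,\alpha_n;\,2-2\alpha_1,\dots,2-2\alpha_k,2\alpha_{k+1},\dots,2\alpha_n;\,\xi,\eta_1\bigr),$$ as a function of its argument $\xi\in\mathbb C^n$ with $\eta_1$ fixed,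 converges absolutely for $\sum_j|\xi_j|<1$ and extends (uniquely) to a holomorphic function on the convex open set $\{\xi\in\mathbb C^n:\sum_j\max(\operatorname{Re}\xi_j,0)<1\}$, which contains the point $\xi=\xi(x,x_0)$. With $\mathrm H_A^{(n,1)}$ denoting this continuation, the function $$q_k(x,x_0)=\gamma_k\prod_{i=1}^k(x_ix_{0i})^{1-2\alpha_i}\; r^{-2\tilde\alpha_k}\;\mathrm H_A^{(n,1)}\!\left[\begin{matrix}\tilde\alpha_k,1-\alpha_1,\dots,1-\alpha_k,\alpha_{k+1},\dots,\alpha_n;\\ 2-2\alpha_1,\dots,2-2\alpha_k,2\alpha_{k+1},\dots,2\alpha_n;\end{matrix}\ \xi,\eta_1\right]$$ is a fundamental solution of the equation with pole $x_0$. That is: 1. As a function of $x$ it is of class $C^2$ on $R_m^{n+}\setminus\{x_0\}$ and satisfies $L_xq_k(x,x_0)=0$ there. 2. It is locally integrable on $R_m^{n+}$, and for every $\varphi\in C_c^\infty(R_m^{n+};\mathbb C)$ $$\int_{R_m^{n+}}q_k(x,x_0)\,(L\varphi)(x)\,\prod_{j=1}^nx_j^{2\alpha_j}\,dx=-\varphi(x_0),$$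 that is, $L_xq_k(\cdot,x_0)=-\prod_{j=1}^nx_{0j}^{-2\alpha_j}\,\delta_{x_0}$ in the sense of distributions. -/

import Mathlib

open scoped ContDiff

noncomputable section

namespace SingularHelmholtz

/-! ### The confluent hypergeometric function of `n + 1` variables -/

/-- The Pochhammer symbol `(κ)_ν = Γ(κ + ν) / Γ(κ)` with an integer (possibly negative) index. -/
def poch (κ : ℝ) (ν : ℤ) : ℝ := Real.Gamma (κ + ν) / Real.Gamma κ

/-- The general term of the power series of `H_A^{(n,1)}(a, b; c; ξ, η)`; the first component of
`p` is the multi-index `(m_1, …, m_n)`, the second one is `m_{n+1}`. -/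
def seriesTerm {n : ℕ} (a : ℝ) (b c : Fin n → ℝ) (ξ : Fin n → ℂ) (η : ℂ)
    (p : (Fin n → ℕ) × ℕ) : ℂ :=
  ((poch a ((∑ j, (p.1 j : ℤ)) - (p.2 : ℤ)) * ∏ j, poch (b j) (p.1 j) : ℝ) : ℂ) /
      (((∏ j, ((p.1 j).factorial : ℝ)) * (p.2.factorial : ℝ) * ∏ j, poch (c j) (p.1 j) : ℝ) : ℂ) *
    (∏ j, ξ j ^ p.1 j) * η ^ p.2

/-- The convex open set of all `ξ ∈ ℂⁿ` with `∑ max (Re ξ_j) 0 < 1`. It contains the domain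
`∑ |ξ_j| < 1` of convergence and all `ξ` with nonpositive real coordinates. -/
def contDomain (n : ℕ) : Set (Fin n → ℂ) := {ξ | ∑ j, max (ξ j).re 0 < 1}

/-- For fixed `η`, the function `H` is the analytic continuation in `ξ` of `H_A^{(n,1)}` to
`contDomain n`: it is holomorphic there, and for `∑ |ξ_j| < 1` it is the sum of the (absolutely
convergent) series. -/
def IsHA {n : ℕ} (a : ℝ) (b c : Fin n → ℝ) (η : ℂ) (H : (Fin n → ℂ) → ℂ) : Prop :=
  DifferentiableOn ℂ H (contDomain n) ∧
    ∀ ξ : Fin n → ℂ, ∑ j, ‖ξ j‖ < 1 → HasSum (seriesTerm a b c ξ η) (H ξ)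

lemma isOpen_contDomain (n : ℕ) : IsOpen (contDomain n) := by
  refine isOpen_lt (continuous_finsetSum _ fun j _ => ?_) continuous_const
  exact (Complex.continuous_re.comp (continuous_apply j)).max continuous_const

lemma convex_contDomain (n : ℕ) : Convex ℝ (contDomain n) := by
  intro x hx y hy s t hs ht hst
  have key : ∑ j, max ((s • x + t • y) j).re 0 ≤
      s * ∑ j, max (x j).re 0 + t * ∑ j, max (y j).re 0 := by
    rw [Finset.mul_sum, Finset.mul_sum, ← Finset.sum_add_distrib]
    refine Finset.sum_le_sum fun j _ => max_le ?_ ?_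
    · have h1 := mul_le_mul_of_nonneg_left (le_max_left (x j).re 0) hs
      have h2 := mul_le_mul_of_nonneg_left (le_max_left (y j).re 0) ht
      simp
      linarith
    · positivity
  have hx' : ∑ j, max (x j).re 0 < 1 := hx
  have hy' : ∑ j, max (y j).re 0 < 1 := hy
  refine lt_of_le_of_lt key ?_
  rcases hs.eq_or_lt with h | h
  · have : t = 1 := by linarith
    subst h this
    linarith
  · nlinarith [mul_lt_mul_of_pos_left hx' h, mul_le_mul_of_nonneg_left hy'.le ht]

/-- The analytic continuation is unique. -/
lemma IsHA.eqOn {n : ℕ} {a : ℝ} {b c : Fin n → ℝ} {η : ℂ} {H₁ H₂ : (Fin n → ℂ) → ℂ}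
    (h₁ : IsHA a b c η H₁) (h₂ : IsHA a b c η H₂) : Set.EqOn H₁ H₂ (contDomain n) := by
  intro ξ hξ
  set U : Set ℂ := {z | z • ξ ∈ contDomain n} with hU
  have hUo : IsOpen U := (isOpen_contDomain n).preimage (by fun_prop)
  have hUc : Convex ℝ U := by
    intro z hz w hw s t hs ht hst
    have := convex_contDomain n hz hw hs ht hst
    show (s • z + t • w) • ξ ∈ contDomain n
    rw [add_smul, smul_assoc, smul_assoc]
    exact this
  have hA : ∀ H, IsHA a b c η H → AnalyticOnNhd ℂ (fun z : ℂ => H (z • ξ)) U := by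
    intro H h
    refine DifferentiableOn.analyticOnNhd ?_ hUo
    exact h.1.comp (by fun_prop : DifferentiableOn ℂ (fun z : ℂ => z • ξ) U) fun z hz => hz
  have h0 : (0 : ℂ) ∈ U := by simp [hU, contDomain]
  have hev : (fun z : ℂ => H₁ (z • ξ)) =ᶠ[nhds 0] fun z : ℂ => H₂ (z • ξ) := by
    have hc : Continuous fun z : ℂ => ∑ j, ‖(z • ξ) j‖ := by
      simp only [Pi.smul_apply]
      fun_prop
    filter_upwards [(isOpen_lt hc continuous_const).mem_nhds
      (show ∑ j, ‖((0 : ℂ) • ξ) j‖ < 1 by simp)] with z hz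
    exact (h₁.2 _ hz).unique (h₂.2 _ hz)
  have := (hA _ h₁).eqOn_of_preconnected_of_eventuallyEq (hA _ h₂) hUc.isPreconnected h0 hev
    (show (1 : ℂ) ∈ U by simpa [hU] using hξ)
  simpa using this

open Classical in
/-- The confluent hypergeometric function `H_A^{(n,1)}(a, b; c; ξ, η)`, continued analytically
in `ξ` to `contDomain n`. -/
def HA {n : ℕ} (a : ℝ) (b c : Fin n → ℝ) (ξ : Fin n → ℂ) (η : ℂ) : ℂ :=
  if h : ∃ H, IsHA a b c η H then h.choose ξ else 0

/-! ### The singular Helmholtz equation -/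

/-- The domain `R_m^{n+}`: the first `n` coordinates are positive. -/
def posDomain {m n : ℕ} (hnm : n ≤ m) : Set (EuclideanSpace ℝ (Fin m)) :=
  {x | ∀ j : Fin n, 0 < x (Fin.castLE hnm j)}

/-- The partial derivative `∂u/∂x_i`. -/
def partialDeriv {m : ℕ} (i : Fin m) (u : EuclideanSpace ℝ (Fin m) → ℂ)
    (x : EuclideanSpace ℝ (Fin m)) : ℂ :=
  fderiv ℝ u x (EuclideanSpace.single i 1)

/-- `L u = ∑_{i ≤ m} ∂²u/∂x_i² + ∑_{j ≤ n} (2 α_j / x_j) ∂u/∂x_j - λ² u`. -/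
def helmholtzOp {m n : ℕ} (hnm : n ≤ m) (α : Fin n → ℝ) (lam : ℂ)
    (u : EuclideanSpace ℝ (Fin m) → ℂ) (x : EuclideanSpace ℝ (Fin m)) : ℂ :=
  (∑ i, partialDeriv i (partialDeriv i u) x) +
    (∑ j, ((2 * α j / x (Fin.castLE hnm j) : ℝ) : ℂ) * partialDeriv (Fin.castLE hnm j) u x) -
    lam ^ 2 * u x

/-- The weight `∏_{j ≤ n} x_j^{2 α_j}`, with respect to which `L` is formally symmetric. -/
def weight {m n : ℕ} (hnm : n ≤ m) (α : Fin n → ℝ) (x : EuclideanSpace ℝ (Fin m)) : ℝ :=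
  ∏ j, x (Fin.castLE hnm j) ^ (2 * α j)

/-- `u` solves `L u = 0` classically in `R_m^{n+} \ {x₀}`. -/
def IsSolutionOff {m n : ℕ} (hnm : n ≤ m) (α : Fin n → ℝ) (lam : ℂ)
    (x₀ : EuclideanSpace ℝ (Fin m)) (u : EuclideanSpace ℝ (Fin m) → ℂ) : Prop :=
  ContDiffOn ℝ 2 u (posDomain hnm \ {x₀}) ∧
    ∀ x ∈ posDomain hnm \ {x₀}, helmholtzOp hnm α lam u x = 0

/-- `u` is a fundamental solution in `R_m^{n+}` with pole `x₀`: it is locally integrable, and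
`L u = -δ_{x₀}` weakly with respect to the measure `∏ x_j^{2 α_j} dx` (equivalently,
`L u = -∏ x_{0j}^{-2 α_j} δ_{x₀}` as a distribution with respect to Lebesgue measure). -/
def IsFundamentalSolution {m n : ℕ} (hnm : n ≤ m) (α : Fin n → ℝ) (lam : ℂ)
    (x₀ : EuclideanSpace ℝ (Fin m)) (u : EuclideanSpace ℝ (Fin m) → ℂ) : Prop :=
  MeasureTheory.LocallyIntegrableOn u (posDomain hnm) ∧
    ∀ φ : EuclideanSpace ℝ (Fin m) → ℂ, ContDiff ℝ ∞ φ → HasCompactSupport φ →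
      tsupport φ ⊆ posDomain hnm →
      ∫ x, u x * helmholtzOp hnm α lam φ x * (weight hnm α x : ℂ) = -φ x₀

/-! ### The functions `q_k` -/

/-- `r² = ∑_i (x_i - x_{0i})²`. -/
def rSq {m : ℕ} (x x₀ : EuclideanSpace ℝ (Fin m)) : ℝ := ∑ i, (x i - x₀ i) ^ 2

/-- `r_j² = (x_j + x_{0j})² + ∑_{i ≠ j} (x_i - x_{0i})²`. -/
def rjSq {m : ℕ} (j : Fin m) (x x₀ : EuclideanSpace ℝ (Fin m)) : ℝ :=
  (x j + x₀ j) ^ 2 + ∑ i ∈ Finset.univ.erase j, (x i - x₀ i) ^ 2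

/-- `ξ_j = (r² - r_j²) / r²`. -/
def xiArg {m n : ℕ} (hnm : n ≤ m) (x x₀ : EuclideanSpace ℝ (Fin m)) (j : Fin n) : ℂ :=
  (((rSq x x₀ - rjSq (Fin.castLE hnm j) x x₀) / rSq x x₀ : ℝ) : ℂ)

/-- `η_1 = -λ² r² / 4`. -/
def etaArg {m : ℕ} (lam : ℂ) (x x₀ : EuclideanSpace ℝ (Fin m)) : ℂ :=
  -(1 / 4) * lam ^ 2 * (rSq x x₀ : ℂ)

/-- `α̃_k = m/2 + k - 1 - ∑_{i ≤ k} α_i + ∑_{k < i ≤ n} α_i`. Indices start at `0` here, so that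
`i ≤ k` is written `i < k`. -/
def alphaTilde (m : ℕ) {n : ℕ} (α : Fin n → ℝ) (k : ℕ) : ℝ :=
  (m : ℝ) / 2 + k - 1 - (∑ i : Fin n with i.val < k, α i) + ∑ i : Fin n with k ≤ i.val, α i

/-- The numerator parameters `1 - α_1, …, 1 - α_k, α_{k+1}, …, α_n`. -/
def bParam {n : ℕ} (α : Fin n → ℝ) (k : ℕ) (i : Fin n) : ℝ :=
  if (i : ℕ) < k then 1 - α i else α i

/-- The denominator parameters `2 - 2α_1, …, 2 - 2α_k, 2α_{k+1}, …, 2α_n`. -/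
def cParam {n : ℕ} (α : Fin n → ℝ) (k : ℕ) (i : Fin n) : ℝ :=
  if (i : ℕ) < k then 2 - 2 * α i else 2 * α i

/-- The constant `γ_k`. -/
def gammaConst (m : ℕ) {n : ℕ} (α : Fin n → ℝ) (k : ℕ) : ℝ :=
  (2 : ℝ) ^ (2 * alphaTilde m α k - m) *
    (Real.Gamma (alphaTilde m α k) / Real.pi ^ ((m : ℝ) / 2)) *
    (∏ i : Fin n with i.val < k, Real.Gamma (1 - α i) / Real.Gamma (2 - 2 * α i)) *
    ∏ i : Fin n with k ≤ i.val, Real.Gamma (α i) / Real.Gamma (2 * α i)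

/-- `q_k(x, x₀)`; the factor `r^{-2α̃_k}` is `(r²)^{-α̃_k}`. -/
def q {m n : ℕ} (hnm : n ≤ m) (α : Fin n → ℝ) (lam : ℂ) (k : ℕ)
    (x x₀ : EuclideanSpace ℝ (Fin m)) : ℂ :=
  ((gammaConst m α k *
      (∏ i : Fin n with i.val < k, (x (Fin.castLE hnm i) * x₀ (Fin.castLE hnm i)) ^ (1 - 2 * α i)) *
      rSq x x₀ ^ (-alphaTilde m α k) : ℝ) : ℂ) *
    HA (alphaTilde m α k) (bParam α k) (cParam α k) (xiArg hnm x x₀) (etaArg lam x x₀)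

end SingularHelmholtz

end

noncomputable section

namespace SingularHelmholtz

/-! Put κ = -λ²/4, let b_j = 1 - α_j for j ≤ k and b_j = α_j for j > k, and write a for α̃_k. Then
c_j = 2 b_j and a = m/2 - 1 + ∑ b_j. The building block is Ψ_a(z) = z^(-a) ∑ Γ(a - p) (κ z)^p / p!,
which satisfies Ψ_a' = -Ψ_{a+1} and z Ψ_{a+2} = (a + 1) Ψ_{a+1} - κ Ψ_a.

Euler integral. Expand Ψ_a(1 - ∑ t_j ξ_j), with η in place of κ, in powers of ξ and η, and integrate
in t against the product of the Beta(b_j, b_j) distributions. Their moments (b_j)_p / (2 b_j)_p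
produce exactly Γ(a) H_A. The integral makes sense wherever 1 - ∑ t_j ξ_j has positive real part for
all t in the cube, and so gives the continuation (`isHA_eulerHA`). Since -r² ξ_j = 4 x_j x_{0j}, the
function q_k is, up to a constant and the factor ∏ x_j^(1 - 2 α_j) over j ≤ k, the average V of
Ψ_a(X), where X = r² + ∑ 4 t_j x_j x_{0j} (`q_eq_regularizedQ`).

Equation. Replace X by X + ε. Differentiating under the integral, integrating by parts in each t_j
and using the recurrence, one finds that the operator with parameters b_j maps V_{a,ε} to -4 ε
V_{a+2,ε} (`betaPotential_pde`). Conjugation by the power factor exchanges α_j and 1 - α_j, which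
carries the identity over to L (`helmholtzOp_coordPower_mul`). At ε = 0 it says L q_k = 0 off the
pole.

Delta mass. For ε > 0 everything is smooth on the whole domain, so L can be moved from φ to the
regularized function (`integral_mul_helmholtzOp`), which leaves -4 ε ∫ h V_{a+2,ε} with h supported
in the support of φ. A majorant independent of ε gives the limit of the other side. For the
remaining one, only the leading part Γ(a + 2) (X + ε)^(-(a+2)) matters. Written as a Laplace
integral in u, it becomes ε ∫ e^(-ε u) Q(u) du, which tends to Q(∞) (`tendsto_mul_laplace`). The
rescaling x = x₀ + y/√u shows that Q(∞) is h(x₀) times explicit powers, a Gaussian factor π^(m/2),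
and a factor Γ(2 b_j)/Γ(b_j) from the Laplace transform of each beta distribution. The constant γ_k
is what makes the product 1 (`gammaConst_mul_eq_one`). -/

/-! ### Radial functions of Bessel type -/

lemma exists_bound_Gamma_sub_nat (a : ℝ) : ∃ C : ℝ, 0 ≤ C ∧ ∀ p : ℕ, |Real.Gamma (a - p)| ≤ C := by
  -- Beyond `|a| + 1` each step to the left divides Γ by a number of modulus at least 1, so only
  -- finitely many values count.
  obtain ⟨N, hN⟩ := exists_nat_ge (|a| + 1)
  have hstep : ∀ p : ℕ, N ≤ p → |Real.Gamma (a - (p + 1 : ℕ))| ≤ |Real.Gamma (a - p)| := by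
    intro p hp
    have hp' : (N : ℝ) ≤ p := by exact_mod_cast hp
    have ha := le_abs_self a
    have hs : a - (p + 1 : ℕ) ≠ 0 := by push_cast; intro h; linarith
    have h := Real.Gamma_add_one hs
    rw [show a - ((p + 1 : ℕ) : ℝ) + 1 = a - p by push_cast; ring] at h
    rw [h, abs_mul]
    refine le_mul_of_one_le_left (abs_nonneg _) ?_
    rw [abs_of_nonpos (by push_cast; linarith)]
    push_cast; linarith
  have htail : ∀ p : ℕ, N ≤ p → |Real.Gamma (a - p)| ≤ |Real.Gamma (a - N)| := by
    intro p hp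
    induction p, hp using Nat.le_induction with
    | base => exact le_rfl
    | succ p hp ih => exact (hstep p hp).trans ih
  refine ⟨∑ p ∈ Finset.range (N + 1), |Real.Gamma (a - p)|,
    Finset.sum_nonneg fun _ _ => abs_nonneg _, fun p => ?_⟩
  have hle : ∀ q ∈ Finset.range (N + 1), |Real.Gamma (a - q)| ≤
      ∑ p ∈ Finset.range (N + 1), |Real.Gamma (a - p)| := fun q hq =>
    Finset.single_le_sum (f := fun p : ℕ => |Real.Gamma (a - p)|) (fun _ _ => abs_nonneg _) hq
  rcases le_total N p with h | h
  · exact (htail p h).trans (hle N (by simp))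
  · exact hle p (by simp; omega)

/-- The entire function `∑ Γ(a - p) κ^p z^p / p!`. -/
def besselPhi (a : ℝ) (κ z : ℂ) : ℂ :=
  ∑' p : ℕ, (Real.Gamma (a - p) : ℂ) * κ ^ p / p.factorial * z ^ p

lemma norm_besselPhi_term_le {a C : ℝ} (hC : ∀ p : ℕ, |Real.Gamma (a - p)| ≤ C) (κ z : ℂ) (p : ℕ) :
    ‖(Real.Gamma (a - p) : ℂ) * κ ^ p / p.factorial * z ^ p‖ ≤
      C * ((‖κ‖ * ‖z‖) ^ p / p.factorial) := by
  have h1 : ‖(Real.Gamma (a - p) : ℂ) * κ ^ p / p.factorial * z ^ p‖ =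
      |Real.Gamma (a - p)| * ((‖κ‖ * ‖z‖) ^ p / p.factorial) := by
    rw [norm_mul, norm_div, norm_mul, norm_pow, norm_pow, Complex.norm_real, Complex.norm_natCast,
      Real.norm_eq_abs, mul_pow]
    ring
  rw [h1]
  exact mul_le_mul_of_nonneg_right (hC p) (by positivity)

lemma summable_besselPhi (a : ℝ) (κ z : ℂ) :
    Summable fun p : ℕ => (Real.Gamma (a - p) : ℂ) * κ ^ p / p.factorial * z ^ p := by
  obtain ⟨C, -, hC⟩ := exists_bound_Gamma_sub_nat a
  exact Summable.of_norm_bounded ((Real.summable_pow_div_factorial _).mul_left C)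
    (norm_besselPhi_term_le hC κ z)

lemma hasSum_besselPhi (a : ℝ) (κ z : ℂ) :
    HasSum (fun p : ℕ => (Real.Gamma (a - p) : ℂ) * κ ^ p / p.factorial * z ^ p)
      (besselPhi a κ z) :=
  (summable_besselPhi a κ z).hasSum

/-- The factor `p` is absorbed by `p!` and shifts the index, turning `a - p` into `(a - 1) - p`. It
is one half of the contiguity relation `besselPhi_add_one`. -/
lemma hasSum_mul_besselPhi_sub_one (a : ℝ) (κ z : ℂ) :
    HasSum (fun p : ℕ => (p : ℂ) * ((Real.Gamma (a - p) : ℂ) * κ ^ p / p.factorial * z ^ p))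
      (κ * z * besselPhi (a - 1) κ z) := by
  rw [← hasSum_nat_add_iff' 1]
  simp only [Finset.sum_range_one, Nat.cast_zero, zero_mul, sub_zero]
  refine ((hasSum_besselPhi (a - 1) κ z).mul_left (κ * z)).congr_fun fun p => ?_
  have h1 : ((p : ℂ) + 1) ≠ 0 := by exact_mod_cast p.succ_ne_zero
  have h2 : (p.factorial : ℂ) ≠ 0 := by exact_mod_cast p.factorial_ne_zero
  rw [show a - ((p + 1 : ℕ) : ℝ) = a - 1 - p by push_cast; ring, Nat.factorial_succ]
  push_cast
  field_simp
  ring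

lemma hasDerivAt_besselPhi (a : ℝ) (κ z : ℂ) :
    HasDerivAt (besselPhi a κ) (κ * besselPhi (a - 1) κ z) z := by
  obtain ⟨C, hC0, hC⟩ := exists_bound_Gamma_sub_nat a
  set R := ‖z‖ + 1 with hR
  have hR0 : 0 < R := by positivity
  -- Majorant of the differentiated series on the ball of radius `R`, with `R ^ (p - 1)` written as
  -- `R ^ p / R`.
  have hu : Summable fun p : ℕ => C * ((p : ℝ) * ((‖κ‖ * R) ^ p / p.factorial)) / R := by
    refine ((Summable.mul_left C ?_).div_const R)
    rw [← summable_nat_add_iff 1]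
    refine ((Real.summable_pow_div_factorial (‖κ‖ * R)).mul_left (‖κ‖ * R)).congr fun p => ?_
    rw [Nat.factorial_succ]
    push_cast
    field_simp
    ring
  have key := hasDerivAt_tsum_of_isPreconnected
    (g := fun (p : ℕ) (y : ℂ) => (Real.Gamma (a - p) : ℂ) * κ ^ p / p.factorial * y ^ p)
    (g' := fun (p : ℕ) (y : ℂ) =>
      (Real.Gamma (a - p) : ℂ) * κ ^ p / p.factorial * (p * y ^ (p - 1)))
    (t := Metric.ball 0 R) (y₀ := z) (y := z) hu Metric.isOpen_ball
    (convex_ball (0 : ℂ) R).isPreconnected (fun p y _ => (hasDerivAt_pow p y).const_mul _) ?_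
    (by simp [hR]) (summable_besselPhi a κ z) (by simp [hR])
  · convert! key using 1
    symm
    rw [tsum_eq_zero_add' ]
    · simp only [Nat.cast_zero, zero_mul, mul_zero, zero_add]
      rw [besselPhi, ← tsum_mul_left]
      refine tsum_congr fun p => ?_
      have h1 : ((p : ℂ) + 1) ≠ 0 := by exact_mod_cast p.succ_ne_zero
      have h2 : (p.factorial : ℂ) ≠ 0 := by exact_mod_cast p.factorial_ne_zero
      rw [show a - ((p + 1 : ℕ) : ℝ) = a - 1 - p by push_cast; ring, Nat.factorial_succ]
      push_cast
      field_simp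
      ring_nf
    · refine ((summable_besselPhi (a - 1) κ z).mul_left κ).congr fun p => ?_
      have h1 : ((p : ℂ) + 1) ≠ 0 := by exact_mod_cast p.succ_ne_zero
      have h2 : (p.factorial : ℂ) ≠ 0 := by exact_mod_cast p.factorial_ne_zero
      rw [show a - ((p + 1 : ℕ) : ℝ) = a - 1 - p by push_cast; ring, Nat.factorial_succ]
      push_cast
      field_simp
      ring_nf
  · intro p y hy
    have hy' : ‖y‖ ≤ R := by simpa using (Metric.mem_ball.1 hy).le
    rcases p with _ | p
    · simp
    have h3 : ‖y‖ ^ p ≤ R ^ p := by gcongr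
    have h4 : C * (((p + 1 : ℕ) : ℝ) * ((‖κ‖ * R) ^ (p + 1) / (p + 1).factorial)) / R =
        C * (‖κ‖ ^ (p + 1) / (p + 1).factorial * (((p + 1 : ℕ) : ℝ) * R ^ p)) := by
      field_simp
      ring_nf
    rw [h4, norm_mul, norm_div, norm_mul, norm_mul, norm_pow, norm_pow, Complex.norm_real,
      Complex.norm_natCast, Complex.norm_natCast, Real.norm_eq_abs, mul_div_assoc, mul_assoc,
      Nat.add_sub_cancel]
    exact mul_le_mul (hC _) (by gcongr) (by positivity) hC0

lemma continuous_besselPhi (a : ℝ) (κ : ℂ) : Continuous (besselPhi a κ) :=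
  continuous_iff_continuousAt.2 fun z => (hasDerivAt_besselPhi a κ z).continuousAt

/-- The condition under which the contiguity relations of `besselPhi` hold. -/
def Admissible (a : ℝ) (κ : ℂ) : Prop := 0 < a ∧ (κ = 0 ∨ ∀ N : ℕ, a ≠ N)

lemma Admissible.add_one {a : ℝ} {κ : ℂ} (h : Admissible a κ) : Admissible (a + 1) κ := by
  refine ⟨by linarith [h.1], h.2.imp_right fun h2 N hN => ?_⟩
  rcases N with _ | N
  · have := h.1
    simp at hN
    linarith
  · exact h2 N (by push_cast at hN; linarith)

lemma besselPhi_zero_right (a : ℝ) (κ : ℂ) : besselPhi a κ 0 = Real.Gamma a := by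
  rw [besselPhi, tsum_eq_single 0]
  · simp
  · intro p hp; simp [hp]

lemma besselPhi_zero_left (a : ℝ) (z : ℂ) : besselPhi a 0 z = Real.Gamma a := by
  rw [besselPhi, tsum_eq_single 0]
  · simp
  · intro p hp; simp [hp]

/-- Termwise this is Γ(a - p + 1) = (a - p) Γ(a - p), which breaks down only at `p = a`.
`Admissible` excludes that case unless `κ = 0`, and then only the term `p = 0` is present. -/
lemma besselPhi_add_one {a : ℝ} {κ : ℂ} (h : Admissible a κ) (z : ℂ) :
    besselPhi (a + 1) κ z = a * besselPhi a κ z - κ * z * besselPhi (a - 1) κ z := by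
  rcases h.2 with rfl | h2
  · simp [besselPhi_zero_left, Real.Gamma_add_one h.1.ne']
  · refine (hasSum_besselPhi (a + 1) κ z).unique
      ((((hasSum_besselPhi a κ z).mul_left (a : ℂ)).sub
        (hasSum_mul_besselPhi_sub_one a κ z)).congr_fun fun p => ?_)
    rw [show a + 1 - (p : ℝ) = a - p + 1 by ring,
      Real.Gamma_add_one (sub_ne_zero.2 (h2 p))]
    push_cast
    ring

lemma cpow_eq_sub_one_mul {z : ℂ} (hz : z ≠ 0) (c : ℂ) : z ^ c = z ^ (c - 1) * z := by
  rw [Complex.cpow_sub _ _ hz, Complex.cpow_one, div_mul_cancel₀ _ hz]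

/-- The radial function `z ^ (-a) ∑ Γ(a - p) κ^p z^p / p!`; up to a constant factor,
`z = ρ²` gives a solution of the modified Bessel equation in dimension `2 a + 2`. -/
def besselPsi (a : ℝ) (κ z : ℂ) : ℂ := z ^ (-a : ℂ) * besselPhi a κ z

/-- The product rule yields z^(-a-1) (-a Φ_a + κ z Φ_{a-1}), which is -z^(-a-1) Φ_{a+1} by
contiguity. -/
lemma hasDerivAt_besselPsi {a : ℝ} {κ : ℂ} (h : Admissible a κ) {z : ℂ} (hz : z ∈ Complex.slitPlane) :
    HasDerivAt (besselPsi a κ) (-besselPsi (a + 1) κ z) z := by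
  have hz0 : z ≠ 0 := Complex.slitPlane_ne_zero hz
  have h1 := ((hasDerivAt_id z).cpow_const (c := (-a : ℂ)) hz).mul (hasDerivAt_besselPhi a κ z)
  refine h1.congr_deriv ?_
  rw [besselPsi, besselPhi_add_one h]
  have h2 := cpow_eq_sub_one_mul hz0 (-a : ℂ)
  simp only [id]
  rw [h2, show (-((a + 1 : ℝ) : ℂ)) = -a - 1 by push_cast; ring]
  ring

/-- Together with `hasDerivAt_besselPsi` this is the Bessel-type equation z Ψ'' + (a + 1) Ψ' + κ Ψ =
0. -/
lemma besselPsi_recurrence {a : ℝ} {κ : ℂ} (h : Admissible a κ) {z : ℂ} (hz : z ≠ 0) :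
    z * besselPsi (a + 2) κ z = (a + 1) * besselPsi (a + 1) κ z - κ * besselPsi a κ z := by
  have h1 := besselPhi_add_one h.add_one z
  rw [show a + 1 + 1 = a + 2 by ring, show a + 1 - 1 = a by ring] at h1
  rw [besselPsi, besselPsi, besselPsi, h1]
  have h2 := cpow_eq_sub_one_mul hz (-a : ℂ)
  have h3 := cpow_eq_sub_one_mul hz (-a - 1 : ℂ)
  rw [show (-a - 1 - 1 : ℂ) = -a - 2 by ring] at h3
  rw [show (-((a + 1 : ℝ) : ℂ)) = -a - 1 by push_cast; ring,
    show (-((a + 2 : ℝ) : ℂ)) = -a - 2 by push_cast; ring, h2, h3]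
  push_cast
  ring

/-- Homogeneity: it moves r² out of the argument and into the parameter, turning κ into η = κ r². -/
lemma besselPsi_ofReal_mul (a : ℝ) (κ : ℂ) {z : ℂ} (hz : z ≠ 0) {r : ℝ} (hr : 0 < r) :
    besselPsi a κ (r * z) = ((r ^ (-a) : ℝ) : ℂ) * besselPsi a (κ * r) z := by
  have h1 : besselPhi a κ (r * z) = besselPhi a (κ * r) z := by
    refine tsum_congr fun p => ?_
    rw [mul_pow, mul_pow]; ring
  have hr' : (r : ℂ) ≠ 0 := by exact_mod_cast hr.ne'
  rw [besselPsi, besselPsi, h1, Complex.ofReal_cpow hr.le,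
    Complex.cpow_def_of_ne_zero (mul_ne_zero hr' hz), Complex.cpow_def_of_ne_zero hz,
    Complex.cpow_def_of_ne_zero hr', Complex.log_ofReal_mul hr hz, Complex.ofReal_log hr.le,
    add_mul, Complex.exp_add]
  push_cast
  ring

lemma exists_norm_besselPsi_le (a : ℝ) (κ : ℂ) (M : ℝ) :
    ∃ C : ℝ, 0 ≤ C ∧ ∀ s : ℝ, 0 < s → s ≤ M → ‖besselPsi a κ s‖ ≤ C * s ^ (-a) := by
  obtain ⟨C, hC⟩ := (isCompact_closedBall (0 : ℂ) M).exists_bound_of_continuousOn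
    (continuous_besselPhi a κ).continuousOn
  refine ⟨|C|, abs_nonneg _, fun s hs hsM => ?_⟩
  rw [besselPsi, norm_mul, ← Complex.ofReal_neg, Complex.norm_cpow_eq_rpow_re_of_pos hs,
    Complex.ofReal_re, mul_comm]
  gcongr
  exact (hC s (by simpa [abs_of_pos hs] using hsM)).trans (le_abs_self C)

/-- The mean value inequality for the entire factor at 0 gains one power of `s` over the leading
singularity. -/
lemma exists_norm_besselPsi_sub_le (a : ℝ) (κ : ℂ) (M : ℝ) :
    ∃ C : ℝ, 0 ≤ C ∧ ∀ s : ℝ, 0 < s → s ≤ M →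
      ‖besselPsi a κ s - ((s ^ (-a) * Real.Gamma a : ℝ) : ℂ)‖ ≤ C * s ^ (1 - a) := by
  obtain ⟨C, hC⟩ := (isCompact_closedBall (0 : ℂ) M).exists_bound_of_continuousOn
    ((continuous_besselPhi (a - 1) κ).const_mul κ).continuousOn
  refine ⟨|C|, abs_nonneg _, fun s hs hsM => ?_⟩
  have h1 : ‖besselPhi a κ s - besselPhi a κ 0‖ ≤ |C| * ‖(s : ℂ) - 0‖ := by
    refine (convex_closedBall (0 : ℂ) M).norm_image_sub_le_of_norm_hasDerivWithin_le
      (fun z _ => (hasDerivAt_besselPhi a κ z).hasDerivWithinAt)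
      (fun z hz => (hC z hz).trans (le_abs_self C)) ?_ ?_
    · simp; linarith
    · simpa [abs_of_pos hs] using hsM
  have h2 : besselPsi a κ s - ((s ^ (-a) * Real.Gamma a : ℝ) : ℂ) =
      ((s ^ (-a) : ℝ) : ℂ) * (besselPhi a κ s - besselPhi a κ 0) := by
    rw [besselPsi, besselPhi_zero_right, Complex.ofReal_mul, Complex.ofReal_cpow hs.le]
    push_cast; ring
  rw [h2, norm_mul, Complex.norm_real, Real.norm_of_nonneg (by positivity)]
  rw [sub_zero, Complex.norm_real, Real.norm_of_nonneg hs.le] at h1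
  calc s ^ (-a) * ‖besselPhi a κ s - besselPhi a κ 0‖ ≤ s ^ (-a) * (|C| * s) := by gcongr
    _ = |C| * s ^ (1 - a) := by
      rw [show 1 - a = -a + 1 by ring, Real.rpow_add_one hs.ne']; ring

/-! ### The symmetric beta distribution and its Laplace transform -/

lemma measurable_betaPDF (b : ℝ) : Measurable (ProbabilityTheory.betaPDF b b) :=
  (ProbabilityTheory.measurable_betaPDFReal b b).ennreal_ofReal

open MeasureTheory ProbabilityTheory Filter Topology Set in
lemma ae_betaMeasure (b : ℝ) : ∀ᵐ t ∂betaMeasure b b, t ∈ Ioo (0 : ℝ) 1 := by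
  rw [betaMeasure, ae_withDensity_iff (measurable_betaPDF b)]
  refine Eventually.of_forall fun t ht => ⟨?_, ?_⟩ <;> by_contra! h
  · exact ht (betaPDF_eq_zero_of_nonpos h)
  · exact ht (betaPDF_eq_zero_of_one_le h)

/-- The density of `betaMeasure b b` on `(0, 1)`. -/
def betaDensity (b t : ℝ) : ℝ := 1 / ProbabilityTheory.beta b b * t ^ (b - 1) * (1 - t) ^ (b - 1)

open MeasureTheory ProbabilityTheory Set in
lemma integral_betaMeasure {E : Type*} [NormedAddCommGroup E] [NormedSpace ℝ E] {b : ℝ}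
    (hb : 0 < b) (f : ℝ → E) :
    ∫ t, f t ∂betaMeasure b b = ∫ t in Ioo (0 : ℝ) 1, betaDensity b t • f t := by
  have h0 : ∀ t, 0 ≤ betaPDFReal b b t := fun t => by
    by_cases h : 0 < t ∧ t < 1
    · exact (betaPDFReal_pos h.1 h.2 hb hb).le
    · simp [betaPDFReal, h]
  rw [betaMeasure, integral_withDensity_eq_integral_toReal_smul
    (measurable_betaPDF b) (by simp [betaPDF])]
  rw [← integral_indicator measurableSet_Ioo]
  refine integral_congr_ae (Filter.Eventually.of_forall fun t => ?_)
  simp only [betaPDF, ENNReal.toReal_ofReal (h0 t)]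
  by_cases h : 0 < t ∧ t < 1
  · rw [indicator_of_mem (show t ∈ Ioo (0 : ℝ) 1 from h), betaPDFReal, if_pos h, betaDensity]
  · rw [indicator_of_notMem (show t ∉ Ioo (0 : ℝ) 1 from h), betaPDFReal, if_neg h, zero_smul]

open MeasureTheory ProbabilityTheory Set in
lemma integrable_betaMeasure_iff {E : Type*} [NormedAddCommGroup E] [NormedSpace ℝ E] {b : ℝ}
    (hb : 0 < b) (f : ℝ → E) :
    Integrable f (betaMeasure b b) ↔
      IntegrableOn (fun t => betaDensity b t • f t) (Ioo (0 : ℝ) 1) := by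
  have h0 : ∀ t, 0 ≤ betaPDFReal b b t := fun t => by
    by_cases h : 0 < t ∧ t < 1
    · exact (betaPDFReal_pos h.1 h.2 hb hb).le
    · simp [betaPDFReal, h]
  rw [betaMeasure, integrable_withDensity_iff_integrable_smul'
    (measurable_betaPDF b) (by simp [betaPDF]),
    ← integrable_indicator_iff measurableSet_Ioo]
  refine integrable_congr (Filter.Eventually.of_forall fun t => ?_)
  simp only [betaPDF, ENNReal.toReal_ofReal (h0 t)]
  by_cases h : 0 < t ∧ t < 1
  · rw [indicator_of_mem (show t ∈ Ioo (0 : ℝ) 1 from h), betaPDFReal, if_pos h, betaDensity]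
  · rw [indicator_of_notMem (show t ∉ Ioo (0 : ℝ) 1 from h), betaPDFReal, if_neg h, zero_smul]

open MeasureTheory Set in
lemma integral_rpow_mul_one_sub_rpow {u v : ℝ} (hu : 0 < u) (hv : 0 < v) :
    IntegrableOn (fun t : ℝ => t ^ (u - 1) * (1 - t) ^ (v - 1)) (Ioo 0 1) ∧
    ∫ t in Ioo (0 : ℝ) 1, t ^ (u - 1) * (1 - t) ^ (v - 1) = ProbabilityTheory.beta u v := by
  have hc := Complex.betaIntegral_convergent (u := u) (v := v) (by simpa) (by simpa)
  rw [intervalIntegrable_iff_integrableOn_Ioo_of_le zero_le_one] at hc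
  have heq : EqOn (fun t : ℝ => (t : ℂ) ^ ((u : ℂ) - 1) * (1 - (t : ℂ)) ^ ((v : ℂ) - 1))
      (fun t : ℝ => ((t ^ (u - 1) * (1 - t) ^ (v - 1) : ℝ) : ℂ)) (Ioo 0 1) := by
    intro t ht
    have h1 : (0 : ℝ) ≤ 1 - t := by linarith [ht.2]
    simp only
    rw [Complex.ofReal_mul, Complex.ofReal_cpow ht.1.le, Complex.ofReal_cpow h1]
    push_cast
    rfl
  have hc' : IntegrableOn (fun t : ℝ => ((t ^ (u - 1) * (1 - t) ^ (v - 1) : ℝ) : ℂ)) (Ioo 0 1) :=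
    hc.congr_fun heq measurableSet_Ioo
  refine ⟨by simpa using! hc'.re, ?_⟩
  have h2 := Complex.betaIntegral_eq_Gamma_mul_div u v (by simpa) (by simpa)
  rw [Complex.betaIntegral, intervalIntegral.integral_of_le zero_le_one,
    integral_Ioc_eq_integral_Ioo, setIntegral_congr_fun measurableSet_Ioo heq,
    integral_complex_ofReal, ← Complex.ofReal_add, Complex.Gamma_ofReal, Complex.Gamma_ofReal,
    Complex.Gamma_ofReal] at h2
  rw [ProbabilityTheory.beta]
  exact_mod_cast h2

open MeasureTheory ProbabilityTheory Set in
lemma integral_rpow_betaMeasure {b s : ℝ} (hb : 0 < b) (hs : -b < s) :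
    Integrable (fun t : ℝ => t ^ s) (betaMeasure b b) ∧
    ∫ t, t ^ s ∂betaMeasure b b = beta (b + s) b / beta b b := by
  have heq : EqOn (fun t : ℝ => 1 / beta b b * (t ^ (b + s - 1) * (1 - t) ^ (b - 1)))
      (fun t : ℝ => betaDensity b t • t ^ s) (Ioo 0 1) := by
    intro t ht
    simp only [betaDensity, smul_eq_mul]
    rw [show b + s - 1 = (b - 1) + s by ring, Real.rpow_add ht.1]
    ring
  obtain ⟨h1, h2⟩ := integral_rpow_mul_one_sub_rpow (u := b + s) (by linarith) hb
  rw [integrable_betaMeasure_iff hb, integral_betaMeasure hb,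
    ← setIntegral_congr_fun measurableSet_Ioo heq]
  refine ⟨IntegrableOn.congr_fun (h1.const_mul (1 / beta b b)) heq measurableSet_Ioo, ?_⟩
  rw [integral_const_mul, h2]
  ring

open MeasureTheory ProbabilityTheory Set in
-- The ratio B(b + p, b)/B(b, b) is where the denominator parameters c = 2b of the hypergeometric
-- series come from.
lemma integral_pow_betaMeasure {b : ℝ} (hb : 0 < b) (p : ℕ) :
    Integrable (fun t : ℝ => t ^ p) (betaMeasure b b) ∧
    ∫ t, t ^ p ∂betaMeasure b b = poch b p / poch (2 * b) p := by
  have h := integral_rpow_betaMeasure (s := p) hb (by linarith [(Nat.cast_nonneg p : (0:ℝ) ≤ p)])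
  simp only [Real.rpow_natCast] at h
  refine ⟨h.1, h.2.trans ?_⟩
  have hp : (0 : ℝ) ≤ p := Nat.cast_nonneg p
  have h1 := Real.Gamma_pos_of_pos hb
  have h2 := Real.Gamma_pos_of_pos (show 0 < 2 * b by linarith)
  have h3 := Real.Gamma_pos_of_pos (show 0 < b + p by linarith)
  have h4 := Real.Gamma_pos_of_pos (show 0 < 2 * b + p by linarith)
  rw [ProbabilityTheory.beta, ProbabilityTheory.beta, poch, poch, show b + p + b = 2 * b + p by ring,
    show b + b = 2 * b by ring]
  push_cast
  field_simp

open MeasureTheory ProbabilityTheory Set in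
/-- Integration by parts for the symmetric beta distribution. -/
lemma integral_betaMeasure_by_parts {b : ℝ} (hb : 0 < b) {g g' : ℝ → ℂ}
    (hg : ∀ t ∈ Icc (0 : ℝ) 1, HasDerivAt g (g' t) t) (hg' : ContinuousOn g' (Icc 0 1)) :
    ∫ t, ((b * (1 - 2 * t) : ℝ) * g t + (t * (1 - t) : ℝ) * g' t) ∂betaMeasure b b = 0 := by
  have hgc : ContinuousOn g (Icc 0 1) := fun t ht => (hg t ht).continuousAt.continuousWithinAt
  -- The primitive is the density times t(1 - t) g(t); it vanishes at both endpoints because `b >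
  -- 0`.
  set F : ℝ → ℂ := fun t => ((1 / beta b b * (t ^ b * (1 - t) ^ b) : ℝ) : ℂ) * g t with hF
  have hFc : ContinuousOn F (Icc 0 1) := by
    refine ContinuousOn.mul (Complex.continuous_ofReal.comp_continuousOn
      (Continuous.continuousOn ?_)) hgc
    have h1 : Continuous fun t : ℝ => t ^ b := continuous_id.rpow_const fun _ => Or.inr hb.le
    have h2 : Continuous fun t : ℝ => (1 - t) ^ b :=
      (continuous_const.sub continuous_id).rpow_const fun _ => Or.inr hb.le
    fun_prop
  have hderiv : ∀ t ∈ Ioo (0 : ℝ) 1, HasDerivAt F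
      (betaDensity b t • ((b * (1 - 2 * t) : ℝ) * g t + (t * (1 - t) : ℝ) * g' t)) t := by
    intro t ht
    have ht1 : 0 < 1 - t := by linarith [ht.2]
    have h1 : HasDerivAt (fun t : ℝ => t ^ b) (b * t ^ (b - 1)) t :=
      Real.hasDerivAt_rpow_const (Or.inl ht.1.ne')
    have h2 : HasDerivAt (fun t : ℝ => (1 - t) ^ b) (-(b * (1 - t) ^ (b - 1))) t := by
      have := ((hasDerivAt_id t).const_sub 1).rpow_const (p := b) (Or.inl ht1.ne')
      refine this.congr_deriv ?_
      simp
    have h3 := (((h1.mul h2).const_mul (1 / beta b b)).ofReal_comp).mul (hg t ⟨ht.1.le, ht.2.le⟩)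
    refine h3.congr_deriv ?_
    have e1 : t ^ b = t ^ (b - 1) * t := by rw [← Real.rpow_add_one ht.1.ne']; congr 1; ring
    have e2 : (1 - t) ^ b = (1 - t) ^ (b - 1) * (1 - t) := by
      rw [← Real.rpow_add_one ht1.ne']; congr 1; ring
    simp only [Pi.mul_apply]
    rw [e1, e2, betaDensity, Complex.real_smul]
    push_cast
    ring
  have hint : IntegrableOn
      (fun t => betaDensity b t • ((b * (1 - 2 * t) : ℝ) * g t + (t * (1 - t) : ℝ) * g' t))
      (Icc (0 : ℝ) 1) := by
    have hden : IntegrableOn (betaDensity b) (Icc 0 1) := by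
      rw [integrableOn_Icc_iff_integrableOn_Ioo]
      refine IntegrableOn.congr_fun
        ((integral_rpow_mul_one_sub_rpow hb hb).1.const_mul (1 / beta b b)) ?_ measurableSet_Ioo
      intro t _
      simp [betaDensity, mul_assoc]
    refine hden.smul_continuousOn ?_ isCompact_Icc
    refine ContinuousOn.add (ContinuousOn.mul ?_ hgc) (ContinuousOn.mul ?_ hg')
    · exact (Complex.continuous_ofReal.comp (by fun_prop)).continuousOn
    · exact (Complex.continuous_ofReal.comp (by fun_prop)).continuousOn
  have hftc := intervalIntegral.integral_eq_sub_of_hasDerivAt_of_le zero_le_one hFc hderiv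
    ((intervalIntegrable_iff_integrableOn_Icc_of_le zero_le_one).2 hint)
  rw [integral_betaMeasure hb, ← integral_Ioc_eq_integral_Ioo,
    ← intervalIntegral.integral_of_le zero_le_one, hftc]
  simp [hF, Real.zero_rpow hb.ne']

/-- The Laplace transform of the symmetric beta distribution, rescaled. -/
def betaLaplace (b v : ℝ) : ℝ :=
  v ^ b * ∫ t, Real.exp (-(v * t)) ∂ProbabilityTheory.betaMeasure b b

open MeasureTheory ProbabilityTheory Set in
lemma integrable_exp_betaMeasure {b : ℝ} (hb : 0 < b) {v : ℝ} (hv : 0 ≤ v) :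
    Integrable (fun t => Real.exp (-(v * t))) (betaMeasure b b) := by
  have := isProbabilityMeasureBeta hb hb
  refine Integrable.of_bound (C := 1) (by fun_prop) ?_
  filter_upwards [ae_betaMeasure b] with t ht
  rw [Real.norm_of_nonneg (Real.exp_nonneg _), Real.exp_le_one_iff]
  nlinarith [ht.1]

lemma one_sub_rpow_le_two {b s : ℝ} (hb0 : 0 < b) (hb1 : b < 1) (hs : s ≤ 1 / 2) :
    (1 - s) ^ (b - 1) ≤ 2 := by
  have h2 : (1 / 2 : ℝ) ≤ 1 - s := by linarith
  calc (1 - s) ^ (b - 1) ≤ (1 / 2 : ℝ) ^ (b - 1) :=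
        Real.rpow_le_rpow_of_nonpos (by norm_num) h2 (by linarith)
    _ = 2 ^ (1 - b) := by
        rw [one_div, Real.inv_rpow (by norm_num), ← Real.rpow_neg (by norm_num)]; congr 1; ring
    _ ≤ 2 ^ (1 : ℝ) := Real.rpow_le_rpow_of_exponent_le (by norm_num) (by linarith)
    _ = 2 := Real.rpow_one 2

open MeasureTheory ProbabilityTheory Set in
-- For large `v` the mass near `t = 0` decides. On `t ≤ 1/2` the substitution τ = v t absorbs `v ^
-- b`, while `(1 - t) ^ (b - 1)` stays away from its singularity at 1.
lemma betaLaplace_eq {b : ℝ} (hb : 0 < b) {v : ℝ} (hv : 0 < v) :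
    betaLaplace b v =
      (1 / beta b b) * (∫ τ in Ioi (0 : ℝ), (Iic (v / 2)).indicator
        (fun τ => Real.exp (-τ) * τ ^ (b - 1) * (1 - τ / v) ^ (b - 1)) τ) +
      v ^ b * ∫ t in Ioi (1 / 2), Real.exp (-(v * t)) ∂betaMeasure b b := by
  have hint := integrable_exp_betaMeasure hb hv.le
  rw [betaLaplace, ← integral_add_compl (measurableSet_Ioi (a := (1 / 2 : ℝ))) hint, mul_add,
    add_comm]
  congr 1
  rw [compl_Ioi, ← integral_indicator measurableSet_Iic, integral_betaMeasure hb,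
    ← integral_indicator measurableSet_Ioo]
  set g : ℝ → ℝ := (Iic (v / 2)).indicator
        (fun τ => Real.exp (-τ) * τ ^ (b - 1) * (1 - τ / v) ^ (b - 1)) with hg
  have h1 := integral_comp_mul_left_Ioi g 0 hv
  rw [mul_zero, smul_eq_mul] at h1
  have h2 : ∫ τ in Ioi (0 : ℝ), g τ = v * ∫ x in Ioi (0 : ℝ), g (v * x) := by
    rw [h1]; field_simp
  rw [h2, ← integral_const_mul, ← integral_const_mul, ← integral_const_mul,
    ← integral_indicator measurableSet_Ioi]
  refine integral_congr_ae (Filter.Eventually.of_forall fun t => ?_)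
  simp only
  by_cases ht0 : 0 < t
  · rw [indicator_of_mem (show t ∈ Ioi (0 : ℝ) from ht0)]
    by_cases ht : t ≤ 1 / 2
    · rw [indicator_of_mem (show t ∈ Ioo (0 : ℝ) 1 from ⟨ht0, by linarith⟩),
        indicator_of_mem (show t ∈ Iic (1 / 2 : ℝ) from ht), hg,
        indicator_of_mem (show v * t ∈ Iic (v / 2) from by
          simp only [mem_Iic]; nlinarith), betaDensity, smul_eq_mul, mul_div_cancel_left₀ _ hv.ne',
        Real.mul_rpow hv.le ht0.le]
      have : v ^ b = v ^ (b - 1) * v := by rw [← Real.rpow_add_one hv.ne']; congr 1; ring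
      rw [this]
      ring
    · rw [hg, indicator_of_notMem (show v * t ∉ Iic (v / 2) from by
          simp only [mem_Iic, not_le] at ht ⊢; nlinarith), mul_zero, mul_zero]
      by_cases ht1 : t < 1
      · rw [indicator_of_mem (show t ∈ Ioo (0 : ℝ) 1 from ⟨ht0, ht1⟩),
          indicator_of_notMem (show t ∉ Iic (1 / 2 : ℝ) from ht), smul_zero, mul_zero]
      · rw [indicator_of_notMem (show t ∉ Ioo (0 : ℝ) 1 from fun h => ht1 h.2), mul_zero]
  · rw [indicator_of_notMem (show t ∉ Ioi (0 : ℝ) from ht0),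
      indicator_of_notMem (show t ∉ Ioo (0 : ℝ) 1 from fun h => ht0 h.1), mul_zero]

open MeasureTheory ProbabilityTheory Set in
lemma betaLaplace_tail_le {b : ℝ} (hb : 0 < b) {v : ℝ} (hv : 0 < v) :
    ∫ t in Ioi (1 / 2), Real.exp (-(v * t)) ∂betaMeasure b b ≤ Real.exp (-(1 / 2) * v) := by
  have := isProbabilityMeasureBeta hb hb
  calc ∫ t in Ioi (1 / 2), Real.exp (-(v * t)) ∂betaMeasure b b
      ≤ ∫ t in Ioi (1 / 2), Real.exp (-(1 / 2) * v) ∂betaMeasure b b := by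
        refine setIntegral_mono_on (integrable_exp_betaMeasure hb hv.le).integrableOn
          (integrable_const _).integrableOn measurableSet_Ioi fun t ht => ?_
        rw [Real.exp_le_exp]
        have : (1 / 2 : ℝ) < t := ht
        nlinarith
    _ ≤ Real.exp (-(1 / 2) * v) := by
        rw [setIntegral_const, smul_eq_mul]
        exact mul_le_of_le_one_left (Real.exp_nonneg _) measureReal_le_one

lemma betaLaplace_kernel_le {b : ℝ} (hb : 0 < b) (hb1 : b < 1) {v : ℝ} (hv : 0 < v) {τ : ℝ}
    (hτ : 0 < τ) :
    ‖(Set.Iic (v / 2)).indicator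
      (fun τ => Real.exp (-τ) * τ ^ (b - 1) * (1 - τ / v) ^ (b - 1)) τ‖ ≤
      2 * (Real.exp (-τ) * τ ^ (b - 1)) := by
  by_cases h : τ ≤ v / 2
  · rw [Set.indicator_of_mem (show τ ∈ Set.Iic (v / 2) from h)]
    have h1 : τ / v ≤ 1 / 2 := by rw [div_le_iff₀ hv]; linarith
    have h2 : 0 ≤ 1 - τ / v := by linarith
    rw [Real.norm_of_nonneg (by positivity), mul_comm 2]
    exact mul_le_mul_of_nonneg_left (one_sub_rpow_le_two hb hb1 h1) (by positivity)
  · rw [Set.indicator_of_notMem (show τ ∉ Set.Iic (v / 2) from h), norm_zero]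
    positivity

open MeasureTheory ProbabilityTheory Set Filter Topology in
-- Dominated convergence turns the first part into Γ(b)/B(b, b) = Γ(2b)/Γ(b); the second part is
-- exponentially small.
lemma tendsto_betaLaplace {b : ℝ} (hb : 0 < b) (hb1 : b < 1) :
    Tendsto (betaLaplace b) atTop (𝓝 (Real.Gamma (2 * b) / Real.Gamma b)) := by
  have hG := Real.Gamma_pos_of_pos hb
  have hG2 := Real.Gamma_pos_of_pos (show 0 < 2 * b by linarith)
  have hlim : Real.Gamma (2 * b) / Real.Gamma b = (1 / beta b b) * Real.Gamma b + 0 := by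
    rw [ProbabilityTheory.beta, show b + b = 2 * b by ring]
    field_simp
    ring
  rw [hlim]
  have h1 : Tendsto (fun v : ℝ => ∫ τ in Ioi (0 : ℝ), (Iic (v / 2)).indicator
      (fun τ => Real.exp (-τ) * τ ^ (b - 1) * (1 - τ / v) ^ (b - 1)) τ) atTop
      (𝓝 (Real.Gamma b)) := by
    rw [Real.Gamma_eq_integral hb]
    refine tendsto_integral_filter_of_dominated_convergence
      (fun τ => 2 * (Real.exp (-τ) * τ ^ (b - 1))) ?_ ?_ ?_ ?_
    · refine Eventually.of_forall fun v => ?_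
      refine (Measurable.indicator ?_ measurableSet_Iic).aestronglyMeasurable
      fun_prop
    · filter_upwards [eventually_gt_atTop 0] with v hv
      exact ae_restrict_of_forall_mem measurableSet_Ioi fun τ hτ =>
        betaLaplace_kernel_le hb hb1 hv hτ
    · exact (Real.GammaIntegral_convergent hb).const_mul 2
    · refine ae_restrict_of_forall_mem measurableSet_Ioi fun τ hτ => ?_
      have h2 : Tendsto (fun v : ℝ => Real.exp (-τ) * τ ^ (b - 1) * (1 - τ / v) ^ (b - 1)) atTop
          (𝓝 (Real.exp (-τ) * τ ^ (b - 1) * (1 - 0) ^ (b - 1))) := by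
        refine Tendsto.const_mul _ (Tendsto.rpow_const ?_ (Or.inl (by norm_num)))
        exact tendsto_const_nhds.sub (tendsto_const_nhds.div_atTop tendsto_id)
      rw [sub_zero, Real.one_rpow, mul_one] at h2
      refine h2.congr' ?_
      filter_upwards [eventually_ge_atTop (2 * τ)] with v hv
      rw [indicator_of_mem (show τ ∈ Iic (v / 2) from by simp only [mem_Iic]; linarith)]
  have h2 : Tendsto (fun v : ℝ =>
      v ^ b * ∫ t in Ioi (1 / 2), Real.exp (-(v * t)) ∂betaMeasure b b) atTop (𝓝 0) := by
    refine tendsto_of_tendsto_of_tendsto_of_le_of_le' tendsto_const_nhds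
      (tendsto_rpow_mul_exp_neg_mul_atTop_nhds_zero b (1 / 2) (by norm_num)) ?_ ?_
    · filter_upwards [eventually_gt_atTop 0] with v hv
      exact mul_nonneg (by positivity) (integral_nonneg fun _ => Real.exp_nonneg _)
    · filter_upwards [eventually_gt_atTop 0] with v hv
      exact mul_le_mul_of_nonneg_left (betaLaplace_tail_le hb hv) (by positivity)
  refine ((h1.const_mul (1 / beta b b)).add h2).congr' ?_
  filter_upwards [eventually_gt_atTop 0] with v hv
  exact (betaLaplace_eq hb hv).symm

open MeasureTheory ProbabilityTheory Set Filter Topology in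
-- Convergence controls large `v`; for bounded `v` the integral is at most 1 and `v ^ b` is bounded.
lemma exists_betaLaplace_le {b : ℝ} (hb : 0 < b) (hb1 : b < 1) :
    ∃ C : ℝ, 0 ≤ C ∧ ∀ v : ℝ, 0 < v → ‖betaLaplace b v‖ ≤ C := by
  have := isProbabilityMeasureBeta hb hb
  obtain ⟨N, hN⟩ := ((tendsto_betaLaplace hb hb1).norm.eventually_le_const
    (lt_add_one _)).exists_forall_of_atTop
  refine ⟨max (‖Real.Gamma (2 * b) / Real.Gamma b‖ + 1) (|N| ^ b),
    le_max_of_le_right (by positivity), fun v hv => ?_⟩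
  rcases le_total N v with h | h
  · exact (hN v h).trans (le_max_left _ _)
  · refine le_max_of_le_right ?_
    rw [betaLaplace, norm_mul, Real.norm_of_nonneg (by positivity : 0 ≤ v ^ b)]
    have h1 : ‖∫ t, Real.exp (-(v * t)) ∂betaMeasure b b‖ ≤ 1 := by
      have := norm_integral_le_of_norm_le_const (μ := betaMeasure b b) (C := 1)
        (f := fun t => Real.exp (-(v * t))) (by
          filter_upwards [ae_betaMeasure b] with t ht
          rw [Real.norm_of_nonneg (Real.exp_nonneg _), Real.exp_le_one_iff]
          nlinarith [ht.1])
      simpa using this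
    calc v ^ b * ‖∫ t, Real.exp (-(v * t)) ∂betaMeasure b b‖ ≤ v ^ b * 1 := by gcongr
      _ ≤ |N| ^ b := by
        rw [mul_one]
        exact Real.rpow_le_rpow hv.le (h.trans (le_abs_self N)) hb.le

/-! ### The product beta measure -/

/-- The product of the symmetric beta distributions with parameters `b j`. -/
def betaPi {n : ℕ} (b : Fin n → ℝ) : MeasureTheory.Measure (Fin n → ℝ) :=
  MeasureTheory.Measure.pi fun j => ProbabilityTheory.betaMeasure (b j) (b j)

section
variable {n : ℕ} {b : Fin n → ℝ}

lemma isProbabilityMeasure_betaPi (hb : ∀ j, 0 < b j) :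
    MeasureTheory.IsProbabilityMeasure (betaPi b) := by
  have := fun j => ProbabilityTheory.isProbabilityMeasureBeta (hb j) (hb j)
  unfold betaPi
  infer_instance

lemma ae_betaPi (hb : ∀ j, 0 < b j) : ∀ᵐ t ∂betaPi b, ∀ j, t j ∈ Set.Ioo (0 : ℝ) 1 := by
  have := fun j => ProbabilityTheory.isProbabilityMeasureBeta (hb j) (hb j)
  exact Filter.eventually_all.2 fun j =>
    MeasureTheory.Measure.tendsto_eval_ae_ae.eventually (ae_betaMeasure (b j))

lemma ae_betaPi_Icc (hb : ∀ j, 0 < b j) : ∀ᵐ t ∂betaPi b, t ∈ Set.Icc (0 : Fin n → ℝ) 1 := by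
  filter_upwards [ae_betaPi hb] with t ht
  exact ⟨fun j => (ht j).1.le, fun j => (ht j).2.le⟩

open MeasureTheory in
lemma integrable_betaPi_of_continuousOn {E : Type*} [NormedAddCommGroup E] (hb : ∀ j, 0 < b j)
    {f : (Fin n → ℝ) → E} (hf : ContinuousOn f (Set.Icc 0 1)) : Integrable f (betaPi b) := by
  have := isProbabilityMeasure_betaPi hb
  have h := hf.integrableOn_compact (μ := betaPi b) isCompact_Icc
  rwa [IntegrableOn, Measure.restrict_eq_self_of_ae_mem (ae_betaPi_Icc hb)] at h

open MeasureTheory in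
-- By Fubini the coordinate `t j` may be integrated first, with the others frozen; the inner
-- integral is then zero by the one-dimensional identity.
lemma integral_betaPi_by_parts (hb : ∀ j, 0 < b j) (j : Fin n) {G G' : (Fin n → ℝ) → ℂ}
    (hG : ContinuousOn G (Set.Icc 0 1)) (hG' : ContinuousOn G' (Set.Icc 0 1))
    (hd : ∀ t ∈ Set.Icc (0 : Fin n → ℝ) 1,
      HasDerivAt (fun s => G (Function.update t j s)) (G' t) (t j)) :
    ∫ t, ((b j * (1 - 2 * t j) : ℝ) * G t + (t j * (1 - t j) : ℝ) * G' t) ∂betaPi b = 0 := by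
  have hint : Integrable (fun t : Fin n → ℝ =>
      ((b j * (1 - 2 * t j) : ℝ) * G t + (t j * (1 - t j) : ℝ) * G' t)) (betaPi b) := by
    refine integrable_betaPi_of_continuousOn hb (ContinuousOn.add (ContinuousOn.mul ?_ hG)
      (ContinuousOn.mul ?_ hG'))
    · exact (Complex.continuous_ofReal.comp (by fun_prop)).continuousOn
    · exact (Complex.continuous_ofReal.comp (by fun_prop)).continuousOn
  obtain _ | n := n
  · exact j.elim0
  have hp := fun j => ProbabilityTheory.isProbabilityMeasureBeta (hb j) (hb j)
  have hmp := (measurePreserving_piFinSuccAbove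
    (fun j => ProbabilityTheory.betaMeasure (b j) (b j)) j).symm
  have hint' := (hmp.integrable_comp_emb (MeasurableEquiv.measurableEmbedding _)).2 hint
  rw [betaPi, ← hmp.integral_comp']
  refine (integral_prod_symm _ hint').trans ?_
  refine integral_eq_zero_of_ae ?_
  have hb' : ∀ i : Fin n, 0 < b (j.succAbove i) := fun i => hb _
  filter_upwards [ae_betaPi_Icc hb'] with r hr
  have hmem : ∀ s ∈ Set.Icc (0 : ℝ) 1, j.insertNth s r ∈ Set.Icc (0 : Fin (n + 1) → ℝ) 1 := by
    intro s hs
    constructor <;> intro i <;> refine Fin.succAboveCases j ?_ (fun i => ?_) i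
    · simpa using hs.1
    · simpa using hr.1 i
    · simpa using hs.2
    · simpa using hr.2 i
  have hcont : Continuous fun s : ℝ => (j.insertNth s r : Fin (n + 1) → ℝ) := by fun_prop
  have key := integral_betaMeasure_by_parts (hb j) (g := fun s => G (j.insertNth s r))
    (g' := fun s => G' (j.insertNth s r)) (fun s hs => ?_)
    (hG'.comp hcont.continuousOn hmem)
  · simp only [Pi.zero_apply]
    rw [← key]
    refine integral_congr_ae (Filter.Eventually.of_forall fun s => ?_)
    simp [MeasurableEquiv.piFinSuccAbove_symm_apply, Fin.insertNthEquiv]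
  · have h := hd _ (hmem s hs)
    have hupd : ∀ s' : ℝ, Function.update (j.insertNth s r : Fin (n + 1) → ℝ) j s' =
        j.insertNth s' r := by
      intro s'
      funext i
      refine Fin.succAboveCases j ?_ (fun i => ?_) i
      · simp
      · simp
    simpa [hupd] using h

end

/-! ### Averages over linear forms and their differentiability -/

/-- The set of `(s, y)` such that `s + ∑ t_j y_j` has positive real part for all `t ∈ [0, 1]^n`. -/
def tubeDomain (n : ℕ) : Set (ℂ × (Fin n → ℂ)) := {w | 0 < w.1.re + ∑ j, min (w.2 j).re 0}

lemma isOpen_tubeDomain (n : ℕ) : IsOpen (tubeDomain n) := by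
  refine isOpen_lt continuous_const ?_
  refine Continuous.add (by fun_prop) (continuous_finsetSum _ fun j _ => ?_)
  exact (Complex.continuous_re.comp ((continuous_apply j).comp continuous_snd)).min
    continuous_const

/-- The linear form `(s, y) ↦ s + ∑ t_j y_j`. -/
def tubeForm {n : ℕ} (t : Fin n → ℝ) : ℂ × (Fin n → ℂ) →L[ℂ] ℂ :=
  ContinuousLinearMap.fst ℂ ℂ (Fin n → ℂ) + ∑ j, (t j : ℂ) •
    (ContinuousLinearMap.proj (R := ℂ) j).comp (ContinuousLinearMap.snd ℂ ℂ (Fin n → ℂ))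

section
variable {n : ℕ} {b : Fin n → ℝ}

lemma tubeForm_apply (t : Fin n → ℝ) (w : ℂ × (Fin n → ℂ)) :
    tubeForm t w = w.1 + ∑ j, (t j : ℂ) * w.2 j := by
  simp [tubeForm]

lemma continuous_tubeForm : Continuous (tubeForm (n := n)) := by
  unfold tubeForm
  refine continuous_const.add (continuous_finsetSum _ fun j _ => ?_)
  exact (Complex.continuous_ofReal.comp (continuous_apply j)).smul continuous_const

lemma continuous_tubeForm_apply (w : ℂ × (Fin n → ℂ)) :
    Continuous fun t : Fin n → ℝ => tubeForm t w := by
  simp only [tubeForm_apply]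
  fun_prop

lemma re_tubeForm_le {t : Fin n → ℝ} (ht : t ∈ Set.Icc (0 : Fin n → ℝ) 1) (w : ℂ × (Fin n → ℂ)) :
    w.1.re + ∑ j, min (w.2 j).re 0 ≤ (tubeForm t w).re := by
  rw [tubeForm_apply, Complex.add_re, Complex.re_sum]
  refine add_le_add_right (Finset.sum_le_sum fun j _ => ?_) _
  rw [Complex.re_ofReal_mul]
  have h0 : 0 ≤ t j := ht.1 j
  have h1 : t j ≤ 1 := ht.2 j
  rcases le_total (w.2 j).re 0 with h | h
  · rw [min_eq_left h]; nlinarith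
  · rw [min_eq_right h]; positivity

lemma tubeForm_mem_slitPlane {t : Fin n → ℝ} (ht : t ∈ Set.Icc (0 : Fin n → ℝ) 1)
    {w : ℂ × (Fin n → ℂ)} (hw : w ∈ tubeDomain n) : tubeForm t w ∈ Complex.slitPlane :=
  Or.inl (lt_of_lt_of_le hw (re_tubeForm_le ht w))

lemma measurable_besselPsi (a : ℝ) (κ : ℂ) : Measurable (besselPsi a κ) := by
  have := (continuous_besselPhi a κ).measurable
  unfold besselPsi
  fun_prop

/-- Averages of `besselPsi` along the linear forms `s + ∑ t_j y_j`. -/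
def betaTransform (b : Fin n → ℝ) (a : ℝ) (κ : ℂ) (p : (Fin n → ℝ) → ℂ)
    (w : ℂ × (Fin n → ℂ)) : ℂ :=
  ∫ t, p t * besselPsi a κ (tubeForm t w) ∂betaPi b

lemma continuousOn_besselPsi_tubeForm {a : ℝ} {κ : ℂ} (ha : Admissible a κ)
    {w : ℂ × (Fin n → ℂ)} (hw : w ∈ tubeDomain n) :
    ContinuousOn (fun t => besselPsi a κ (tubeForm t w)) (Set.Icc 0 1) := fun _ ht =>
  ContinuousAt.continuousWithinAt (ContinuousAt.comp (f := fun t => tubeForm t w)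
    (hasDerivAt_besselPsi ha (tubeForm_mem_slitPlane ht hw)).continuousAt
    (continuous_tubeForm_apply w).continuousAt)

lemma integrable_betaTransform (hb : ∀ j, 0 < b j) {a : ℝ} {κ : ℂ} (ha : Admissible a κ)
    {p : (Fin n → ℝ) → ℂ} (hp : Continuous p) {w : ℂ × (Fin n → ℂ)} (hw : w ∈ tubeDomain n) :
    MeasureTheory.Integrable (fun t => p t * besselPsi a κ (tubeForm t w)) (betaPi b) :=
  integrable_betaPi_of_continuousOn hb (hp.continuousOn.mul (continuousOn_besselPsi_tubeForm ha hw))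

open MeasureTheory in
-- Differentiation under the integral raises `a` by one and multiplies the weight `p` by 1 or by a
-- coordinate `t j`. The family of transforms with continuous weights is thus closed under
-- differentiation, which drives the induction in `contDiffOn_betaTransform`.
lemma hasFDerivAt_betaTransform (hb : ∀ j, 0 < b j) {a : ℝ} {κ : ℂ} (ha : Admissible a κ)
    {p : (Fin n → ℝ) → ℂ} (hp : Continuous p) {w : ℂ × (Fin n → ℂ)} (hw : w ∈ tubeDomain n) :
    HasFDerivAt (betaTransform b a κ p)
      (-(betaTransform b (a + 1) κ p w • ContinuousLinearMap.fst ℂ ℂ (Fin n → ℂ) +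
        ∑ j, betaTransform b (a + 1) κ (fun t => p t * t j) w •
          (ContinuousLinearMap.proj (R := ℂ) j).comp
            (ContinuousLinearMap.snd ℂ ℂ (Fin n → ℂ)))) w := by
  have hprob := isProbabilityMeasure_betaPi hb
  -- Half the lower bound for the real part of the forms at `w`. On the neighbourhood `s` all forms
  -- take values in the compact set `Kc`, off the branch cut, which gives a uniform bound for the
  -- derivative.
  set c : ℝ := (w.1.re + ∑ j, min (w.2 j).re 0) / 2 with hc
  have hw' : 0 < w.1.re + ∑ j, min (w.2 j).re 0 := hw
  have hc0 : 0 < c := by positivity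
  obtain ⟨A, hA⟩ := (isCompact_Icc (a := (0 : Fin n → ℝ)) (b := 1)).exists_bound_of_continuousOn
    (continuous_tubeForm (n := n)).continuousOn
  obtain ⟨B, hB⟩ := (isCompact_Icc (a := (0 : Fin n → ℝ)) (b := 1)).exists_bound_of_continuousOn
    hp.continuousOn
  set s : Set (ℂ × (Fin n → ℂ)) :=
    {w' | c < w'.1.re + ∑ j, min (w'.2 j).re 0} ∩ Metric.ball w 1 with hs
  have hso : IsOpen s := by
    refine IsOpen.inter (isOpen_lt continuous_const ?_) Metric.isOpen_ball
    refine Continuous.add (by fun_prop) (continuous_finsetSum _ fun j _ => ?_)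
    exact (Complex.continuous_re.comp ((continuous_apply j).comp continuous_snd)).min
      continuous_const
  have hsw : w ∈ s := ⟨by simp only [Set.mem_ofPred_eq]; linarith, Metric.mem_ball_self one_pos⟩
  have hsD : s ⊆ tubeDomain n := fun w' h => hc0.trans h.1
  set Kc : Set ℂ := {z | c ≤ z.re} ∩ Metric.closedBall 0 (|A| * (‖w‖ + 1)) with hKc
  have hKcomp : IsCompact Kc :=
    (isCompact_closedBall _ _).inter_left (isClosed_le continuous_const Complex.continuous_re)
  have hKcont : ContinuousOn (besselPsi (a + 1) κ) Kc := fun z hz =>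
    (hasDerivAt_besselPsi ha.add_one (Or.inl (hc0.trans_le hz.1))).continuousAt.continuousWithinAt
  obtain ⟨M, hM⟩ := hKcomp.exists_bound_of_continuousOn hKcont
  have hmemK : ∀ t ∈ Set.Icc (0 : Fin n → ℝ) 1, ∀ w' ∈ s, tubeForm t w' ∈ Kc := by
    intro t ht w' hw'
    refine ⟨hw'.1.le.trans (re_tubeForm_le ht w'), ?_⟩
    rw [mem_closedBall_zero_iff]
    have h1 : ‖w'‖ ≤ ‖w‖ + 1 := by
      have h2 := norm_sub_norm_le w' w
      have h3 : ‖w' - w‖ < 1 := by simpa [dist_eq_norm] using hw'.2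
      linarith
    calc ‖tubeForm t w'‖ ≤ ‖tubeForm t‖ * ‖w'‖ := (tubeForm t).le_opNorm w'
      _ ≤ |A| * (‖w‖ + 1) := by
        gcongr
        exact (hA t ht).trans (le_abs_self A)
  have hmeas : ∀ a' : ℝ, ∀ w', AEStronglyMeasurable
      (fun t => p t * besselPsi a' κ (tubeForm t w')) (betaPi b) := fun a' w' =>
    (hp.measurable.mul ((measurable_besselPsi a' κ).comp
      (continuous_tubeForm_apply w').measurable)).aestronglyMeasurable
  have key := hasFDerivAt_integral_of_dominated_of_fderiv_le (μ := betaPi b) (𝕜 := ℂ)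
    (F := fun w t => p t * besselPsi a κ (tubeForm t w))
    (F' := fun w t => (p t * -besselPsi (a + 1) κ (tubeForm t w)) • tubeForm t)
    (bound := fun _ => |B| * |M| * |A|) (hso.mem_nhds hsw)
    (Filter.Eventually.of_forall fun w' => hmeas a w') (integrable_betaTransform hb ha hp hw)
    ?_ ?_ (integrable_const _) ?_
  · refine key.congr_fderiv ?_
    have hfun : ∀ t : Fin n → ℝ, (p t * -besselPsi (a + 1) κ (tubeForm t w)) • tubeForm t =
        -((p t * besselPsi (a + 1) κ (tubeForm t w)) • ContinuousLinearMap.fst ℂ ℂ (Fin n → ℂ) +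
          ∑ j, (p t * t j * besselPsi (a + 1) κ (tubeForm t w)) •
            (ContinuousLinearMap.proj (R := ℂ) j).comp
              (ContinuousLinearMap.snd ℂ ℂ (Fin n → ℂ))) := by
      intro t
      generalize besselPsi (a + 1) κ (tubeForm t w) = z
      refine ContinuousLinearMap.ext fun v => ?_
      simp only [FunLike.coe_smul, FunLike.coe_neg, FunLike.coe_add, Pi.smul_apply, Pi.neg_apply,
        Pi.add_apply, tubeForm_apply, sum_apply, smul_eq_mul,
        ContinuousLinearMap.coe_fst', ContinuousLinearMap.comp_apply,
        ContinuousLinearMap.proj_apply, ContinuousLinearMap.coe_snd']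
      rw [mul_add, Finset.mul_sum, neg_add, ← Finset.sum_neg_distrib]
      refine congrArg₂ _ (by ring) (Finset.sum_congr rfl fun j _ => by ring)
    have hpj : ∀ j : Fin n, Continuous fun t : Fin n → ℝ => p t * t j := fun j => by fun_prop
    simp_rw [hfun]
    rw [integral_neg, integral_add, integral_smul_const, integral_finsetSum]
    · simp_rw [integral_smul_const]
      rfl
    · exact fun j _ => (integrable_betaTransform hb ha.add_one (hpj j) hw).smul_const _
    · exact (integrable_betaTransform hb ha.add_one hp hw).smul_const _
    · exact integrable_finsetSum _ fun j _ =>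
        (integrable_betaTransform hb ha.add_one (hpj j) hw).smul_const _
  · have h1 : AEStronglyMeasurable (fun t => p t * -besselPsi (a + 1) κ (tubeForm t w))
        (betaPi b) := by
      simpa using! (hmeas (a + 1) w).neg
    exact h1.smul (continuous_tubeForm (n := n)).aestronglyMeasurable
  · filter_upwards [ae_betaPi_Icc hb] with t ht w' hw'
    rw [norm_smul, norm_mul, norm_neg]
    gcongr
    · exact (hB t ht).trans (le_abs_self B)
    · exact (hM _ (hmemK t ht w' hw')).trans (le_abs_self M)
    · exact (hA t ht).trans (le_abs_self A)
  · filter_upwards [ae_betaPi_Icc hb] with t ht w' hw'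
    have h1 := (hasDerivAt_besselPsi ha (tubeForm_mem_slitPlane ht (hsD hw'))).comp_hasFDerivAt w'
      (tubeForm t).hasFDerivAt
    refine (h1.const_mul (p t)).congr_fderiv ?_
    rw [smul_smul]

lemma contDiffOn_betaTransform (hb : ∀ j, 0 < b j) (N : ℕ) {a : ℝ} {κ : ℂ} (ha : Admissible a κ)
    {p : (Fin n → ℝ) → ℂ} (hp : Continuous p) :
    ContDiffOn ℂ N (betaTransform b a κ p) (tubeDomain n) := by
  induction N generalizing a p with
  | zero =>
    exact contDiffOn_zero.2 fun w hw =>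
      (hasFDerivAt_betaTransform hb ha hp hw).continuousAt.continuousWithinAt
  | succ N ih =>
    push_cast
    rw [contDiffOn_succ_iff_hasFDerivWithinAt_of_uniqueDiffOn (isOpen_tubeDomain n).uniqueDiffOn]
    refine ⟨by simp, _, ?_, fun w hw => (hasFDerivAt_betaTransform hb ha hp hw).hasFDerivWithinAt⟩
    refine (ContDiffOn.add ((ih ha.add_one hp).smul contDiffOn_const)
      (ContDiffOn.sum fun j _ => (ih ha.add_one ?_).smul contDiffOn_const)).neg
    fun_prop

end

/-! ### Multiple power series -/

/-- The multinomial theorem on the layer |m| = N: series whose coefficients depend on `m` only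
through |m| reduce to one variable. -/
lemma sum_piAntidiag_mul_prod_pow_div_factorial {n : ℕ} {R : Type*} [Field R] [CharZero R]
    (f : ℕ → R) (z : Fin n → R) (N : ℕ) :
    ∑ m ∈ Finset.piAntidiag Finset.univ N, f (∑ j, m j) * ∏ j, z j ^ m j / (m j).factorial =
      f N * ((∑ j, z j) ^ N / N.factorial) := by
  rw [Finset.sum_pow_eq_sum_piAntidiag, Finset.sum_div, Finset.mul_sum]
  refine Finset.sum_congr rfl fun m hm => ?_
  have hN : ∑ j, m j = N := (Finset.mem_piAntidiag.1 hm).1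
  have h1 := Nat.multinomial_spec Finset.univ m
  rw [hN] at h1
  have h2 : (∏ j, ((m j).factorial : R)) * (Nat.multinomial Finset.univ m : R) = N.factorial := by
    exact_mod_cast h1
  have h3 : (∏ j, ((m j).factorial : R)) ≠ 0 :=
    Finset.prod_ne_zero_iff.2 fun j _ => by exact_mod_cast (m j).factorial_ne_zero
  have h4 : (N.factorial : R) ≠ 0 := by exact_mod_cast N.factorial_ne_zero
  rw [hN, Finset.prod_div_distrib]
  congr 1
  rw [div_eq_div_iff h3 h4, ← h2]
  ring

lemma summable_multiindex {n : ℕ} {f : ℕ → ℝ} (hf : ∀ N, 0 ≤ f N) {z : Fin n → ℝ}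
    (hz : ∀ j, 0 ≤ z j) (hs : Summable fun N => f N * ((∑ j, z j) ^ N / N.factorial)) :
    Summable fun m : Fin n → ℕ => f (∑ j, m j) * ∏ j, z j ^ m j / (m j).factorial := by
  have h0 : ∀ m : Fin n → ℕ, 0 ≤ f (∑ j, m j) * ∏ j, z j ^ m j / (m j).factorial := fun m =>
    mul_nonneg (hf _) (Finset.prod_nonneg fun j _ => div_nonneg (pow_nonneg (hz j) _) (by positivity))
  refine summable_of_sum_le h0 (c := ∑' N, f N * ((∑ j, z j) ^ N / N.factorial)) fun u => ?_
  have hmaps : ∀ m ∈ u, ∑ j, m j ∈ u.image fun m => ∑ j, m j := fun m hm =>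
    Finset.mem_image_of_mem _ hm
  rw [← Finset.sum_fiberwise_of_maps_to hmaps]
  refine le_trans (Finset.sum_le_sum fun N _ => ?_) (hs.sum_le_tsum _ fun N _ =>
    mul_nonneg (hf N) (div_nonneg (pow_nonneg (Finset.sum_nonneg fun j _ => hz j) _)
      (by positivity)))
  rw [← sum_piAntidiag_mul_prod_pow_div_factorial]
  refine Finset.sum_le_sum_of_subset_of_nonneg (fun m hm => ?_) fun m _ _ => h0 m
  exact Finset.mem_piAntidiag.2 ⟨(Finset.mem_filter.1 hm).2, fun _ _ => Finset.mem_univ _⟩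

lemma hasSum_multiindex {n : ℕ} {f : ℕ → ℂ} {z : Fin n → ℂ} {S : ℂ}
    (hs : Summable fun N => ‖f N‖ * ((∑ j, ‖z j‖) ^ N / N.factorial))
    (hS : HasSum (fun N => f N * ((∑ j, z j) ^ N / N.factorial)) S) :
    HasSum (fun m : Fin n → ℕ => f (∑ j, m j) * ∏ j, z j ^ m j / (m j).factorial) S := by
  have h1 := summable_multiindex (f := fun N => ‖f N‖) (fun _ => norm_nonneg _)
    (fun j => norm_nonneg (z j)) hs
  have h2 : Summable fun m : Fin n → ℕ => f (∑ j, m j) * ∏ j, z j ^ m j / (m j).factorial := by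
    refine Summable.of_norm (h1.congr fun m => ?_)
    rw [norm_mul, norm_prod]
    congr 1
    refine Finset.prod_congr rfl fun j _ => ?_
    rw [norm_div, norm_pow, Complex.norm_natCast]
  have h3 := h2.hasSum.tsum_fiberwise fun m : Fin n → ℕ => ∑ j, m j
  have h4 : ∀ N : ℕ, ∑' m : ↑((fun m : Fin n → ℕ => ∑ j, m j) ⁻¹' {N}),
      (f (∑ j, (m : Fin n → ℕ) j) * ∏ j, z j ^ (m : Fin n → ℕ) j / ((m : Fin n → ℕ) j).factorial) =
      f N * ((∑ j, z j) ^ N / N.factorial) := by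
    intro N
    have hset : (fun m : Fin n → ℕ => ∑ j, m j) ⁻¹' {N} =
        ↑(Finset.piAntidiag (Finset.univ : Finset (Fin n)) N) := by
      ext m
      simp [Finset.mem_piAntidiag]
    rw [hset, Finset.tsum_subtype' _
      (fun m : Fin n → ℕ => f (∑ j, m j) * ∏ j, z j ^ m j / (m j).factorial),
      sum_piAntidiag_mul_prod_pow_div_factorial]
  rw [← (h3.congr_fun fun N => (h4 N).symm).unique hS]
  exact h2.hasSum

lemma Gamma_add_nat_eq {β : ℝ} (hβ : ∀ N : ℕ, β + N ≠ 0) (N : ℕ) :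
    (Real.Gamma (β + N) : ℂ) =
      Real.Gamma β * (N.factorial * Ring.choose ((β : ℂ) + N - 1) N) := by
  have h1 : (N.factorial : ℂ) * Ring.choose ((β : ℂ) + N - 1) N =
      (ascPochhammer ℂ N).eval (β : ℂ) := by
    rw [Ring.choose, ← Polynomial.ascPochhammer_smeval_eq_eval,
      ← Ring.factorial_nsmul_multichoose_eq_ascPochhammer, nsmul_eq_mul]
    congr 2
    ring
  rw [h1]
  clear h1
  induction N with
  | zero => simp
  | succ N ih =>
    rw [ascPochhammer_succ_eval, ← mul_assoc, ← ih,
      show β + ((N + 1 : ℕ) : ℝ) = β + N + 1 by push_cast; ring, Real.Gamma_add_one (hβ N)]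
    push_cast
    ring

/-- The binomial series. It is applied with β = a - p, so β may be negative and only the poles of Γ
are excluded. -/
lemma hasSum_Gamma_mul_pow {β : ℝ} (hβ : ∀ N : ℕ, β + N ≠ 0) {z : ℂ} (hz : ‖z‖ < 1) :
    HasSum (fun N : ℕ => (Real.Gamma (β + N) : ℂ) * (z ^ N / N.factorial))
      (Real.Gamma β * (1 - z) ^ (-β : ℂ)) := by
  have h := (Complex.one_div_one_sub_cpow_hasFPowerSeriesOnBall_zero (β : ℂ)).hasSum
    (y := z) (by rw [← ENNReal.ofReal_one, Metric.eball_ofReal]; simpa using hz)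
  simp only [FormalMultilinearSeries.ofScalars_apply_eq, zero_add, smul_eq_mul] at h
  rw [one_div, ← Complex.cpow_neg] at h
  refine (h.mul_left (Real.Gamma β : ℂ)).congr_fun fun N => ?_
  have h2 : (N.factorial : ℂ) ≠ 0 := by exact_mod_cast N.factorial_ne_zero
  rw [Gamma_add_nat_eq hβ]
  field_simp

lemma hasSum_Gamma_mul_pow_real {β : ℝ} (hβ : 0 < β) {x : ℝ} (hx0 : 0 ≤ x) (hx : x < 1) :
    HasSum (fun N : ℕ => Real.Gamma (β + N) * (x ^ N / N.factorial))
      (Real.Gamma β * (1 - x) ^ (-β)) := by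
  have h := hasSum_Gamma_mul_pow (β := β) (z := x) (fun N => by positivity)
    (by rwa [Complex.norm_real, Real.norm_of_nonneg hx0])
  rw [← Complex.hasSum_ofReal]
  convert! h using 1
  · ext N; push_cast; rfl
  · rw [Complex.ofReal_mul, Complex.ofReal_cpow (by linarith)]
    push_cast; rfl

/-- Each step in `N` multiplies the left side by |a - p + N| ≤ a + p + N. The majorant is a binomial
series with positive terms whose sum grows only geometrically in `p`. -/
lemma abs_Gamma_sub_add_le {a C : ℝ} (ha : 0 < a) (p : ℕ) (hp : ∀ N : ℕ, a - p + N ≠ 0)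
    (hC : |Real.Gamma (a - p)| ≤ C) (N : ℕ) :
    |Real.Gamma (a - p + N)| ≤ C / Real.Gamma (a + p) * Real.Gamma (a + p + N) := by
  have hG : 0 < Real.Gamma (a + p) := Real.Gamma_pos_of_pos (by positivity)
  induction N with
  | zero => simp only [Nat.cast_zero, add_zero]; rwa [div_mul_cancel₀ _ hG.ne']
  | succ N ih =>
    have h2 : a + p + N ≠ 0 := by positivity
    rw [show a - p + ((N + 1 : ℕ) : ℝ) = a - p + N + 1 by push_cast; ring,
      show a + p + ((N + 1 : ℕ) : ℝ) = a + p + N + 1 by push_cast; ring,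
      Real.Gamma_add_one (hp N), Real.Gamma_add_one h2, abs_mul]
    have h3 : |a - p + N| ≤ a + p + N := by
      have : (0 : ℝ) ≤ p := by positivity
      have : (0 : ℝ) ≤ N := by positivity
      rw [abs_le]; constructor <;> linarith
    calc |a - p + N| * |Real.Gamma (a - p + N)|
        ≤ (a + p + N) * (C / Real.Gamma (a + p) * Real.Gamma (a + p + N)) :=
          mul_le_mul h3 ih (abs_nonneg _) (by positivity)
      _ = _ := by ring

/-- Poles of Γ have to be avoided only in those layers where `κ ^ p` is not zero. -/
lemma Admissible.sub_add_ne_zero {a : ℝ} {κ : ℂ} (h : Admissible a κ) {p : ℕ}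
    (hp : κ ≠ 0 ∨ p = 0) (N : ℕ) : a - p + N ≠ 0 := by
  have ha := h.1
  rcases hp with hκ | rfl
  · have h2 := h.2.resolve_left hκ
    intro h0
    have hle : N ≤ p := by
      by_contra! hlt
      have : (p : ℝ) < N := by exact_mod_cast hlt
      linarith
    refine h2 (p - N) ?_
    rw [Nat.cast_sub hle]
    linarith
  · push_cast
    positivity

/-- The general term of the expansion of `besselPsi a κ (1 - ∑ z_j)` in powers of `z` and `κ`. -/
def psiTerm {n : ℕ} (a : ℝ) (κ : ℂ) (z : Fin n → ℂ) (q : (Fin n → ℕ) × ℕ) : ℂ :=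
  ((Real.Gamma (a - q.2 + (∑ j, q.1 j : ℕ)) : ℂ) * ∏ j, z j ^ q.1 j / (q.1 j).factorial) *
    (κ ^ q.2 / q.2.factorial)

lemma norm_psiTerm {n : ℕ} (a : ℝ) (κ : ℂ) (z : Fin n → ℂ) (q : (Fin n → ℕ) × ℕ) :
    ‖psiTerm a κ z q‖ = (|Real.Gamma (a - q.2 + (∑ j, q.1 j : ℕ))| *
      ∏ j, ‖z j‖ ^ q.1 j / (q.1 j).factorial) * (‖κ‖ ^ q.2 / q.2.factorial) := by
  rw [psiTerm, norm_mul, norm_mul, norm_prod, norm_div, norm_pow, Complex.norm_natCast,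
    Complex.norm_real, Real.norm_eq_abs]
  congr 2
  refine Finset.prod_congr rfl fun j _ => ?_
  rw [norm_div, norm_pow, Complex.norm_natCast]

lemma summable_abs_Gamma_sub_add {a : ℝ} {κ : ℂ} (ha : Admissible a κ) {C : ℝ}
    (hC : ∀ p : ℕ, |Real.Gamma (a - p)| ≤ C) {p : ℕ} (hp : κ ≠ 0 ∨ p = 0) {x : ℝ}
    (hx0 : 0 ≤ x) (hx : x < 1) :
    Summable (fun N : ℕ => |Real.Gamma (a - p + N)| * (x ^ N / N.factorial)) ∧
    ∑' N : ℕ, |Real.Gamma (a - p + N)| * (x ^ N / N.factorial) ≤ C * (1 - x) ^ (-(a + p)) := by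
  have ha0 := ha.1
  have hG : 0 < Real.Gamma (a + p) := Real.Gamma_pos_of_pos (by positivity)
  have h1 := (hasSum_Gamma_mul_pow_real (β := a + p) (by positivity) hx0 hx).mul_left
    (C / Real.Gamma (a + p))
  have h2 : ∀ N : ℕ, |Real.Gamma (a - p + N)| * (x ^ N / N.factorial) ≤
      C / Real.Gamma (a + p) * (Real.Gamma (a + p + N) * (x ^ N / N.factorial)) := fun N => by
    rw [← mul_assoc]
    exact mul_le_mul_of_nonneg_right
      (abs_Gamma_sub_add_le ha0 p (ha.sub_add_ne_zero hp) (hC p) N) (by positivity)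
  have h3 := h1.summable.of_nonneg_of_le (fun N => by positivity) h2
  refine ⟨h3, (h3.tsum_le_tsum h2 h1.summable).trans_eq ?_⟩
  rw [h1.tsum_eq]
  field_simp

/-- With x = ∑ ‖z_j‖, the layer `p` contributes at most C (1 - x)^(-(a + p)) ‖κ‖^p / p!, and these
bounds form an exponential series. -/
lemma summable_norm_psiTerm {n : ℕ} {a : ℝ} {κ : ℂ} (ha : Admissible a κ) {z : Fin n → ℂ}
    (hz : ∑ j, ‖z j‖ < 1) : Summable fun q => ‖psiTerm a κ z q‖ := by
  obtain ⟨C, hC0, hC⟩ := exists_bound_Gamma_sub_nat a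
  have hx0 : 0 ≤ ∑ j, ‖z j‖ := Finset.sum_nonneg fun _ _ => norm_nonneg _
  rw [← (Equiv.prodComm ℕ (Fin n → ℕ)).summable_iff]
  refine (summable_prod_of_nonneg fun _ => norm_nonneg _).2 ?_
  simp only [Equiv.prodComm_apply, Prod.swap_prod_mk, norm_psiTerm]
  -- Every layer either is free of poles or carries a vanishing power of `κ`.
  have hsplit : ∀ p : ℕ, (κ ≠ 0 ∨ p = 0) ∨ ‖κ‖ ^ p / p.factorial = 0 := by
    intro p
    by_cases hκ : κ = 0
    · by_cases hp : p = 0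
      · exact Or.inl (Or.inr hp)
      · exact Or.inr (by simp [hκ, hp])
    · exact Or.inl (Or.inl hκ)
  have hsum : ∀ p : ℕ, (κ ≠ 0 ∨ p = 0) → Summable fun m : Fin n → ℕ =>
      |Real.Gamma (a - p + (∑ j, m j : ℕ))| * ∏ j, ‖z j‖ ^ m j / (m j).factorial := fun p hp =>
    summable_multiindex (f := fun N => |Real.Gamma (a - p + N)|) (fun _ => abs_nonneg _)
      (fun j => norm_nonneg (z j)) (summable_abs_Gamma_sub_add ha hC hp hx0 hz).1
  constructor
  · intro p
    rcases hsplit p with hp | hp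
    · exact (hsum p hp).mul_right _
    · simp only [hp, mul_zero]; exact summable_zero
  · have hx1 : 0 < 1 - ∑ j, ‖z j‖ := by linarith
    refine Summable.of_nonneg_of_le (fun p => tsum_nonneg fun m => by positivity) (fun p => ?_)
      ((Real.summable_pow_div_factorial (‖κ‖ * (1 - ∑ j, ‖z j‖)⁻¹)).mul_left
        (C * (1 - ∑ j, ‖z j‖) ^ (-a)))
    rcases hsplit p with hp | hp
    · rw [tsum_mul_right]
      have h1 := (hasSum_multiindex (f := fun N => ((|Real.Gamma (a - p + N)| : ℝ) : ℂ))
        (z := fun j => ((‖z j‖ : ℝ) : ℂ))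
        (S := ((∑' N : ℕ, |Real.Gamma (a - p + N)| *
          ((∑ j, ‖z j‖) ^ N / N.factorial) : ℝ) : ℂ)) ?_ ?_)
      · have h2 : HasSum (fun m : Fin n → ℕ => |Real.Gamma (a - p + (∑ j, m j : ℕ))| *
            ∏ j, ‖z j‖ ^ m j / (m j).factorial) (∑' N : ℕ, |Real.Gamma (a - p + N)| *
            ((∑ j, ‖z j‖) ^ N / N.factorial)) := by
          rw [← Complex.hasSum_ofReal]
          refine h1.congr_fun fun m => ?_
          push_cast
          rfl
        rw [h2.tsum_eq]
        calc _ ≤ C * (1 - ∑ j, ‖z j‖) ^ (-(a + p)) * (‖κ‖ ^ p / p.factorial) :=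
              mul_le_mul_of_nonneg_right (summable_abs_Gamma_sub_add ha hC hp hx0 hz).2
                (by positivity)
          _ = _ := by
            rw [neg_add, Real.rpow_add hx1, Real.rpow_neg hx1.le (p : ℝ), Real.rpow_natCast,
              mul_pow, inv_pow]
            ring
      · simpa using (summable_abs_Gamma_sub_add ha hC hp hx0 hz).1
      · have := (summable_abs_Gamma_sub_add ha hC hp hx0 hz).1.hasSum
        rw [← Complex.hasSum_ofReal] at this
        refine this.congr_fun fun N => ?_
        push_cast
        rfl
    · simp only [hp, mul_zero, tsum_zero]
      positivity

/-- For fixed `p` the sum over the multi-indices is the binomial series of (1 - ∑ z_j)^(-(a - p));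
summing over `p` gives the series of `besselPhi` at 1 - ∑ z_j. Absolute convergence permits this
order of summation. -/
lemma hasSum_psiTerm {n : ℕ} {a : ℝ} {κ : ℂ} (ha : Admissible a κ) {z : Fin n → ℂ}
    (hz : ∑ j, ‖z j‖ < 1) : HasSum (psiTerm a κ z) (besselPsi a κ (1 - ∑ j, z j)) := by
  obtain ⟨C, hC0, hC⟩ := exists_bound_Gamma_sub_nat a
  have hx0 : 0 ≤ ∑ j, ‖z j‖ := Finset.sum_nonneg fun _ _ => norm_nonneg _
  have hS : ‖∑ j, z j‖ < 1 := (norm_sum_le _ _).trans_lt hz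
  have hne : (1 : ℂ) - ∑ j, z j ≠ 0 := by
    intro h
    rw [sub_eq_zero] at h
    rw [← h] at hS
    simp at hS
  have hs := (summable_norm_psiTerm ha hz).of_norm
  have h1 : HasSum (fun q : ℕ × (Fin n → ℕ) => psiTerm a κ z q.swap) (∑' q, psiTerm a κ z q) :=
    (Equiv.prodComm ℕ (Fin n → ℕ)).hasSum_iff.2 hs.hasSum
  have h2 : ∀ p : ℕ, HasSum (fun m : Fin n → ℕ => psiTerm a κ z (m, p))
      ((1 - ∑ j, z j) ^ (-a : ℂ) *
        ((Real.Gamma (a - p) : ℂ) * κ ^ p / p.factorial * (1 - ∑ j, z j) ^ p)) := by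
    intro p
    by_cases hp : κ ≠ 0 ∨ p = 0
    · have h3 := hasSum_multiindex (f := fun N => (Real.Gamma (a - p + N) : ℂ)) (z := z)
        (by simpa using (summable_abs_Gamma_sub_add ha hC hp hx0 hz).1)
        (hasSum_Gamma_mul_pow (ha.sub_add_ne_zero hp) hS)
      have h4 := h3.mul_right (κ ^ p / p.factorial)
      convert! h4 using 1
      rw [show (-((a - p : ℝ) : ℂ)) = -a + (p : ℂ) by push_cast; ring, Complex.cpow_add _ _ hne,
        Complex.cpow_natCast]
      ring
    · push Not at hp
      have h3 : κ ^ p = 0 := by rw [hp.1, zero_pow hp.2]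
      simp only [psiTerm, h3, zero_div, mul_zero, zero_mul]
      exact hasSum_zero
  have h5 := h1.prod_fiberwise h2
  have h6 := (hasSum_besselPhi a κ (1 - ∑ j, z j)).mul_left ((1 - ∑ j, z j) ^ (-a : ℂ))
  rw [show besselPsi a κ (1 - ∑ j, z j) = ∑' q, psiTerm a κ z q from h6.unique h5]
  exact hs.hasSum

/-! ### The Euler integral for the hypergeometric function -/

/-- The Euler-type integral for the continuation of `H_A^{(n,1)}(a, b; 2 b; ξ, η)`. -/
def eulerHA {n : ℕ} (a : ℝ) (b : Fin n → ℝ) (ξ : Fin n → ℂ) (η : ℂ) : ℂ :=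
  (Real.Gamma a : ℂ)⁻¹ * betaTransform b a η (fun _ => 1) (1, -ξ)

lemma one_neg_mem_tubeDomain {n : ℕ} {ξ : Fin n → ℂ} (hξ : ξ ∈ contDomain n) :
    ((1 : ℂ), -ξ) ∈ tubeDomain n := by
  have h : ∑ j, max (ξ j).re 0 < 1 := hξ
  have h2 : ∀ j, min ((-ξ) j).re 0 = -max (ξ j).re 0 := fun j => by
    rw [Pi.neg_apply, Complex.neg_re, ← neg_zero, min_neg_neg, neg_zero]
  show (0 : ℝ) < (1 : ℂ).re + ∑ j, min ((-ξ) j).re 0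
  simp only [h2, Finset.sum_neg_distrib, Complex.one_re]
  linarith

lemma integral_prod_pow_betaPi {n : ℕ} {b : Fin n → ℝ} (hb : ∀ j, 0 < b j) (m : Fin n → ℕ) :
    ∫ t, ((∏ j, t j ^ m j : ℝ) : ℂ) ∂betaPi b =
      ((∏ j, poch (b j) (m j) / poch (2 * b j) (m j) : ℝ) : ℂ) := by
  have := fun j => ProbabilityTheory.isProbabilityMeasureBeta (hb j) (hb j)
  rw [integral_complex_ofReal, betaPi,
    MeasureTheory.integral_fintype_prod_eq_prod (fun (j : Fin n) (t : ℝ) => t ^ m j)]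
  congr 1
  exact Finset.prod_congr rfl fun j _ => (integral_pow_betaMeasure (hb j) (m j)).2

lemma psiTerm_ofReal_mul {n : ℕ} (a : ℝ) (κ : ℂ) (t : Fin n → ℝ) (ξ : Fin n → ℂ)
    (q : (Fin n → ℕ) × ℕ) :
    psiTerm a κ (fun j => t j * ξ j) q =
      ((∏ j, t j ^ q.1 j : ℝ) : ℂ) * psiTerm a κ ξ q := by
  simp only [psiTerm, mul_pow, mul_div_assoc, Finset.prod_mul_distrib]
  push_cast
  ring

lemma seriesTerm_eq {n : ℕ} (a : ℝ) (b : Fin n → ℝ) (ξ : Fin n → ℂ) (η : ℂ)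
    (q : (Fin n → ℕ) × ℕ) :
    seriesTerm a b (fun j => 2 * b j) ξ η q = (Real.Gamma a : ℂ)⁻¹ *
      (((∏ j, poch (b j) (q.1 j) / poch (2 * b j) (q.1 j) : ℝ) : ℂ) * psiTerm a η ξ q) := by
  have h1 : poch a ((∑ j, (q.1 j : ℤ)) - (q.2 : ℤ)) =
      Real.Gamma (a - q.2 + (∑ j, q.1 j : ℕ)) / Real.Gamma a := by
    rw [poch]
    congr 2
    push_cast
    ring
  rw [seriesTerm, psiTerm, h1, Finset.prod_div_distrib, Finset.prod_div_distrib]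
  push_cast
  field_simp

open MeasureTheory in
-- Holomorphy comes from differentiating under the integral. On the polydomain of convergence the
-- series of `hasSum_psiTerm` is integrated termwise: for `t` in the cube its terms are bounded by
-- those at `ξ`, and the beta moments supply the missing Pochhammer quotients.
lemma isHA_eulerHA {n : ℕ} {a : ℝ} {b : Fin n → ℝ} {η : ℂ} (hb : ∀ j, 0 < b j)
    (ha : Admissible a η) : IsHA a b (fun j => 2 * b j) η fun ξ => eulerHA a b ξ η := by
  have hprob := isProbabilityMeasure_betaPi hb
  constructor
  · intro ξ hξ
    have h1 := (hasFDerivAt_betaTransform hb ha (continuous_const (y := (1 : ℂ)))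
      (one_neg_mem_tubeDomain hξ)).differentiableAt
    have h2 : DifferentiableAt ℂ (fun ξ : Fin n → ℂ => ((1 : ℂ), -ξ)) ξ := by fun_prop
    exact ((h1.comp ξ h2).const_mul _).differentiableWithinAt
  · intro ξ hξ
    have hle : ∀ t ∈ Set.Icc (0 : Fin n → ℝ) 1, ∀ j, ‖(t j : ℂ) * ξ j‖ ≤ ‖ξ j‖ := by
      intro t ht j
      rw [norm_mul, Complex.norm_real, Real.norm_of_nonneg (ht.1 j)]
      exact mul_le_of_le_one_left (norm_nonneg _) (ht.2 j)
    have hF : ∀ q, Integrable (fun t => psiTerm a η (fun j => (t j : ℂ) * ξ j) q) (betaPi b) := by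
      intro q
      refine integrable_betaPi_of_continuousOn hb (Continuous.continuousOn ?_)
      unfold psiTerm
      fun_prop
    have hnorm : ∀ q, ∫ t, ‖psiTerm a η (fun j => (t j : ℂ) * ξ j) q‖ ∂betaPi b ≤
        ‖psiTerm a η ξ q‖ := by
      intro q
      have h1 : ∫ t, ‖psiTerm a η (fun j => (t j : ℂ) * ξ j) q‖ ∂betaPi b ≤
          ∫ _, ‖psiTerm a η ξ q‖ ∂betaPi b := by
        refine integral_mono_ae (hF q).norm (integrable_const _) ?_
        filter_upwards [ae_betaPi_Icc hb] with t ht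
        rw [norm_psiTerm, norm_psiTerm]
        gcongr with j
        exact hle t ht j
      simpa using h1
    have hsum : Summable fun q => ∫ t, ‖psiTerm a η (fun j => (t j : ℂ) * ξ j) q‖ ∂betaPi b :=
      (summable_norm_psiTerm ha hξ).of_nonneg_of_le
        (fun q => integral_nonneg fun t => norm_nonneg _) hnorm
    have key := (hasSum_integral_of_summable_integral_norm hF hsum).mul_left (Real.Gamma a : ℂ)⁻¹
    convert! key using 1
    · funext q
      rw [seriesTerm_eq, ← integral_prod_pow_betaPi hb, ← integral_mul_const]
      simp only [psiTerm_ofReal_mul]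
    · show (Real.Gamma a : ℂ)⁻¹ * ∫ t, 1 * besselPsi a η (tubeForm t (1, -ξ)) ∂betaPi b = _
      congr 1
      refine integral_congr_ae ?_
      filter_upwards [ae_betaPi_Icc hb] with t ht
      have h2 : ∑ j, ‖(t j : ℂ) * ξ j‖ < 1 :=
        (Finset.sum_le_sum fun j _ => hle t ht j).trans_lt hξ
      rw [(hasSum_psiTerm ha h2).tsum_eq, tubeForm_apply, one_mul]
      congr 1
      simp only [Pi.neg_apply, mul_neg, Finset.sum_neg_distrib]
      ring

lemma isHA_HA {n : ℕ} {a : ℝ} {b c : Fin n → ℝ} {η : ℂ} (h : ∃ H, IsHA a b c η H) :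
    IsHA a b c η fun ξ => HA a b c ξ η := by
  have h1 : (fun ξ => HA a b c ξ η) = h.choose := by
    funext ξ
    rw [HA, dif_pos h]
  rw [h1]
  exact h.choose_spec

lemma HA_eq_eulerHA {n : ℕ} {a : ℝ} {b : Fin n → ℝ} {η : ℂ} (hb : ∀ j, 0 < b j)
    (ha : Admissible a η) {ξ : Fin n → ℂ} (hξ : ξ ∈ contDomain n) :
    HA a b (fun j => 2 * b j) ξ η = eulerHA a b ξ η :=
  (isHA_HA ⟨_, isHA_eulerHA hb ha⟩).eqOn (isHA_eulerHA hb ha) hξ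

/-! ### Regularized potentials and their differential equation -/

section
variable {m n : ℕ} (hnm : n ≤ m)

/-- Extension by zero of a vector with `n` components to one with `m` components. -/
def zeroExt (_ : n ≤ m) (e : Fin n → ℝ) (i : Fin m) : ℝ := if h : i.val < n then e ⟨i, h⟩ else 0

@[simp] lemma zeroExt_castLE (e : Fin n → ℝ) (j : Fin n) : zeroExt hnm e (Fin.castLE hnm j) = e j := by
  simp [zeroExt]

/-- Separates the singular coordinates from the others, on which all `zeroExt` coefficients vanish;
this lets the operator be handled as one sum over `Fin m`. -/
lemma eq_castLE_or_zeroExt_eq_zero (i : Fin m) :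
    (∃ j : Fin n, i = Fin.castLE hnm j) ∨ ∀ e : Fin n → ℝ, zeroExt hnm e i = 0 := by
  by_cases h : i.val < n
  · exact Or.inl ⟨⟨i, h⟩, rfl⟩
  · exact Or.inr fun e => by simp [zeroExt, h]

lemma sum_eq_sum_castLE {R : Type*} [AddCommMonoid R] {F : Fin m → R}
    (hF : ∀ i : Fin m, (∀ e : Fin n → ℝ, zeroExt hnm e i = 0) → F i = 0) :
    ∑ i, F i = ∑ j, F (Fin.castLE hnm j) := by
  have h1 : ∑ i ∈ Finset.univ.map (Fin.castLEEmb hnm), F i = ∑ i, F i := by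
    refine Finset.sum_subset (Finset.subset_univ _) fun i _ hi => ?_
    rcases eq_castLE_or_zeroExt_eq_zero hnm i with ⟨j, rfl⟩ | h
    · exact absurd (Finset.mem_map.2 ⟨j, Finset.mem_univ _, rfl⟩) hi
    · exact hF i h
  rw [← h1, Finset.sum_map]
  rfl

lemma isOpen_posDomain : IsOpen (posDomain hnm) := by
  have h : posDomain hnm = ⋂ j : Fin n, {x | 0 < x (Fin.castLE hnm j)} := by
    ext x; simp [posDomain]
  rw [h]
  exact isOpen_iInter_of_finite fun j => isOpen_lt continuous_const (by fun_prop)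

lemma partialDeriv_eq_of_hasFDerivAt {i : Fin m} {u : EuclideanSpace ℝ (Fin m) → ℂ}
    {u' : EuclideanSpace ℝ (Fin m) →L[ℝ] ℂ} {x : EuclideanSpace ℝ (Fin m)}
    (h : HasFDerivAt u u' x) : partialDeriv i u x = u' (EuclideanSpace.single i 1) := by
  rw [partialDeriv, h.fderiv]

lemma partialDeriv_congr {i : Fin m} {u v : EuclideanSpace ℝ (Fin m) → ℂ}
    {x : EuclideanSpace ℝ (Fin m)} (h : u =ᶠ[nhds x] v) :
    partialDeriv i u x = partialDeriv i v x := by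
  rw [partialDeriv, partialDeriv, h.fderiv_eq]

lemma partialDeriv_mul {i : Fin m} {u v : EuclideanSpace ℝ (Fin m) → ℂ}
    {x : EuclideanSpace ℝ (Fin m)} (hu : DifferentiableAt ℝ u x) (hv : DifferentiableAt ℝ v x) :
    partialDeriv i (fun x => u x * v x) x =
      partialDeriv i u x * v x + u x * partialDeriv i v x := by
  have h : HasFDerivAt (fun x => u x * v x) _ x := hu.hasFDerivAt.mul hv.hasFDerivAt
  rw [partialDeriv_eq_of_hasFDerivAt h]
  simp [partialDeriv]
  ring

lemma partialDeriv_add {i : Fin m} {u v : EuclideanSpace ℝ (Fin m) → ℂ}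
    {x : EuclideanSpace ℝ (Fin m)} (hu : DifferentiableAt ℝ u x) (hv : DifferentiableAt ℝ v x) :
    partialDeriv i (fun x => u x + v x) x = partialDeriv i u x + partialDeriv i v x := by
  have h : HasFDerivAt (fun x => u x + v x) _ x := hu.hasFDerivAt.add hv.hasFDerivAt
  rw [partialDeriv_eq_of_hasFDerivAt h]
  simp [partialDeriv]

lemma partialDeriv_neg {i : Fin m} {u : EuclideanSpace ℝ (Fin m) → ℂ}
    {x : EuclideanSpace ℝ (Fin m)} (hu : DifferentiableAt ℝ u x) :
    partialDeriv i (fun x => -u x) x = -partialDeriv i u x := by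
  have h : HasFDerivAt (fun x => -u x) _ x := hu.hasFDerivAt.neg
  rw [partialDeriv_eq_of_hasFDerivAt h]
  simp [partialDeriv]

lemma hasFDerivAt_coord (i : Fin m) (x : EuclideanSpace ℝ (Fin m)) :
    HasFDerivAt (fun x : EuclideanSpace ℝ (Fin m) => x i)
      (EuclideanSpace.proj i : EuclideanSpace ℝ (Fin m) →L[ℝ] ℝ) x :=
  (EuclideanSpace.proj i : EuclideanSpace ℝ (Fin m) →L[ℝ] ℝ).hasFDerivAt

lemma partialDeriv_ofReal {i : Fin m} {f : EuclideanSpace ℝ (Fin m) → ℝ}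
    {f' : EuclideanSpace ℝ (Fin m) →L[ℝ] ℝ} {x : EuclideanSpace ℝ (Fin m)}
    (h : HasFDerivAt f f' x) :
    DifferentiableAt ℝ (fun x => (f x : ℂ)) x ∧
      partialDeriv i (fun x => (f x : ℂ)) x = f' (EuclideanSpace.single i 1) := by
  have h1 := Complex.ofRealCLM.hasFDerivAt.comp x h
  exact ⟨h1.differentiableAt, partialDeriv_eq_of_hasFDerivAt h1⟩

lemma rSq_eq_norm_sq (x x₀ : EuclideanSpace ℝ (Fin m)) : rSq x x₀ = ‖x - x₀‖ ^ 2 := by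
  rw [EuclideanSpace.norm_sq_eq, rSq]
  simp

lemma rSq_nonneg (x x₀ : EuclideanSpace ℝ (Fin m)) : 0 ≤ rSq x x₀ := by
  rw [rSq_eq_norm_sq]; positivity

lemma rSq_pos {x x₀ : EuclideanSpace ℝ (Fin m)} (h : x ≠ x₀) : 0 < rSq x x₀ := by
  rw [rSq_eq_norm_sq]
  have := norm_pos_iff.2 (sub_ne_zero.2 h)
  positivity

lemma contDiff_rSq (x₀ : EuclideanSpace ℝ (Fin m)) {N : WithTop ℕ∞} :
    ContDiff ℝ N fun x => rSq x x₀ := by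
  unfold rSq
  fun_prop

/-- The point at which `betaTransform` has to be evaluated to average a function of
`r² + ε + ∑ 4 t_j x_j x_{0j}`. -/
def kernelPoint (x₀ : EuclideanSpace ℝ (Fin m)) (ε : ℝ) (x : EuclideanSpace ℝ (Fin m)) :
    ℂ × (Fin n → ℂ) :=
  (((rSq x x₀ + ε : ℝ) : ℂ),
    fun j => ((4 * x₀ (Fin.castLE hnm j) * x (Fin.castLE hnm j) : ℝ) : ℂ))

/-- The average of `besselPsi` over the points `r² + ε + ∑ 4 t_j x_j x_{0j}`. -/
def betaPotential (b : Fin n → ℝ) (a : ℝ) (κ : ℂ) (p : (Fin n → ℝ) → ℂ)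
    (x₀ : EuclideanSpace ℝ (Fin m)) (ε : ℝ) (x : EuclideanSpace ℝ (Fin m)) : ℂ :=
  betaTransform b a κ p (kernelPoint hnm x₀ ε x)

/-- The set where the arguments `r² + ε + ∑ 4 t_j x_j x_{0j}` are positive. -/
def kernelDomain (x₀ : EuclideanSpace ℝ (Fin m)) (ε : ℝ) : Set (EuclideanSpace ℝ (Fin m)) :=
  posDomain hnm ∩ {x | 0 < rSq x x₀ + ε}

lemma isOpen_kernelDomain (x₀ : EuclideanSpace ℝ (Fin m)) (ε : ℝ) :
    IsOpen (kernelDomain hnm x₀ ε) :=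
  (isOpen_posDomain hnm).inter (isOpen_lt continuous_const
    ((contDiff_rSq x₀ (N := 0)).continuous.add continuous_const))

variable {hnm}
variable {x₀ : EuclideanSpace ℝ (Fin m)}

lemma kernelPoint_mem_tubeDomain (hx₀ : x₀ ∈ posDomain hnm) {ε : ℝ}
    {x : EuclideanSpace ℝ (Fin m)} (hx : x ∈ kernelDomain hnm x₀ ε) :
    kernelPoint hnm x₀ ε x ∈ tubeDomain n := by
  have h : ∀ j : Fin n, min ((kernelPoint hnm x₀ ε x).2 j).re 0 = 0 := by
    intro j
    refine min_eq_right ?_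
    have h1 := hx.1 j
    have h2 := hx₀ j
    simp only [kernelPoint, Complex.ofReal_re]
    positivity
  show 0 < (kernelPoint hnm x₀ ε x).1.re + ∑ j, min ((kernelPoint hnm x₀ ε x).2 j).re 0
  simp only [h, Finset.sum_const_zero, add_zero]
  exact hx.2

lemma tubeForm_kernelPoint (ε : ℝ) (x : EuclideanSpace ℝ (Fin m)) (t : Fin n → ℝ) :
    tubeForm t (kernelPoint hnm x₀ ε x) =
      ((rSq x x₀ + ε + ∑ j, t j * (4 * x₀ (Fin.castLE hnm j) * x (Fin.castLE hnm j)) : ℝ) : ℂ) := by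
  rw [tubeForm_apply, kernelPoint]
  push_cast
  rfl

lemma contDiff_kernelPoint (ε : ℝ) {N : WithTop ℕ∞} : ContDiff ℝ N (kernelPoint hnm x₀ ε) := by
  have h1 : ∀ f : EuclideanSpace ℝ (Fin m) → ℝ, ContDiff ℝ N f →
      ContDiff ℝ N fun x => (f x : ℂ) := fun f hf => Complex.ofRealCLM.contDiff.comp hf
  refine ContDiff.prodMk (h1 _ ((contDiff_rSq x₀).add contDiff_const)) ?_
  exact contDiff_pi.2 fun j => h1 _ (by fun_prop)

lemma fderiv_kernelPoint_single (ε : ℝ) (x : EuclideanSpace ℝ (Fin m)) (i : Fin m) :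
    fderiv ℝ (kernelPoint hnm x₀ ε) x (EuclideanSpace.single i 1) =
      (((2 * (x i - x₀ i) : ℝ) : ℂ),
        fun j => ((if Fin.castLE hnm j = i then 4 * x₀ i else 0 : ℝ) : ℂ)) := by
  have h1 : HasFDerivAt (fun x => rSq x x₀ + ε) (∑ l : Fin m,
      (2 * (x l - x₀ l)) • (EuclideanSpace.proj l : EuclideanSpace ℝ (Fin m) →L[ℝ] ℝ)) x := by
    refine HasFDerivAt.add_const ε (HasFDerivAt.fun_sum fun l _ => ?_)
    simpa using ((hasFDerivAt_coord l x).sub_const (x₀ l)).pow 2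
  have h2 : ∀ j : Fin n, HasFDerivAt
      (fun x : EuclideanSpace ℝ (Fin m) => 4 * x₀ (Fin.castLE hnm j) * x (Fin.castLE hnm j))
      ((4 * x₀ (Fin.castLE hnm j)) •
        (EuclideanSpace.proj (Fin.castLE hnm j) : EuclideanSpace ℝ (Fin m) →L[ℝ] ℝ)) x := fun j =>
    (hasFDerivAt_coord _ x).const_mul _
  have h3 := (Complex.ofRealCLM.hasFDerivAt.comp x h1).prodMk
    (hasFDerivAt_pi.2 fun j => Complex.ofRealCLM.hasFDerivAt.comp x (h2 j))
  have h4 : HasFDerivAt (kernelPoint hnm x₀ ε) _ x := h3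
  rw [h4.fderiv]
  refine Prod.ext ?_ ?_
  · simp [ContinuousLinearMap.prod_apply, sum_apply]
  · funext j
    by_cases h : Fin.castLE hnm j = i
    · simp [ContinuousLinearMap.prod_apply, h]
    · simp [ContinuousLinearMap.prod_apply, h, PiLp.single_apply]

variable {b : Fin n → ℝ} {a : ℝ} {κ : ℂ} {p : (Fin n → ℝ) → ℂ}

lemma contDiffOn_betaPotential (hx₀ : x₀ ∈ posDomain hnm) (hb : ∀ j, 0 < b j)
    (ha : Admissible a κ) (hp : Continuous p) (ε : ℝ) (N : ℕ) :
    ContDiffOn ℝ N (betaPotential hnm b a κ p x₀ ε) (kernelDomain hnm x₀ ε) :=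
  ((contDiffOn_betaTransform hb N ha hp).restrict_scalars ℝ).comp
    (contDiff_kernelPoint ε).contDiffOn fun _ hx => kernelPoint_mem_tubeDomain hx₀ hx

lemma differentiableAt_betaPotential (hx₀ : x₀ ∈ posDomain hnm) (hb : ∀ j, 0 < b j)
    (ha : Admissible a κ) (hp : Continuous p) {ε : ℝ} {x : EuclideanSpace ℝ (Fin m)}
    (hx : x ∈ kernelDomain hnm x₀ ε) :
    DifferentiableAt ℝ (betaPotential hnm b a κ p x₀ ε) x :=
  ((contDiffOn_betaPotential hx₀ hb ha hp ε 1).contDiffAt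
    ((isOpen_kernelDomain hnm x₀ ε).mem_nhds hx)).differentiableAt (by norm_num)

/-- The derivative of `4 t_j x_j x_{0j}` with respect to `x_j`. -/
def crossDeriv (hnm : n ≤ m) (x₀ : EuclideanSpace ℝ (Fin m)) (i : Fin m) (t : Fin n → ℝ) : ℂ :=
  ((4 * x₀ i * zeroExt hnm t i : ℝ) : ℂ)

lemma continuous_crossDeriv (i : Fin m) : Continuous (crossDeriv hnm x₀ i) := by
  unfold crossDeriv zeroExt
  split_ifs <;> fun_prop

lemma partialDeriv_betaPotential (hx₀ : x₀ ∈ posDomain hnm) (hb : ∀ j, 0 < b j)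
    (ha : Admissible a κ) (hp : Continuous p) {ε : ℝ} {x : EuclideanSpace ℝ (Fin m)}
    (hx : x ∈ kernelDomain hnm x₀ ε) (i : Fin m) :
    partialDeriv i (betaPotential hnm b a κ p x₀ ε) x =
      -(((2 * (x i - x₀ i) : ℝ) : ℂ) * betaPotential hnm b (a + 1) κ p x₀ ε x +
        betaPotential hnm b (a + 1) κ (fun t => p t * crossDeriv hnm x₀ i t) x₀ ε x) := by
  have h1 := ((hasFDerivAt_betaTransform hb ha hp
    (kernelPoint_mem_tubeDomain hx₀ hx)).restrictScalars ℝ).comp x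
    ((contDiff_kernelPoint (hnm := hnm) (x₀ := x₀) ε (N := 1)).differentiable
      (by norm_num) x).hasFDerivAt
  have h2 : HasFDerivAt (betaPotential hnm b a κ p x₀ ε) _ x := h1
  rw [partialDeriv_eq_of_hasFDerivAt h2]
  simp only [ContinuousLinearMap.comp_apply, ContinuousLinearMap.coe_restrictScalars',
    fderiv_kernelPoint_single, FunLike.coe_neg, FunLike.coe_add, Pi.neg_apply, Pi.add_apply,
    FunLike.coe_smul, Pi.smul_apply, sum_apply, ContinuousLinearMap.coe_fst',
    ContinuousLinearMap.coe_snd', ContinuousLinearMap.proj_apply, smul_eq_mul]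
  rw [betaPotential, betaPotential, mul_comm]
  congr 2
  rcases eq_castLE_or_zeroExt_eq_zero hnm i with ⟨j, rfl⟩ | h
  · rw [Finset.sum_eq_single j]
    · rw [if_pos rfl, mul_comm, betaTransform, betaTransform, ← MeasureTheory.integral_const_mul]
      refine MeasureTheory.integral_congr_ae (Filter.Eventually.of_forall fun t => ?_)
      simp only [crossDeriv, zeroExt_castLE]
      push_cast
      ring
    · intro j' _ hj'
      rw [if_neg (fun h => hj' (Fin.castLE_injective hnm h))]
      simp
    · simp
  · have h3 : ∀ j, Fin.castLE hnm j ≠ i := by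
      rintro j rfl
      have := h fun _ => 1
      simp at this
    simp only [h3, if_false, Complex.ofReal_zero, mul_zero, Finset.sum_const_zero, betaTransform,
      crossDeriv, h, zero_mul, MeasureTheory.integral_zero]

lemma partialDeriv_coord_sub (i : Fin m) (x : EuclideanSpace ℝ (Fin m)) :
    DifferentiableAt ℝ (fun x : EuclideanSpace ℝ (Fin m) => ((2 * (x i - x₀ i) : ℝ) : ℂ)) x ∧
    partialDeriv i (fun x => ((2 * (x i - x₀ i) : ℝ) : ℂ)) x = 2 := by
  have h := partialDeriv_ofReal (i := i) (((hasFDerivAt_coord i x).sub_const (x₀ i)).const_mul 2)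
  refine ⟨h.1, h.2.trans ?_⟩
  simp

lemma partialDeriv_partialDeriv_betaPotential (hx₀ : x₀ ∈ posDomain hnm) (hb : ∀ j, 0 < b j)
    (ha : Admissible a κ) {ε : ℝ} {x : EuclideanSpace ℝ (Fin m)}
    (hx : x ∈ kernelDomain hnm x₀ ε) (i : Fin m) :
    partialDeriv i (partialDeriv i (betaPotential hnm b a κ (fun _ => 1) x₀ ε)) x =
      -(2 * betaPotential hnm b (a + 1) κ (fun _ => 1) x₀ ε x) +
        (((4 * (x i - x₀ i) ^ 2 : ℝ) : ℂ) * betaPotential hnm b (a + 2) κ (fun _ => 1) x₀ ε x +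
        ((4 * (x i - x₀ i) : ℝ) : ℂ) *
          betaPotential hnm b (a + 2) κ (crossDeriv hnm x₀ i) x₀ ε x +
        betaPotential hnm b (a + 2) κ (fun t => crossDeriv hnm x₀ i t ^ 2) x₀ ε x) := by
  have hc := continuous_crossDeriv (hnm := hnm) (x₀ := x₀) i
  have h1 : Continuous fun _ : Fin n → ℝ => (1 : ℂ) := continuous_const
  have hev : partialDeriv i (betaPotential hnm b a κ (fun _ => 1) x₀ ε) =ᶠ[nhds x] fun x =>
      -(((2 * (x i - x₀ i) : ℝ) : ℂ) * betaPotential hnm b (a + 1) κ (fun _ => 1) x₀ ε x +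
        betaPotential hnm b (a + 1) κ (crossDeriv hnm x₀ i) x₀ ε x) := by
    filter_upwards [(isOpen_kernelDomain hnm x₀ ε).mem_nhds hx] with y hy
    rw [partialDeriv_betaPotential hx₀ hb ha h1 hy]
    simp only [one_mul]
  have hd1 := differentiableAt_betaPotential hx₀ hb ha.add_one h1 hx
  have hd2 := differentiableAt_betaPotential hx₀ hb ha.add_one hc hx
  obtain ⟨hd3, he⟩ := partialDeriv_coord_sub (x₀ := x₀) i x
  have hd4 : DifferentiableAt ℝ (fun x => ((2 * (x i - x₀ i) : ℝ) : ℂ) *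
      betaPotential hnm b (a + 1) κ (fun _ => 1) x₀ ε x) x := hd3.mul hd1
  have hd5 : DifferentiableAt ℝ (fun x => ((2 * (x i - x₀ i) : ℝ) : ℂ) *
      betaPotential hnm b (a + 1) κ (fun _ => 1) x₀ ε x +
      betaPotential hnm b (a + 1) κ (crossDeriv hnm x₀ i) x₀ ε x) x := hd4.add hd2
  rw [partialDeriv_congr hev, partialDeriv_neg hd5, partialDeriv_add hd4 hd2, partialDeriv_mul hd3 hd1, he,
    partialDeriv_betaPotential hx₀ hb ha.add_one h1 hx,
    partialDeriv_betaPotential hx₀ hb ha.add_one hc hx, show a + 1 + 1 = a + 2 by ring]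
  simp only [one_mul, ← sq]
  push_cast
  ring

lemma integrable_betaPotential (hx₀ : x₀ ∈ posDomain hnm) (hb : ∀ j, 0 < b j)
    (ha : Admissible a κ) (hp : Continuous p) {ε : ℝ} {x : EuclideanSpace ℝ (Fin m)}
    (hx : x ∈ kernelDomain hnm x₀ ε) :
    MeasureTheory.Integrable
      (fun t => p t * besselPsi a κ (tubeForm t (kernelPoint hnm x₀ ε x))) (betaPi b) :=
  integrable_betaTransform hb ha hp (kernelPoint_mem_tubeDomain hx₀ hx)

/-- The argument of `besselPsi` is r² + ε + ∑ x_i `crossDeriv` i t, so this is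
`besselPsi_recurrence` integrated over `t`. -/
lemma betaPotential_recurrence (hx₀ : x₀ ∈ posDomain hnm) (hb : ∀ j, 0 < b j)
    (ha : Admissible a κ) {ε : ℝ} {x : EuclideanSpace ℝ (Fin m)}
    (hx : x ∈ kernelDomain hnm x₀ ε) :
    ((rSq x x₀ + ε : ℝ) : ℂ) * betaPotential hnm b (a + 2) κ (fun _ => 1) x₀ ε x +
      ∑ i, (x i : ℂ) * betaPotential hnm b (a + 2) κ (crossDeriv hnm x₀ i) x₀ ε x =
    (a + 1) * betaPotential hnm b (a + 1) κ (fun _ => 1) x₀ ε x -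
      κ * betaPotential hnm b a κ (fun _ => 1) x₀ ε x := by
  have ha2 : Admissible (a + 2) κ := by
    have := ha.add_one.add_one
    rwa [show a + 1 + 1 = a + 2 by ring] at this
  have h1 : Continuous fun _ : Fin n → ℝ => (1 : ℂ) := continuous_const
  have hi2 := integrable_betaPotential hx₀ hb ha2 h1 hx
  have hi1 := integrable_betaPotential hx₀ hb ha.add_one h1 hx
  have hi0 := integrable_betaPotential hx₀ hb ha h1 hx
  have hic := fun i => integrable_betaPotential hx₀ hb ha2
    (continuous_crossDeriv (hnm := hnm) (x₀ := x₀) i) hx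
  simp only [betaPotential, betaTransform]
  simp_rw [← MeasureTheory.integral_const_mul]
  rw [← MeasureTheory.integral_finsetSum _ fun i _ => (hic i).const_mul _,
    ← MeasureTheory.integral_add (hi2.const_mul _)
      (MeasureTheory.integrable_finsetSum _ fun i _ => (hic i).const_mul _),
    ← MeasureTheory.integral_sub (hi1.const_mul _) (hi0.const_mul _)]
  refine MeasureTheory.integral_congr_ae ?_
  filter_upwards [ae_betaPi_Icc hb] with t ht
  have hne := Complex.slitPlane_ne_zero
    (tubeForm_mem_slitPlane ht (kernelPoint_mem_tubeDomain hx₀ hx))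
  have hrec := besselPsi_recurrence ha hne
  have hform : tubeForm t (kernelPoint hnm x₀ ε x) =
      ((rSq x x₀ + ε : ℝ) : ℂ) + ∑ i, (x i : ℂ) * crossDeriv hnm x₀ i t := by
    rw [tubeForm_kernelPoint, sum_eq_sum_castLE hnm (F := fun i => (x i : ℂ) * crossDeriv hnm x₀ i t)
      (fun i hi => by simp [crossDeriv, hi])]
    simp only [crossDeriv, zeroExt_castLE]
    push_cast
    refine congrArg₂ _ rfl (Finset.sum_congr rfl fun j _ => by ring)
  have hsum : ∑ i, (x i : ℂ) * (crossDeriv hnm x₀ i t *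
      besselPsi (a + 2) κ (tubeForm t (kernelPoint hnm x₀ ε x))) =
      (∑ i, (x i : ℂ) * crossDeriv hnm x₀ i t) *
        besselPsi (a + 2) κ (tubeForm t (kernelPoint hnm x₀ ε x)) := by
    rw [Finset.sum_mul]
    exact Finset.sum_congr rfl fun i _ => by ring
  rw [hsum]
  linear_combination hrec - hform * besselPsi (a + 2) κ (tubeForm t (kernelPoint hnm x₀ ε x))

/-- The left side collects the terms in which the operator produces powers of t_i: the square from
the second derivative and the singular first-order term. Integration by parts against t^b (1 - t)^b
trades them for terms that combine with the rest of the operator. -/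
lemma betaPotential_by_parts (hx₀ : x₀ ∈ posDomain hnm) (hb : ∀ j, 0 < b j)
    (ha : Admissible a κ) {ε : ℝ} {x : EuclideanSpace ℝ (Fin m)}
    (hx : x ∈ kernelDomain hnm x₀ ε) (i : Fin m) :
    betaPotential hnm b (a + 2) κ (fun t => crossDeriv hnm x₀ i t ^ 2) x₀ ε x -
      ((2 * zeroExt hnm b i / x i : ℝ) : ℂ) *
        betaPotential hnm b (a + 1) κ (crossDeriv hnm x₀ i) x₀ ε x =
    ((4 * x₀ i : ℝ) : ℂ) * betaPotential hnm b (a + 2) κ (crossDeriv hnm x₀ i) x₀ ε x -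
      ((4 * x₀ i * zeroExt hnm b i / x i : ℝ) : ℂ) *
        betaPotential hnm b (a + 1) κ (fun _ => 1) x₀ ε x := by
  rcases eq_castLE_or_zeroExt_eq_zero hnm i with ⟨j, rfl⟩ | h
  swap
  · simp [h, betaPotential, betaTransform, crossDeriv]
  have ha2 : Admissible (a + 2) κ := by
    have := ha.add_one.add_one
    rwa [show a + 1 + 1 = a + 2 by ring] at this
  set i := Fin.castLE hnm j with hi
  have hxi : 0 < x i := hx.1 j
  have hc := continuous_crossDeriv (hnm := hnm) (x₀ := x₀) i
  have h1 : Continuous fun _ : Fin n → ℝ => (1 : ℂ) := continuous_const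
  have hmem := kernelPoint_mem_tubeDomain hx₀ hx
  have key := integral_betaPi_by_parts hb j
    (G := fun t => besselPsi (a + 1) κ (tubeForm t (kernelPoint hnm x₀ ε x)))
    (G' := fun t => -besselPsi (a + 2) κ (tubeForm t (kernelPoint hnm x₀ ε x)) *
      ((4 * x₀ i * x i : ℝ) : ℂ))
    (continuousOn_besselPsi_tubeForm ha.add_one hmem)
    ((continuousOn_besselPsi_tubeForm ha2 hmem).neg.mul continuousOn_const) ?_
  · have hc2 : Continuous fun t => crossDeriv hnm x₀ i t ^ 2 := hc.pow 2
    have hI1 := integrable_betaPotential hx₀ hb ha2 hc2 hx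
    have hI2 := integrable_betaPotential hx₀ hb ha.add_one hc hx
    have hI3 := integrable_betaPotential hx₀ hb ha2 hc hx
    have hI4 := integrable_betaPotential hx₀ hb ha.add_one h1 hx
    rw [← sub_eq_zero]
    simp only [betaPotential, betaTransform]
    rw [← MeasureTheory.integral_const_mul, ← MeasureTheory.integral_const_mul,
      ← MeasureTheory.integral_const_mul, ← MeasureTheory.integral_sub hI1 (hI2.const_mul _),
      ← MeasureTheory.integral_sub (hI3.const_mul _) (hI4.const_mul _),
      ← MeasureTheory.integral_sub]
    rotate_left
    · exact hI1.sub (hI2.const_mul _)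
    · exact (hI3.const_mul _).sub (hI4.const_mul _)
    -- After this scaling, 4x₀x·t(1 - t) becomes 4x₀·(4x₀t) - (4x₀t)², and b(1 - 2t) becomes (4x₀b -
    -- 2b·4x₀t)/x, where x and x₀ stand for their `i`-th coordinates.
    have key2 := congrArg (fun z : ℂ => ((4 * x₀ i / x i : ℝ) : ℂ) * z) key
    simp only [mul_zero] at key2
    rw [← key2, ← MeasureTheory.integral_const_mul]
    refine MeasureTheory.integral_congr_ae (Filter.Eventually.of_forall fun t => ?_)
    have hxi' : (x i : ℂ) ≠ 0 := by exact_mod_cast hxi.ne'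
    simp only [crossDeriv, hi, zeroExt_castLE]
    rw [← hi]
    push_cast
    field_simp
    ring
  · intro t ht
    have h2 := hasDerivAt_besselPsi ha.add_one (tubeForm_mem_slitPlane ht hmem)
    rw [show a + 1 + 1 = a + 2 by ring] at h2
    have h3 : HasDerivAt (fun s : ℝ => tubeForm (Function.update t j s) (kernelPoint hnm x₀ ε x))
        ((4 * x₀ i * x i : ℝ) : ℂ) (t j) := by
      have h4 : (fun s : ℝ => tubeForm (Function.update t j s) (kernelPoint hnm x₀ ε x)) =
          fun s : ℝ => tubeForm t (kernelPoint hnm x₀ ε x) +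
            ((s : ℂ) - t j) * ((4 * x₀ i * x i : ℝ) : ℂ) := by
        funext s
        rw [tubeForm_apply, tubeForm_apply, add_assoc]
        congr 1
        rw [← Finset.add_sum_erase _ _ (Finset.mem_univ j),
          ← Finset.add_sum_erase _ (fun l => (t l : ℂ) * (kernelPoint hnm x₀ ε x).2 l)
            (Finset.mem_univ j), Function.update_self]
        have h5 : ∑ l ∈ Finset.univ.erase j,
            ((Function.update t j s l : ℝ) : ℂ) * (kernelPoint hnm x₀ ε x).2 l =
            ∑ l ∈ Finset.univ.erase j, (t l : ℂ) * (kernelPoint hnm x₀ ε x).2 l :=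
          Finset.sum_congr rfl fun l hl => by
            rw [Function.update_of_ne (Finset.ne_of_mem_erase hl)]
        rw [h5]
        simp only [kernelPoint, ← hi]
        ring
      rw [h4]
      have h6 := ((((hasDerivAt_id (t j)).ofReal_comp).sub_const (t j : ℂ)).mul_const
        ((4 * x₀ i * x i : ℝ) : ℂ)).const_add (tubeForm t (kernelPoint hnm x₀ ε x))
      simpa using! h6
    have h7 : tubeForm (Function.update t j (t j)) (kernelPoint hnm x₀ ε x) =
        tubeForm t (kernelPoint hnm x₀ ε x) := by rw [Function.update_eq_self]
    rw [← h7] at h2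
    have h8 := h2.comp (t j) h3
    rw [h7] at h8
    exact h8

/-- After the integration by parts the order `a + 2` terms add up to 4(r² + ∑ x_i `crossDeriv` i),
that is 4(X - ε) with X the full argument, including ε. The recurrence converts 4X into order `a +
1` and `a`. The order `a + 1` terms cancel because 4(a + 1) = 2m + 4∑ b_j, and only the part with
`ε` is left. -/
lemma betaPotential_pde (hx₀ : x₀ ∈ posDomain hnm) (hb : ∀ j, 0 < b j) (ha : Admissible a κ)
    (hab : a = (m : ℝ) / 2 - 1 + ∑ j, b j) {ε : ℝ} {x : EuclideanSpace ℝ (Fin m)}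
    (hx : x ∈ kernelDomain hnm x₀ ε) :
    ∑ i, (partialDeriv i (partialDeriv i (betaPotential hnm b a κ (fun _ => 1) x₀ ε)) x +
        ((2 * zeroExt hnm b i / x i : ℝ) : ℂ) *
          partialDeriv i (betaPotential hnm b a κ (fun _ => 1) x₀ ε) x) +
      4 * κ * betaPotential hnm b a κ (fun _ => 1) x₀ ε x =
    -((4 * ε : ℝ) : ℂ) * betaPotential hnm b (a + 2) κ (fun _ => 1) x₀ ε x := by
  have h1 : Continuous fun _ : Fin n → ℝ => (1 : ℂ) := continuous_const
  have hterm : ∀ i, partialDeriv i (partialDeriv i (betaPotential hnm b a κ (fun _ => 1) x₀ ε)) x +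
        ((2 * zeroExt hnm b i / x i : ℝ) : ℂ) *
          partialDeriv i (betaPotential hnm b a κ (fun _ => 1) x₀ ε) x =
      -2 * betaPotential hnm b (a + 1) κ (fun _ => 1) x₀ ε x +
      4 * ((((x i - x₀ i) ^ 2 : ℝ) : ℂ) * betaPotential hnm b (a + 2) κ (fun _ => 1) x₀ ε x) +
      4 * ((x i : ℂ) * betaPotential hnm b (a + 2) κ (crossDeriv hnm x₀ i) x₀ ε x) -
      4 * ((zeroExt hnm b i : ℂ) * betaPotential hnm b (a + 1) κ (fun _ => 1) x₀ ε x) := by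
    intro i
    rw [partialDeriv_partialDeriv_betaPotential hx₀ hb ha hx,
      partialDeriv_betaPotential hx₀ hb ha h1 hx]
    simp only [one_mul]
    have hparts := betaPotential_by_parts hx₀ hb ha hx i
    have hB : ((zeroExt hnm b i / x i : ℝ) : ℂ) * x i = zeroExt hnm b i := by
      rcases eq_castLE_or_zeroExt_eq_zero hnm i with ⟨j, rfl⟩ | h
      · have hxi : x (Fin.castLE hnm j) ≠ 0 := (hx.1 j).ne'
        rw [← Complex.ofReal_mul, div_mul_cancel₀ _ hxi]
      · simp [h]
    push_cast at hparts hB ⊢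
    linear_combination hparts - 4 * betaPotential hnm b (a + 1) κ (fun _ => 1) x₀ ε x * hB
  have hrec := betaPotential_recurrence hx₀ hb ha hx
  have hsumb : ∑ i, (zeroExt hnm b i : ℂ) = ((∑ j, b j : ℝ) : ℂ) := by
    rw [sum_eq_sum_castLE hnm (F := fun i => (zeroExt hnm b i : ℂ)) (fun i hi => by simp [hi])]
    simp
  simp only [hterm]
  rw [Finset.sum_sub_distrib, Finset.sum_add_distrib, Finset.sum_add_distrib, Finset.sum_const,
    ← Finset.mul_sum, ← Finset.mul_sum, ← Finset.mul_sum, ← Finset.sum_mul, ← Finset.sum_mul, hsumb,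
    Finset.card_univ, Fintype.card_fin, nsmul_eq_mul]
  have hr : ∑ i, (((x i - x₀ i) ^ 2 : ℝ) : ℂ) = (rSq x x₀ : ℂ) := by
    rw [rSq]; push_cast; rfl
  have ha' : ((∑ j, b j : ℝ) : ℂ) = a - (m : ℂ) / 2 + 1 := by
    rw [hab]; push_cast; ring
  rw [hr, ha']
  push_cast at hrec ⊢
  linear_combination 4 * hrec

end

/-! ### Conjugation by powers and symmetry of the operator -/

section
variable {m n : ℕ} (hnm : n ≤ m)

/-- The product of the powers `x_j ^ e_j`, `j ≤ n`. -/
def coordPower (e : Fin n → ℝ) (x : EuclideanSpace ℝ (Fin m)) : ℝ :=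
  ∏ j, x (Fin.castLE hnm j) ^ e j

variable {hnm}

lemma coordPower_eq_exp (e : Fin n → ℝ) {x : EuclideanSpace ℝ (Fin m)} (hx : x ∈ posDomain hnm) :
    coordPower hnm e x = Real.exp (∑ j, Real.log (x (Fin.castLE hnm j)) * e j) := by
  rw [Real.exp_sum, coordPower]
  exact Finset.prod_congr rfl fun j _ => Real.rpow_def_of_pos (hx j) _

lemma contDiffOn_coordPower (e : Fin n → ℝ) {N : WithTop ℕ∞} :
    ContDiffOn ℝ N (coordPower hnm e) (posDomain hnm) := by
  refine ContDiffOn.congr (f := fun x => Real.exp (∑ j, Real.log (x (Fin.castLE hnm j)) * e j)) ?_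
    fun x hx => coordPower_eq_exp e hx
  refine Real.contDiff_exp.comp_contDiffOn (ContDiffOn.sum fun j _ => ContDiffOn.mul ?_
    contDiffOn_const)
  refine ContDiffOn.log (by fun_prop) fun x hx => (hx j).ne'

lemma hasFDerivAt_coordPower (e : Fin n → ℝ) {x : EuclideanSpace ℝ (Fin m)}
    (hx : x ∈ posDomain hnm) :
    HasFDerivAt (coordPower hnm e) (coordPower hnm e x • ∑ j, e j • (x (Fin.castLE hnm j))⁻¹ •
      (EuclideanSpace.proj (Fin.castLE hnm j) : EuclideanSpace ℝ (Fin m) →L[ℝ] ℝ)) x := by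
  have h1 : HasFDerivAt (fun x : EuclideanSpace ℝ (Fin m) =>
      Real.exp (∑ j, Real.log (x (Fin.castLE hnm j)) * e j)) _ x :=
    (HasFDerivAt.fun_sum fun j _ =>
      ((hasFDerivAt_coord (Fin.castLE hnm j) x).log (hx j).ne').mul_const (e j)).exp
  rw [coordPower_eq_exp e hx]
  refine h1.congr_of_eventuallyEq ?_
  filter_upwards [(isOpen_posDomain hnm).mem_nhds hx] with y hy
  exact coordPower_eq_exp e hy

lemma partialDeriv_coordPower (e : Fin n → ℝ) {x : EuclideanSpace ℝ (Fin m)}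
    (hx : x ∈ posDomain hnm) (i : Fin m) :
    DifferentiableAt ℝ (fun x => (coordPower hnm e x : ℂ)) x ∧
    partialDeriv i (fun x => (coordPower hnm e x : ℂ)) x =
      (coordPower hnm e x : ℂ) * ((zeroExt hnm e i / x i : ℝ) : ℂ) := by
  have h := partialDeriv_ofReal (i := i) (hasFDerivAt_coordPower e hx)
  refine ⟨h.1, h.2.trans ?_⟩
  rw [← Complex.ofReal_mul]
  congr 1
  simp only [FunLike.coe_smul, Pi.smul_apply, sum_apply, smul_eq_mul]
  congr 1
  rcases eq_castLE_or_zeroExt_eq_zero hnm i with ⟨j, rfl⟩ | h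
  · rw [Finset.sum_eq_single j]
    · simp [div_eq_mul_inv]
    · intro j' _ hj'
      have : Fin.castLE hnm j' ≠ Fin.castLE hnm j := fun h => hj' (Fin.castLE_injective hnm h)
      simp [this]
    · simp
  · have h3 : ∀ j, Fin.castLE hnm j ≠ i := by
      rintro j rfl
      have := h fun _ => 1
      simp at this
    simp [h3, h]

lemma partialDeriv_zeroExt_div (e : Fin n → ℝ) {x : EuclideanSpace ℝ (Fin m)}
    (hx : x ∈ posDomain hnm) (i : Fin m) :
    DifferentiableAt ℝ (fun x : EuclideanSpace ℝ (Fin m) => ((zeroExt hnm e i / x i : ℝ) : ℂ)) x ∧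
    partialDeriv i (fun x => ((zeroExt hnm e i / x i : ℝ) : ℂ)) x =
      ((-(zeroExt hnm e i / x i ^ 2) : ℝ) : ℂ) := by
  rcases eq_castLE_or_zeroExt_eq_zero hnm i with ⟨j, rfl⟩ | h
  · have hxj : x (Fin.castLE hnm j) ≠ 0 := (hx j).ne'
    have h1 := (((hasDerivAt_inv hxj).comp_hasFDerivAt x
      (hasFDerivAt_coord (Fin.castLE hnm j) x))).const_mul (e j)
    have h2 := partialDeriv_ofReal (i := Fin.castLE hnm j) h1
    simp only [zeroExt_castLE, div_eq_mul_inv]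
    refine ⟨h2.1, h2.2.trans ?_⟩
    simp
  · simp only [h, zero_div, Complex.ofReal_zero, neg_zero]
    refine ⟨differentiableAt_const _, ?_⟩
    simp [partialDeriv]

lemma contDiffOn_partialDeriv {U : Set (EuclideanSpace ℝ (Fin m))} (hU : IsOpen U) {N : ℕ}
    {u : EuclideanSpace ℝ (Fin m) → ℂ} (hu : ContDiffOn ℝ (N + 1 : ℕ) u U) (i : Fin m) :
    ContDiffOn ℝ N (partialDeriv i u) U := by
  have h : ContDiffOn ℝ N (fderiv ℝ u) U := hu.fderiv_of_isOpen hU (by push_cast; exact le_rfl)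
  exact h.clm_apply contDiffOn_const

lemma helmholtzOp_eq_sum (α : Fin n → ℝ) (lam : ℂ) (u : EuclideanSpace ℝ (Fin m) → ℂ)
    (x : EuclideanSpace ℝ (Fin m)) :
    helmholtzOp hnm α lam u x = ∑ i, (partialDeriv i (partialDeriv i u) x +
      ((2 * zeroExt hnm α i / x i : ℝ) : ℂ) * partialDeriv i u x) - lam ^ 2 * u x := by
  rw [helmholtzOp, Finset.sum_add_distrib, sum_eq_sum_castLE hnm
    (F := fun i => ((2 * zeroExt hnm α i / x i : ℝ) : ℂ) * partialDeriv i u x)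
    (fun i hi => by simp [hi])]
  simp only [zeroExt_castLE]

/-- Conjugation by `∏ x_j ^ e_j` with `e_j ∈ {0, 1 - 2 α_j}` changes `α_j` into `α_j + e_j`. -/
lemma helmholtzOp_coordPower_mul {α e : Fin n → ℝ} (he : ∀ j, e j = 0 ∨ e j = 1 - 2 * α j)
    (lam : ℂ) {U : Set (EuclideanSpace ℝ (Fin m))} (hU : IsOpen U) (hUpos : U ⊆ posDomain hnm)
    {u : EuclideanSpace ℝ (Fin m) → ℂ} (hu : ContDiffOn ℝ (2 : ℕ) u U)
    {x : EuclideanSpace ℝ (Fin m)} (hx : x ∈ U) :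
    helmholtzOp hnm α lam (fun x => (coordPower hnm e x : ℂ) * u x) x =
      (coordPower hnm e x : ℂ) * helmholtzOp hnm (fun j => α j + e j) lam u x := by
  rw [helmholtzOp_eq_sum, helmholtzOp_eq_sum, mul_sub, Finset.mul_sum]
  congr 1
  swap
  · ring
  refine Finset.sum_congr rfl fun i _ => ?_
  have hud : ∀ y ∈ U, DifferentiableAt ℝ u y := fun y hy =>
    (hu.contDiffAt (hU.mem_nhds hy)).differentiableAt (by norm_num)
  have hud' : ∀ y ∈ U, DifferentiableAt ℝ (partialDeriv i u) y := fun y hy =>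
    ((contDiffOn_partialDeriv hU (N := 1) hu i).contDiffAt (hU.mem_nhds hy)).differentiableAt
      (by norm_num)
  have hfirst : ∀ y ∈ U, partialDeriv i (fun x => (coordPower hnm e x : ℂ) * u x) y =
      (coordPower hnm e y : ℂ) *
        (((zeroExt hnm e i / y i : ℝ) : ℂ) * u y + partialDeriv i u y) := by
    intro y hy
    obtain ⟨h1, h2⟩ := partialDeriv_coordPower e (hUpos hy) i
    rw [partialDeriv_mul h1 (hud y hy), h2]
    ring
  have hev : partialDeriv i (fun x => (coordPower hnm e x : ℂ) * u x) =ᶠ[nhds x]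
      fun y => (coordPower hnm e y : ℂ) *
        (((zeroExt hnm e i / y i : ℝ) : ℂ) * u y + partialDeriv i u y) := by
    filter_upwards [hU.mem_nhds hx] with y hy using hfirst y hy
  obtain ⟨h1, h2⟩ := partialDeriv_coordPower e (hUpos hx) i
  obtain ⟨h3, h4⟩ := partialDeriv_zeroExt_div e (hUpos hx) i
  have h5 : DifferentiableAt ℝ (fun y => ((zeroExt hnm e i / y i : ℝ) : ℂ) * u y) x :=
    h3.mul (hud x hx)
  have h6 : DifferentiableAt ℝ
      (fun y => ((zeroExt hnm e i / y i : ℝ) : ℂ) * u y + partialDeriv i u y) x :=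
    h5.add (hud' x hx)
  rw [partialDeriv_congr hev, partialDeriv_mul h1 h6, partialDeriv_add h5 (hud' x hx),
    partialDeriv_mul h3 (hud x hx), h2, h4, hfirst x hx]
  rcases eq_castLE_or_zeroExt_eq_zero hnm i with ⟨j, rfl⟩ | h
  · have hxj : ((x (Fin.castLE hnm j) : ℝ) : ℂ) ≠ 0 := by exact_mod_cast (hUpos hx j).ne'
    simp only [zeroExt_castLE]
    -- Both values are roots of the indicial equation e(e - 1) + 2αe = 0, so the terms in u/x²
    -- cancel and the first-order coefficient becomes 2(α + e)/x.
    rcases he j with h0 | h0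
    · rw [h0]
      push_cast
      ring
    · rw [h0]
      push_cast
      field_simp
      ring
  · simp only [h]
    push_cast
    ring

open MeasureTheory in
lemma integrable_mul_of_compact {U K : Set (EuclideanSpace ℝ (Fin m))} (hK : IsCompact K)
    (hKU : K ⊆ U) {F G : EuclideanSpace ℝ (Fin m) → ℂ} (hF : ContinuousOn F U)
    (hG : Continuous G) (hGK : ∀ x, x ∉ K → G x = 0) : Integrable (fun x => F x * G x) := by
  have h1 : IntegrableOn (fun x => F x * G x) K :=
    ((hF.mono hKU).mul hG.continuousOn).integrableOn_compact hK
  refine (integrableOn_iff_integrable_of_support_subset fun x hx => ?_).1 h1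
  by_contra hxK
  exact hx (by simp [hGK x hxK])

lemma weight_eq_coordPower (α : Fin n → ℝ) (x : EuclideanSpace ℝ (Fin m)) :
    weight hnm α x = coordPower hnm (fun j => 2 * α j) x := rfl

lemma zeroExt_two_mul (α : Fin n → ℝ) (i : Fin m) :
    zeroExt hnm (fun j => 2 * α j) i = 2 * zeroExt hnm α i := by
  unfold zeroExt
  split_ifs <;> simp

open MeasureTheory in
lemma integral_weight_mul_partialDeriv {α : Fin n → ℝ} {v g : EuclideanSpace ℝ (Fin m) → ℂ}
    (hv : ContDiffOn ℝ (1 : ℕ) v (posDomain hnm)) (hg : ContDiff ℝ (1 : ℕ) g)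
    {K : Set (EuclideanSpace ℝ (Fin m))} (hK : IsCompact K) (hKpos : K ⊆ posDomain hnm)
    (hgK : tsupport g ⊆ K) (i : Fin m) :
    ∫ x, v x * weight hnm α x * partialDeriv i g x =
      -∫ x, (partialDeriv i v x + ((2 * zeroExt hnm α i / x i : ℝ) : ℂ) * v x) *
        weight hnm α x * g x := by
  have hopen := isOpen_posDomain hnm
  have hgc : Continuous g := hg.continuous
  have hg'c : Continuous (partialDeriv i g) :=
    (contDiffOn_univ.1 (contDiffOn_partialDeriv isOpen_univ (N := 0)
      (contDiffOn_univ.2 hg) i)).continuous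
  have hg0 : ∀ x, x ∉ K → g x = 0 := fun x hx =>
    image_eq_zero_of_notMem_tsupport fun h => hx (hgK h)
  have hg'0 : ∀ x, x ∉ K → partialDeriv i g x = 0 := fun x hx => by
    rw [partialDeriv, fderiv_of_notMem_tsupport ℝ fun h => hx (hgK h)]
    rfl
  have hwc : ContinuousOn (fun x => (weight hnm α x : ℂ)) (posDomain hnm) :=
    Complex.continuous_ofReal.comp_continuousOn
      (contDiffOn_coordPower (fun j => 2 * α j) (N := 0)).continuousOn
  have hdiff : ∀ x ∈ posDomain hnm, DifferentiableAt ℝ v x := fun x hx =>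
    (hv.contDiffAt (hopen.mem_nhds hx)).differentiableAt (by norm_num)
  have hwd : ∀ x ∈ posDomain hnm, DifferentiableAt ℝ (fun x => (weight hnm α x : ℂ)) x :=
    fun x hx => (partialDeriv_coordPower (fun j => 2 * α j) hx i).1
  have hderiv : ∀ x ∈ posDomain hnm,
      partialDeriv i (fun x => v x * weight hnm α x) x =
        (partialDeriv i v x + ((2 * zeroExt hnm α i / x i : ℝ) : ℂ) * v x) * weight hnm α x := by
    intro x hx
    rw [partialDeriv_mul (hdiff x hx) (hwd x hx)]
    have h := (partialDeriv_coordPower (fun j => 2 * α j) hx i).2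
    simp only [zeroExt_two_mul] at h
    simp only [weight_eq_coordPower]
    rw [h]
    ring
  -- Nothing is known about `v` outside the domain, but `g` vanishes off `K`, so the two sides agree
  -- everywhere.
  have heq : (fun x => partialDeriv i (fun x => v x * weight hnm α x) x * g x) = fun x =>
      (partialDeriv i v x + ((2 * zeroExt hnm α i / x i : ℝ) : ℂ) * v x) *
        weight hnm α x * g x := by
    funext x
    by_cases hx : x ∈ K
    · rw [hderiv x (hKpos hx)]
    · rw [hg0 x hx, mul_zero, mul_zero]
  have hvc := hv.continuousOn
  have hv'c : ContinuousOn (partialDeriv i v) (posDomain hnm) :=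
    (contDiffOn_partialDeriv hopen (N := 0) hv i).continuousOn
  have hcoef : ContinuousOn (fun x : EuclideanSpace ℝ (Fin m) =>
      ((2 * zeroExt hnm α i / x i : ℝ) : ℂ)) (posDomain hnm) := fun x hx => by
    have h := (partialDeriv_zeroExt_div (fun j => 2 * α j) hx i).1.continuousAt
    simp only [zeroExt_two_mul] at h
    exact h.continuousWithinAt
  have key := integral_mul_fderiv_eq_neg_fderiv_mul_of_integrable
    (f := fun x => v x * weight hnm α x) (g := g) (μ := volume) (v := EuclideanSpace.single i 1)
    ?_ ?_ ?_ ?_ ?_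
  · rw [← heq]
    exact key
  · have h := integrable_mul_of_compact hK hKpos ((hv'c.add (hcoef.mul hvc)).mul hwc) hgc hg0
    have h2 : Integrable (fun x => (partialDeriv i v x +
      ((2 * zeroExt hnm α i / x i : ℝ) : ℂ) * v x) * weight hnm α x * g x) := h
    rw [← heq] at h2
    exact h2
  · exact integrable_mul_of_compact hK hKpos (hvc.mul hwc) hg'c hg'0
  · exact integrable_mul_of_compact hK hKpos (hvc.mul hwc) hgc hg0
  · exact fun x hx => (hdiff x (hKpos (hgK hx))).mul (hwd x (hKpos (hgK hx)))
  · exact fun x _ => (hg.differentiable (by norm_num)) x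

open MeasureTheory in
/-- The formal symmetry of `L` with respect to the weight. -/
lemma integral_mul_helmholtzOp {α : Fin n → ℝ} (lam : ℂ) {u φ : EuclideanSpace ℝ (Fin m) → ℂ}
    (hu : ContDiffOn ℝ (2 : ℕ) u (posDomain hnm)) (hφ : ContDiff ℝ (2 : ℕ) φ)
    (hφc : HasCompactSupport φ) (hφpos : tsupport φ ⊆ posDomain hnm) :
    ∫ x, u x * helmholtzOp hnm α lam φ x * weight hnm α x =
      ∫ x, helmholtzOp hnm α lam u x * weight hnm α x * φ x := by
  have hopen := isOpen_posDomain hnm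
  have hK : IsCompact (tsupport φ) := hφc
  have hφ1 : ContDiff ℝ (1 : ℕ) φ := hφ.of_le (by norm_num)
  have hφ' : ∀ i, ContDiff ℝ (1 : ℕ) (partialDeriv i φ) := fun i =>
    contDiffOn_univ.1 (contDiffOn_partialDeriv isOpen_univ (contDiffOn_univ.2 hφ) i)
  have hφ'' : ∀ i, Continuous (partialDeriv i (partialDeriv i φ)) := fun i =>
    (contDiffOn_univ.1 (contDiffOn_partialDeriv isOpen_univ (N := 0)
      (contDiffOn_univ.2 (hφ' i)) i)).continuous
  have hφ's : ∀ i, tsupport (partialDeriv i φ) ⊆ tsupport φ := fun i =>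
    tsupport_fderiv_apply_subset ℝ (EuclideanSpace.single i (1 : ℝ))
  have hφ''s : ∀ i, tsupport (partialDeriv i (partialDeriv i φ)) ⊆ tsupport φ := fun i =>
    (tsupport_fderiv_apply_subset ℝ (EuclideanSpace.single i (1 : ℝ))).trans (hφ's i)
  have hz : ∀ {g : EuclideanSpace ℝ (Fin m) → ℂ}, tsupport g ⊆ tsupport φ →
      ∀ x, x ∉ tsupport φ → g x = 0 := fun h x hx =>
    image_eq_zero_of_notMem_tsupport fun h' => hx (h h')
  have hu1 : ContDiffOn ℝ (1 : ℕ) u (posDomain hnm) := hu.of_le (by norm_num)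
  have hu' : ∀ i, ContDiffOn ℝ (1 : ℕ) (partialDeriv i u) (posDomain hnm) := fun i =>
    contDiffOn_partialDeriv hopen hu i
  have hu'' : ∀ i, ContinuousOn (partialDeriv i (partialDeriv i u)) (posDomain hnm) := fun i =>
    (contDiffOn_partialDeriv hopen (N := 0) (hu' i) i).continuousOn
  have hwc : ContinuousOn (fun x => (weight hnm α x : ℂ)) (posDomain hnm) :=
    Complex.continuous_ofReal.comp_continuousOn
      (contDiffOn_coordPower (fun j => 2 * α j) (N := 0)).continuousOn
  have hcoef : ∀ i, ContinuousOn (fun x : EuclideanSpace ℝ (Fin m) =>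
      ((2 * zeroExt hnm α i / x i : ℝ) : ℂ)) (posDomain hnm) := fun i x hx => by
    have h := (partialDeriv_zeroExt_div (fun j => 2 * α j) hx i).1.continuousAt
    simp only [zeroExt_two_mul] at h
    exact h.continuousWithinAt
  have hi1 : ∀ i, Integrable fun x => u x * weight hnm α x * partialDeriv i (partialDeriv i φ) x :=
    fun i => integrable_mul_of_compact hK hφpos (hu1.continuousOn.mul hwc) (hφ'' i) (hz (hφ''s i))
  have hi2 : ∀ i, Integrable fun x => u x * weight hnm α x *
      ((2 * zeroExt hnm α i / x i : ℝ) : ℂ) * partialDeriv i φ x := fun i =>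
    integrable_mul_of_compact hK hφpos ((hu1.continuousOn.mul hwc).mul (hcoef i))
      (hφ' i).continuous (hz (hφ's i))
  have hi12 : ∀ i, Integrable fun x =>
      u x * weight hnm α x * partialDeriv i (partialDeriv i φ) x +
      u x * weight hnm α x * ((2 * zeroExt hnm α i / x i : ℝ) : ℂ) * partialDeriv i φ x :=
    fun i => (hi1 i).add (hi2 i)
  have hi3 : ∀ i, Integrable fun x => partialDeriv i u x * weight hnm α x * partialDeriv i φ x :=
    fun i => integrable_mul_of_compact hK hφpos ((hu' i).continuousOn.mul hwc)
      (hφ' i).continuous (hz (hφ's i))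
  have hi4 : ∀ i, Integrable fun x => (partialDeriv i (partialDeriv i u) x +
      ((2 * zeroExt hnm α i / x i : ℝ) : ℂ) * partialDeriv i u x) * weight hnm α x * φ x :=
    fun i => integrable_mul_of_compact hK hφpos
      (((hu'' i).add ((hcoef i).mul (hu' i).continuousOn)).mul hwc) hφ.continuous (hz subset_rfl)
  have hi5 : Integrable fun x => u x * weight hnm α x * φ x :=
    integrable_mul_of_compact hK hφpos (hu1.continuousOn.mul hwc) hφ.continuous (hz subset_rfl)
  -- The first integration by parts also differentiates the weight; the resulting term in 2α/x
  -- cancels the first-order term of the operator on φ, and the second integration recreates it on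
  -- `u`.
  have hterm : ∀ i, ∫ x, (u x * weight hnm α x * partialDeriv i (partialDeriv i φ) x +
      u x * weight hnm α x * ((2 * zeroExt hnm α i / x i : ℝ) : ℂ) * partialDeriv i φ x) =
      ∫ x, (partialDeriv i (partialDeriv i u) x +
        ((2 * zeroExt hnm α i / x i : ℝ) : ℂ) * partialDeriv i u x) * weight hnm α x * φ x := by
    intro i
    have h1 := integral_weight_mul_partialDeriv (α := α) hu1 (hφ' i) hK hφpos (hφ's i) i
    have h2 := integral_weight_mul_partialDeriv (α := α) (hu' i) hφ1 hK hφpos subset_rfl i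
    have h3 : ∫ x, (partialDeriv i u x + ((2 * zeroExt hnm α i / x i : ℝ) : ℂ) * u x) *
        weight hnm α x * partialDeriv i φ x =
        (∫ x, partialDeriv i u x * weight hnm α x * partialDeriv i φ x) +
        ∫ x, u x * weight hnm α x * ((2 * zeroExt hnm α i / x i : ℝ) : ℂ) *
          partialDeriv i φ x := by
      rw [← integral_add (hi3 i) (hi2 i)]
      refine integral_congr_ae (Filter.Eventually.of_forall fun x => ?_)
      simp only
      ring
    rw [integral_add (hi1 i) (hi2 i), h1, h3, h2]
    ring
  have hL : ∀ x, u x * helmholtzOp hnm α lam φ x * weight hnm α x =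
      (∑ i, (u x * weight hnm α x * partialDeriv i (partialDeriv i φ) x +
        u x * weight hnm α x * ((2 * zeroExt hnm α i / x i : ℝ) : ℂ) * partialDeriv i φ x)) -
      lam ^ 2 * (u x * weight hnm α x * φ x) := by
    intro x
    rw [helmholtzOp_eq_sum, mul_sub, sub_mul, Finset.mul_sum, Finset.sum_mul]
    refine congrArg₂ _ (Finset.sum_congr rfl fun i _ => by ring) (by ring)
  have hR : ∀ x, helmholtzOp hnm α lam u x * weight hnm α x * φ x =
      (∑ i, (partialDeriv i (partialDeriv i u) x +
        ((2 * zeroExt hnm α i / x i : ℝ) : ℂ) * partialDeriv i u x) * weight hnm α x * φ x) -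
      lam ^ 2 * (u x * weight hnm α x * φ x) := by
    intro x
    rw [helmholtzOp_eq_sum, sub_mul, sub_mul, Finset.sum_mul, Finset.sum_mul]
    refine congrArg₂ _ rfl (by ring)
  simp only [hL, hR]
  rw [integral_sub (integrable_finsetSum _ fun i _ => hi12 i) (hi5.const_mul _),
    integral_sub (integrable_finsetSum _ fun i _ => hi4 i) (hi5.const_mul _),
    integral_finsetSum _ fun i _ => hi12 i, integral_finsetSum _ fun i _ => hi4 i]
  simp only [hterm]

end

/-! ### Bounds near the pole, uniform in the regularization -/

open MeasureTheory in
-- The integrand is |x - x₀|^(-σm); in polar coordinates the radial exponent m - 1 - σm exceeds -1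
-- because `σ < 1`.
lemma integrableOn_rSq_rpow {m : ℕ} (hm : 0 < m) {σ : ℝ} (hσ : σ < 1)
    {K : Set (EuclideanSpace ℝ (Fin m))} (hK : IsCompact K) (x₀ : EuclideanSpace ℝ (Fin m)) :
    IntegrableOn (fun x => rSq x x₀ ^ (-(σ * (m / 2)))) K := by
  have : Nonempty (Fin m) := ⟨⟨0, hm⟩⟩
  obtain ⟨r, hr0, hr⟩ := hK.isBounded.subset_ball_lt 0 x₀
  refine IntegrableOn.mono_set ?_ hr
  have h1 : IntegrableOn (fun x : EuclideanSpace ℝ (Fin m) => ‖x‖ ^ (-(σ * m)))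
      (Metric.ball 0 r) := by
    rw [integrableOn_fun_norm_addHaar volume (f := fun y : ℝ => y ^ (-(σ * m)))]
    have h2 : IntegrableOn (fun y : ℝ => y ^ ((m : ℝ) - 1 + -(σ * m))) (Set.Ioo 0 r) := by
      rw [intervalIntegral.integrableOn_Ioo_rpow_iff hr0]
      have hm' : (0 : ℝ) < m := by exact_mod_cast hm
      nlinarith
    refine h2.congr_fun (fun y hy => ?_) measurableSet_Ioo
    beta_reduce
    rw [finrank_euclideanSpace_fin, smul_eq_mul, Real.rpow_add hy.1, ← Real.rpow_natCast,
      Nat.cast_sub hm, Nat.cast_one]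
  have h3 := (measurePreserving_sub_right (volume : Measure (EuclideanSpace ℝ (Fin m)))
    x₀).integrableOn_comp_preimage (MeasurableEquiv.subRight x₀).measurableEmbedding
    (f := fun x => ‖x‖ ^ (-(σ * m))) (s := Metric.ball 0 r)
  have h4 := h3.2 h1
  have h5 : (fun x => x - x₀) ⁻¹' Metric.ball 0 r = Metric.ball x₀ r := by
    ext x; simp [dist_eq_norm]
  rw [h5] at h4
  refine h4.congr_fun (fun x _ => ?_) measurableSet_ball
  simp only [Function.comp_apply]
  rw [rSq_eq_norm_sq, ← Real.rpow_natCast, ← Real.rpow_mul (norm_nonneg _)]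
  congr 1
  push_cast
  ring

section
variable {m n : ℕ} (hnm : n ≤ m)

/-- The quantity `r² + ∑ 4 t_j x_j x_{0j}`. -/
def kernelArg (x₀ x : EuclideanSpace ℝ (Fin m)) (t : Fin n → ℝ) : ℝ :=
  rSq x x₀ + ∑ j, t j * (4 * x₀ (Fin.castLE hnm j) * x (Fin.castLE hnm j))

variable {hnm}
variable {x₀ x : EuclideanSpace ℝ (Fin m)} {b : Fin n → ℝ}

lemma continuous_kernelArg :
    Continuous fun z : EuclideanSpace ℝ (Fin m) × (Fin n → ℝ) => kernelArg hnm x₀ z.1 z.2 := by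
  unfold kernelArg rSq
  fun_prop

lemma tubeForm_kernelPoint_eq (ε : ℝ) (x : EuclideanSpace ℝ (Fin m)) (t : Fin n → ℝ) :
    tubeForm t (kernelPoint hnm x₀ ε x) = ((kernelArg hnm x₀ x t + ε : ℝ) : ℂ) := by
  rw [tubeForm_kernelPoint, kernelArg]
  congr 1
  ring

lemma rSq_le_kernelArg (hx₀ : x₀ ∈ posDomain hnm) (hx : x ∈ posDomain hnm) {t : Fin n → ℝ}
    (ht : ∀ j, 0 ≤ t j) : rSq x x₀ ≤ kernelArg hnm x₀ x t := by
  refine le_add_of_nonneg_right (Finset.sum_nonneg fun j _ => ?_)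
  have := hx j
  have := hx₀ j
  have := ht j
  positivity

lemma kernelArg_le (hx₀ : x₀ ∈ posDomain hnm) (hx : x ∈ posDomain hnm) {t : Fin n → ℝ}
    (ht : ∀ j, t j ≤ 1) :
    kernelArg hnm x₀ x t ≤ kernelArg hnm x₀ x 1 := by
  refine add_le_add_right (Finset.sum_le_sum fun j _ => ?_) _
  have := hx j
  have := hx₀ j
  exact mul_le_mul_of_nonneg_right (ht j) (by positivity)

lemma mul_le_kernelArg (hx₀ : x₀ ∈ posDomain hnm) (hx : x ∈ posDomain hnm) {t : Fin n → ℝ}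
    (ht : ∀ j, 0 ≤ t j) (j : Fin n) :
    t j * (4 * x₀ (Fin.castLE hnm j) * x (Fin.castLE hnm j)) ≤ kernelArg hnm x₀ x t := by
  refine le_trans ?_ (le_add_of_nonneg_left (rSq_nonneg x x₀))
  refine Finset.single_le_sum
    (f := fun j => t j * (4 * x₀ (Fin.castLE hnm j) * x (Fin.castLE hnm j))) (fun j _ => ?_)
    (Finset.mem_univ j)
  have := hx j
  have := hx₀ j
  have := ht j
  positivity

/-- The kernel argument dominates r² and every c t_j, so its negative power can be shared out: the
portion m/2 goes to r² and the portion b_j to t_j. Since `σ < 1` will hold, the factors are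
integrable against dx and against Beta(b_j, b_j) respectively. -/
lemma kernelArg_rpow_le (hx₀ : x₀ ∈ posDomain hnm) (hx : x ∈ posDomain hnm) (hne : x ≠ x₀)
    {c : ℝ} (hc0 : 0 < c) (hc : ∀ j : Fin n, c ≤ 4 * x₀ (Fin.castLE hnm j) * x (Fin.castLE hnm j))
    {t : Fin n → ℝ} (ht : ∀ j, 0 < t j) (hb : ∀ j, 0 < b j) {σ ε : ℝ} (hσ : 0 ≤ σ) (hε : 0 ≤ ε) :
    (kernelArg hnm x₀ x t + ε) ^ (-(σ * (m / 2 + ∑ j, b j))) ≤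
      rSq x x₀ ^ (-(σ * (m / 2))) * ∏ j, (c * t j) ^ (-(σ * b j)) := by
  have hr := rSq_pos hne
  have h1 := rSq_le_kernelArg hx₀ hx fun j => (ht j).le
  have hX : 0 < kernelArg hnm x₀ x t + ε := by linarith
  have hexp : -(σ * (m / 2 + ∑ j, b j)) = -(σ * (m / 2)) + ∑ j, -(σ * b j) := by
    rw [Finset.sum_neg_distrib, ← Finset.mul_sum]; ring
  have hm0 : (0 : ℝ) ≤ m := Nat.cast_nonneg m
  rw [hexp, Real.rpow_add hX, Real.rpow_sum_of_pos hX]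
  refine mul_le_mul (Real.rpow_le_rpow_of_nonpos hr (by linarith) ?_)
    (Finset.prod_le_prod (fun j _ => by positivity) fun j _ => ?_)
    (Finset.prod_nonneg fun j _ => by positivity) (by positivity)
  · have : 0 ≤ σ * (m / 2) := by positivity
    linarith
  · have h2 := mul_le_kernelArg hx₀ hx (fun j => (ht j).le) j
    have h3 : c * t j ≤ t j * (4 * x₀ (Fin.castLE hnm j) * x (Fin.castLE hnm j)) := by
      rw [mul_comm c]
      exact mul_le_mul_of_nonneg_left (hc j) (ht j).le
    have hbj := hb j
    have htj := ht j
    refine Real.rpow_le_rpow_of_nonpos (by positivity) (by linarith) ?_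
    have : 0 ≤ σ * b j := by positivity
    linarith

lemma exists_pos_le_mul_coord {K : Set (EuclideanSpace ℝ (Fin m))} (hK : IsCompact K)
    (hKpos : K ⊆ posDomain hnm) (hx₀ : x₀ ∈ posDomain hnm) :
    ∃ c : ℝ, 0 < c ∧ ∀ x ∈ K, ∀ j : Fin n,
      c ≤ 4 * x₀ (Fin.castLE hnm j) * x (Fin.castLE hnm j) := by
  have hj : ∀ j : Fin n, ∃ c : ℝ, 0 < c ∧ ∀ x ∈ K,
      c ≤ 4 * x₀ (Fin.castLE hnm j) * x (Fin.castLE hnm j) := by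
    intro j
    rcases K.eq_empty_or_nonempty with rfl | hne
    · exact ⟨1, one_pos, by simp⟩
    · obtain ⟨y, hy, hmin⟩ := hK.exists_isMinOn hne
        (f := fun x : EuclideanSpace ℝ (Fin m) =>
          4 * x₀ (Fin.castLE hnm j) * x (Fin.castLE hnm j)) (by fun_prop)
      refine ⟨_, ?_, fun x hx => hmin hx⟩
      have := hKpos hy j
      have := hx₀ j
      positivity
  choose c hc0 hc using hj
  rcases isEmpty_or_nonempty (Fin n) with h | h
  · exact ⟨1, one_pos, fun x _ j => h.elim j⟩
  · obtain ⟨j₀, hj₀⟩ := Finite.exists_min c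
    exact ⟨c j₀, hc0 j₀, fun x hx j => (hj₀ j).trans (hc j x hx)⟩

open MeasureTheory in
lemma integrable_kernelArg_rpow (hx₀ : x₀ ∈ posDomain hnm) (hb : ∀ j, 0 < b j)
    (hx : x ∈ posDomain hnm) {ε : ℝ} (hε : 0 < rSq x x₀ + ε) (s : ℝ) :
    Integrable (fun t => (kernelArg hnm x₀ x t + ε) ^ s) (betaPi b) := by
  refine integrable_betaPi_of_continuousOn hb fun t ht => ?_
  have h1 := rSq_le_kernelArg hx₀ hx (fun j => ht.1 j)
  have hc : Continuous fun t => kernelArg hnm x₀ x t :=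
    (continuous_kernelArg (hnm := hnm) (x₀ := x₀)).comp (by fun_prop : Continuous fun t => (x, t))
  exact ((hc.add continuous_const).continuousAt.rpow_const
    (Or.inl (ne_of_gt (show 0 < kernelArg hnm x₀ x t + ε by linarith)))).continuousWithinAt

open MeasureTheory in
lemma exists_integral_kernelArg_rpow_le (hx₀ : x₀ ∈ posDomain hnm) (hb : ∀ j, 0 < b j)
    {K : Set (EuclideanSpace ℝ (Fin m))} (hK : IsCompact K) (hKpos : K ⊆ posDomain hnm)
    {σ : ℝ} (hσ0 : 0 ≤ σ) (hσ1 : σ < 1) :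
    ∃ C : ℝ, 0 ≤ C ∧ ∀ x ∈ K, x ≠ x₀ → ∀ ε : ℝ, 0 ≤ ε →
      ∫ t, (kernelArg hnm x₀ x t + ε) ^ (-(σ * (m / 2 + ∑ j, b j))) ∂betaPi b ≤
        C * rSq x x₀ ^ (-(σ * (m / 2))) := by
  have hprob := fun j => ProbabilityTheory.isProbabilityMeasureBeta (hb j) (hb j)
  obtain ⟨c, hc0, hc⟩ := exists_pos_le_mul_coord hK hKpos hx₀
  have hint : Integrable (fun t : Fin n → ℝ => ∏ j, (c ^ (-(σ * b j)) * t j ^ (-(σ * b j))))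
      (betaPi b) := by
    refine Integrable.fintype_prod (f := fun (j : Fin n) (t : ℝ) =>
      c ^ (-(σ * b j)) * t ^ (-(σ * b j))) fun j => ?_
    refine (integral_rpow_betaMeasure (hb j) ?_).1.const_mul _
    have := hb j
    nlinarith
  have heq : ∀ᵐ t ∂betaPi b, ∏ j, (c ^ (-(σ * b j)) * t j ^ (-(σ * b j))) =
      ∏ j, (c * t j) ^ (-(σ * b j)) := by
    filter_upwards [ae_betaPi hb] with t ht
    exact Finset.prod_congr rfl fun j _ => (Real.mul_rpow hc0.le (ht j).1.le).symm
  have hint' : Integrable (fun t : Fin n → ℝ => ∏ j, (c * t j) ^ (-(σ * b j))) (betaPi b) :=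
    hint.congr heq
  refine ⟨∫ t, ∏ j, (c * t j) ^ (-(σ * b j)) ∂betaPi b, ?_, fun x hx hne ε hε => ?_⟩
  · refine integral_nonneg_of_ae ?_
    filter_upwards [ae_betaPi hb] with t ht
    exact Finset.prod_nonneg fun j _ => Real.rpow_nonneg (mul_nonneg hc0.le (ht j).1.le) _
  · rw [mul_comm (∫ t, _ ∂betaPi b) (rSq x x₀ ^ _), ← integral_const_mul]
    refine integral_mono_ae
      (integrable_kernelArg_rpow hx₀ hb (hKpos hx) (by linarith [rSq_pos hne]) _)
      (hint'.const_mul _) ?_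
    filter_upwards [ae_betaPi hb] with t ht
    exact kernelArg_rpow_le hx₀ (hKpos hx) hne hc0 (hc x hx) (fun j => (ht j).1) hb hσ0 hε

lemma exists_kernelArg_le (hx₀ : x₀ ∈ posDomain hnm) {K : Set (EuclideanSpace ℝ (Fin m))}
    (hK : IsCompact K) (hKpos : K ⊆ posDomain hnm) :
    ∃ M : ℝ, ∀ x ∈ K, ∀ t : Fin n → ℝ, (∀ j, t j ≤ 1) → ∀ ε ≤ (1 : ℝ),
      kernelArg hnm x₀ x t + ε ≤ M := by
  have hc : Continuous fun x => kernelArg hnm x₀ x 1 := by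
    unfold kernelArg rSq
    fun_prop
  obtain ⟨M, hM⟩ := hK.exists_bound_of_continuousOn hc.continuousOn
  refine ⟨M + 1, fun x hx t ht ε hε => ?_⟩
  have h1 := kernelArg_le hx₀ (hKpos hx) ht
  have h2 := (le_abs_self _).trans (hM x hx)
  linarith

variable {a : ℝ} {κ : ℂ}

open MeasureTheory in
lemma exists_norm_betaPotential_le (hx₀ : x₀ ∈ posDomain hnm) (hb : ∀ j, 0 < b j)
    {K : Set (EuclideanSpace ℝ (Fin m))} (hK : IsCompact K) (hKpos : K ⊆ posDomain hnm)
    (ha0 : 0 ≤ a) (hm : 0 < m) (had : a < m / 2 + ∑ j, b j) :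
    ∃ C σ : ℝ, 0 ≤ C ∧ σ < 1 ∧ ∀ x ∈ K, x ≠ x₀ → ∀ ε : ℝ, 0 ≤ ε → ε ≤ 1 →
      ‖betaPotential hnm b a κ (fun _ => 1) x₀ ε x‖ ≤ C * rSq x x₀ ^ (-(σ * (m / 2))) := by
  have hm' : (0 : ℝ) < m := by exact_mod_cast hm
  have hD : 0 < (m : ℝ) / 2 + ∑ j, b j :=
    add_pos_of_pos_of_nonneg (by positivity) (Finset.sum_nonneg fun j _ => (hb j).le)
  -- The ratio of `a` to the critical exponent m/2 + ∑ b_j, which makes the sharing of powers exact.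
  set σ := a / ((m : ℝ) / 2 + ∑ j, b j) with hσ
  have hσ0 : 0 ≤ σ := by positivity
  have hσ1 : σ < 1 := by rw [hσ, div_lt_one hD]; exact had
  have hσa : σ * (m / 2 + ∑ j, b j) = a := by rw [hσ, div_mul_cancel₀ _ hD.ne']
  obtain ⟨C₁, hC₁, h1⟩ := exists_integral_kernelArg_rpow_le hx₀ hb hK hKpos hσ0 hσ1
  obtain ⟨M, hM⟩ := exists_kernelArg_le hx₀ hK hKpos
  obtain ⟨C₂, hC₂, h2⟩ := exists_norm_besselPsi_le a κ M
  refine ⟨C₂ * C₁, σ, by positivity, hσ1, fun x hx hne ε hε0 hε1 => ?_⟩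
  have h3 := h1 x hx hne ε hε0
  rw [hσa] at h3
  have hi := integrable_kernelArg_rpow hx₀ hb (hKpos hx) (ε := ε) (by linarith [rSq_pos hne]) (-a)
  calc ‖betaPotential hnm b a κ (fun _ => 1) x₀ ε x‖
      ≤ ∫ t, C₂ * (kernelArg hnm x₀ x t + ε) ^ (-a) ∂betaPi b := by
        refine norm_integral_le_of_norm_le (hi.const_mul _) ?_
        filter_upwards [ae_betaPi_Icc hb] with t ht
        have h4 := rSq_le_kernelArg hx₀ (hKpos hx) fun j => ht.1 j
        rw [one_mul, tubeForm_kernelPoint_eq]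
        exact h2 _ (by linarith [rSq_pos hne]) (hM x hx t (fun j => ht.2 j) ε hε1)
    _ ≤ C₂ * (C₁ * rSq x x₀ ^ (-(σ * (m / 2)))) := by
        rw [integral_const_mul]
        exact mul_le_mul_of_nonneg_left h3 hC₂
    _ = _ := by ring

lemma mem_kernelDomain_zero (hx : x ∈ posDomain hnm) (hne : x ≠ x₀) :
    x ∈ kernelDomain hnm x₀ 0 :=
  ⟨hx, by simpa using! rSq_pos hne⟩

lemma mem_kernelDomain_of_pos (hx : x ∈ posDomain hnm) {ε : ℝ} (hε : 0 < ε) :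
    x ∈ kernelDomain hnm x₀ ε :=
  ⟨hx, add_pos_of_nonneg_of_pos (rSq_nonneg x x₀) hε⟩

open MeasureTheory in
lemma aestronglyMeasurable_of_continuousOn_diff {F : EuclideanSpace ℝ (Fin m) → ℂ} (hm : 0 < m)
    {K U : Set (EuclideanSpace ℝ (Fin m))} (hKm : MeasurableSet K) (hKU : K ⊆ U)
    (hF : ContinuousOn F (U \ {x₀})) : AEStronglyMeasurable F (volume.restrict K) := by
  have : Nonempty (Fin m) := ⟨⟨0, hm⟩⟩
  have h1 : AEStronglyMeasurable F (volume.restrict (K \ {x₀})) :=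
    (hF.mono (Set.sdiff_subset_sdiff_left hKU)).aestronglyMeasurable
      (hKm.diff (measurableSet_singleton _))
  have h2 : (volume.restrict K : Measure (EuclideanSpace ℝ (Fin m))) =
      volume.restrict (K \ {x₀}) := by
    refine Measure.restrict_congr_set ?_
    exact (sdiff_null_ae_eq_self (measure_singleton x₀)).symm
  rwa [h2]

lemma continuousOn_betaPotential_zero (hx₀ : x₀ ∈ posDomain hnm) (hb : ∀ j, 0 < b j)
    (ha : Admissible a κ) :
    ContinuousOn (betaPotential hnm b a κ (fun _ => 1) x₀ 0) (posDomain hnm \ {x₀}) :=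
  (contDiffOn_betaPotential hx₀ hb ha continuous_const 0 0).continuousOn.mono
    fun _ hx => mem_kernelDomain_zero hx.1 hx.2

open MeasureTheory in
lemma integrableOn_betaPotential_zero (hx₀ : x₀ ∈ posDomain hnm) (hb : ∀ j, 0 < b j)
    (ha : Admissible a κ) (hm : 0 < m) (had : a < m / 2 + ∑ j, b j)
    {K : Set (EuclideanSpace ℝ (Fin m))} (hK : IsCompact K) (hKpos : K ⊆ posDomain hnm) :
    IntegrableOn (betaPotential hnm b a κ (fun _ => 1) x₀ 0) K := by
  have : Nonempty (Fin m) := ⟨⟨0, hm⟩⟩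
  obtain ⟨C, σ, hC, hσ, h⟩ := exists_norm_betaPotential_le (κ := κ) hx₀ hb hK hKpos ha.1.le hm had
  refine Integrable.mono' ((integrableOn_rSq_rpow hm hσ hK x₀).const_mul C)
    (aestronglyMeasurable_of_continuousOn_diff hm hK.measurableSet hKpos
      (continuousOn_betaPotential_zero hx₀ hb ha)) ?_
  filter_upwards [ae_restrict_mem hK.measurableSet,
    ae_restrict_of_ae (Measure.ae_ne volume x₀)] with x hx hne
  exact h x hx hne 0 le_rfl zero_le_one

open MeasureTheory Filter Topology in
-- The bound of `exists_norm_betaPotential_le` does not depend on ε in (0, 1], so dominated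
-- convergence applies.
lemma tendsto_integral_betaPotential (hx₀ : x₀ ∈ posDomain hnm) (hb : ∀ j, 0 < b j)
    (ha : Admissible a κ) (hm : 0 < m) (had : a < m / 2 + ∑ j, b j)
    {K : Set (EuclideanSpace ℝ (Fin m))} (hK : IsCompact K) (hKpos : K ⊆ posDomain hnm)
    {G : EuclideanSpace ℝ (Fin m) → ℂ} (hG : ContinuousOn G K) :
    Tendsto (fun ε => ∫ x in K, betaPotential hnm b a κ (fun _ => 1) x₀ ε x * G x) (𝓝[>] 0)
      (𝓝 (∫ x in K, betaPotential hnm b a κ (fun _ => 1) x₀ 0 x * G x)) := by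
  have : Nonempty (Fin m) := ⟨⟨0, hm⟩⟩
  obtain ⟨C, σ, hC, hσ, h⟩ := exists_norm_betaPotential_le (κ := κ) hx₀ hb hK hKpos ha.1.le hm had
  obtain ⟨B, hB⟩ := hK.exists_bound_of_continuousOn hG
  have hae : ∀ᵐ x ∂(volume.restrict K : Measure (EuclideanSpace ℝ (Fin m))), x ∈ K ∧ x ≠ x₀ := by
    filter_upwards [ae_restrict_mem hK.measurableSet,
      ae_restrict_of_ae (Measure.ae_ne volume x₀)] with x hx hne using ⟨hx, hne⟩
  refine tendsto_integral_filter_of_dominated_convergence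
    (fun x => C * rSq x x₀ ^ (-(σ * (m / 2))) * |B|) ?_ ?_
    (((integrableOn_rSq_rpow hm hσ hK x₀).const_mul C).mul_const _) ?_
  · filter_upwards [self_mem_nhdsWithin] with ε hε
    refine ContinuousOn.aestronglyMeasurable (ContinuousOn.mul ?_ hG) hK.measurableSet
    exact (contDiffOn_betaPotential hx₀ hb ha continuous_const ε 0).continuousOn.mono
      fun x hx => mem_kernelDomain_of_pos (hKpos hx) hε
  · filter_upwards [Ioc_mem_nhdsGT one_pos] with ε hε
    filter_upwards [hae] with x hx
    rw [norm_mul]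
    have := rSq_nonneg x x₀
    exact mul_le_mul (h x hx.1 hx.2 ε hε.1.le hε.2) ((hB x hx.1).trans (le_abs_self B))
      (norm_nonneg _) (by positivity)
  · filter_upwards [hae] with x hx
    refine Tendsto.mul_const _ ?_
    have h1 : ContinuousAt (betaTransform b a κ fun _ => 1) (kernelPoint hnm x₀ 0 x) :=
      (hasFDerivAt_betaTransform hb ha continuous_const (kernelPoint_mem_tubeDomain hx₀
        (mem_kernelDomain_zero (hKpos hx.1) hx.2))).continuousAt
    have h2 : Continuous fun ε => kernelPoint hnm x₀ ε x := by
      unfold kernelPoint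
      fun_prop
    exact (ContinuousAt.comp (f := fun ε => kernelPoint hnm x₀ ε x) h1
      h2.continuousAt).tendsto.mono_left nhdsWithin_le_nhds

end

/-! ### Laplace transforms and concentration at the pole -/

open MeasureTheory Set Filter Topology in
-- An Abelian theorem: the substitution v = εu gives ∫ e^(-v) Q(v/ε) dv, and Q(v/ε) tends boundedly
-- to the limit at infinity.
lemma tendsto_mul_laplace {Q : ℝ → ℂ} (hQ : StronglyMeasurable Q) {C : ℝ}
    (hC : ∀ u, 0 < u → ‖Q u‖ ≤ C) {l : ℂ} (hl : Tendsto Q atTop (𝓝 l)) :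
    Tendsto (fun ε : ℝ => (ε : ℂ) * ∫ u in Ioi (0 : ℝ), (Real.exp (-(ε * u)) : ℂ) * Q u)
      (𝓝[>] 0) (𝓝 l) := by
  have h1 : Tendsto (fun ε : ℝ => ∫ v in Ioi (0 : ℝ), (Real.exp (-v) : ℂ) * Q (ε⁻¹ * v))
      (𝓝[>] 0) (𝓝 (∫ v in Ioi (0 : ℝ), (Real.exp (-v) : ℂ) * l)) := by
    refine tendsto_integral_filter_of_dominated_convergence (fun v => Real.exp (-v) * C)
      ?_ ?_ ((integrableOn_exp_neg_Ioi 0).mul_const C) ?_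
    · refine Eventually.of_forall fun ε => ?_
      refine StronglyMeasurable.aestronglyMeasurable (StronglyMeasurable.mul ?_ ?_)
      · exact (by fun_prop : Continuous fun v : ℝ => (Real.exp (-v) : ℂ)).stronglyMeasurable
      · exact hQ.comp_measurable (measurable_const_mul _)
    · filter_upwards [self_mem_nhdsWithin] with ε hε
      refine ae_restrict_of_forall_mem measurableSet_Ioi fun v hv => ?_
      rw [norm_mul, Complex.norm_real, Real.norm_of_nonneg (Real.exp_nonneg _)]
      exact mul_le_mul_of_nonneg_left (hC _ (mul_pos (inv_pos.2 hε) hv)) (Real.exp_nonneg _)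
    · refine ae_restrict_of_forall_mem measurableSet_Ioi fun v hv => ?_
      refine Tendsto.const_mul _ (hl.comp ?_)
      exact tendsto_inv_nhdsGT_zero.atTop_mul_const hv
  have h2 : ∫ v in Ioi (0 : ℝ), (Real.exp (-v) : ℂ) * l = l := by
    rw [integral_mul_const, integral_complex_ofReal, integral_exp_neg_Ioi_zero]
    simp
  rw [h2] at h1
  refine h1.congr' ?_
  filter_upwards [self_mem_nhdsWithin] with ε hε
  have hε0 : ε ≠ 0 := (show 0 < ε from hε).ne'
  have hε' : (ε : ℂ) ≠ 0 := by exact_mod_cast hε0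
  have h3 := integral_comp_mul_left_Ioi
    (fun v => (Real.exp (-v) : ℂ) * Q (ε⁻¹ * v)) 0 (b := ε) hε
  rw [mul_zero] at h3
  have h4 : ∫ u in Ioi (0 : ℝ), (Real.exp (-(ε * u)) : ℂ) * Q u =
      ∫ u in Ioi (0 : ℝ), (Real.exp (-(ε * u)) : ℂ) * Q (ε⁻¹ * (ε * u)) := by
    refine integral_congr_ae (Eventually.of_forall fun u => ?_)
    simp only [inv_mul_cancel_left₀ hε0]
  rw [h4, h3, Complex.real_smul, Complex.ofReal_inv, mul_inv_cancel_left₀ hε']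

open MeasureTheory in
lemma measurable_betaLaplace {b : ℝ} (hb : 0 < b) : Measurable (betaLaplace b) := by
  have := ProbabilityTheory.isProbabilityMeasureBeta hb hb
  have h : StronglyMeasurable fun v : ℝ =>
      ∫ t, Real.exp (-(v * t)) ∂ProbabilityTheory.betaMeasure b b :=
    StronglyMeasurable.integral_prod_right
      (by fun_prop : Continuous fun z : ℝ × ℝ => Real.exp (-(z.1 * z.2))).stronglyMeasurable
  exact (measurable_id.pow_const b).mul h.measurable

open MeasureTheory in
lemma integrable_exp_neg_norm_sq (m : ℕ) :
    Integrable fun y : EuclideanSpace ℝ (Fin m) => Real.exp (-‖y‖ ^ 2) := by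
  refine Integrable.of_integral_ne_zero ?_
  have h := GaussianFourier.integral_rexp_neg_mul_sq_norm (V := EuclideanSpace ℝ (Fin m)) one_pos
  simp only [neg_mul, one_mul] at h
  rw [h]
  positivity

section
variable {m n : ℕ} {hnm : n ≤ m} {x₀ x : EuclideanSpace ℝ (Fin m)} {b : Fin n → ℝ}

/-- The inverse Laplace transform, in the regularization parameter, of the integral of a
regularized kernel against `h`. -/
def laplaceProfile (hnm : n ≤ m) (b : Fin n → ℝ) (x₀ : EuclideanSpace ℝ (Fin m))
    (h : EuclideanSpace ℝ (Fin m) → ℂ) (u : ℝ) : ℂ :=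
  ∫ x, h x * ((u ^ ((m : ℝ) / 2) * Real.exp (-(u * rSq x x₀)) *
    ∏ j, betaLaplace (b j) (u * (4 * x₀ (Fin.castLE hnm j) * x (Fin.castLE hnm j))) : ℝ) : ℂ)

lemma continuous_rSq (x₀ : EuclideanSpace ℝ (Fin m)) : Continuous fun x => rSq x x₀ :=
  (contDiff_rSq x₀ (N := 0)).continuous

open MeasureTheory in
lemma stronglyMeasurable_laplaceProfile (hb : ∀ j, 0 < b j)
    {h : EuclideanSpace ℝ (Fin m) → ℂ} (hh : Continuous h) :
    StronglyMeasurable (laplaceProfile hnm b x₀ h) := by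
  refine StronglyMeasurable.integral_prod_right (Measurable.stronglyMeasurable ?_)
  refine (hh.measurable.comp measurable_snd).mul (Complex.measurable_ofReal.comp ?_)
  refine ((measurable_fst.pow_const _).mul ?_).mul (Finset.measurable_prod _ fun j _ => ?_)
  · refine Real.measurable_exp.comp (measurable_fst.mul ?_).neg
    exact (continuous_rSq x₀).measurable.comp measurable_snd
  · refine (measurable_betaLaplace (hb j)).comp (Continuous.measurable ?_)
    fun_prop

open MeasureTheory in
-- Substitute x = x₀ + y/√u: the Jacobian cancels `u ^ (m / 2)` and the Gaussian becomes independent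
-- of `u`.
lemma laplaceProfile_eq (h : EuclideanSpace ℝ (Fin m) → ℂ) {u : ℝ} (hu : 0 < u) :
    laplaceProfile hnm b x₀ h u = ∫ y, h (x₀ + (√u)⁻¹ • y) * ((Real.exp (-‖y‖ ^ 2) *
      ∏ j, betaLaplace (b j) (u * (4 * x₀ (Fin.castLE hnm j) *
        (x₀ + (√u)⁻¹ • y) (Fin.castLE hnm j))) : ℝ) : ℂ) := by
  have hs : 0 < √u := Real.sqrt_pos.2 hu
  set g : EuclideanSpace ℝ (Fin m) → ℂ := fun y => h (x₀ + y) * ((Real.exp (-(u * ‖y‖ ^ 2)) *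
      ∏ j, betaLaplace (b j) (u * (4 * x₀ (Fin.castLE hnm j) *
        (x₀ + y) (Fin.castLE hnm j))) : ℝ) : ℂ) with hg
  have h1 : laplaceProfile hnm b x₀ h u = ((u ^ ((m : ℝ) / 2) : ℝ) : ℂ) * ∫ y, g y := by
    rw [laplaceProfile, ← integral_add_left_eq_self _ x₀, ← integral_const_mul]
    refine integral_congr_ae (Filter.Eventually.of_forall fun y => ?_)
    simp only [hg, rSq_eq_norm_sq, add_sub_cancel_left]
    push_cast
    ring
  have h2 := Measure.integral_comp_smul (volume : Measure (EuclideanSpace ℝ (Fin m))) g (√u)⁻¹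
  have h3 : |(((√u)⁻¹ ^ Module.finrank ℝ (EuclideanSpace ℝ (Fin m)))⁻¹ : ℝ)| =
      u ^ ((m : ℝ) / 2) := by
    rw [finrank_euclideanSpace_fin, inv_pow, inv_inv, abs_of_pos (by positivity),
      Real.sqrt_eq_rpow, ← Real.rpow_natCast, ← Real.rpow_mul hu.le]
    congr 1
    ring
  rw [h3, Complex.real_smul] at h2
  rw [h1, ← h2]
  refine integral_congr_ae (Filter.Eventually.of_forall fun y => ?_)
  have h4 : u * ‖(√u)⁻¹ • y‖ ^ 2 = ‖y‖ ^ 2 := by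
    rw [norm_smul, mul_pow, norm_inv, Real.norm_of_nonneg hs.le, inv_pow, Real.sq_sqrt hu.le,
      mul_inv_cancel_left₀ hu.ne']
  simp only [hg, h4]

open MeasureTheory in
lemma exists_norm_laplaceProfile_integrand_le (hx₀ : x₀ ∈ posDomain hnm)
    (hb : ∀ j, 0 < b j ∧ b j < 1) {h : EuclideanSpace ℝ (Fin m) → ℂ} (hh : Continuous h)
    (hc : HasCompactSupport h) (hpos : tsupport h ⊆ posDomain hnm) :
    ∃ C : ℝ, ∀ u, 0 < u → ∀ y x : EuclideanSpace ℝ (Fin m),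
      ‖h x * ((Real.exp (-‖y‖ ^ 2) * ∏ j, betaLaplace (b j) (u * (4 * x₀ (Fin.castLE hnm j) *
        x (Fin.castLE hnm j))) : ℝ) : ℂ)‖ ≤ C * Real.exp (-‖y‖ ^ 2) := by
  obtain ⟨B, hB⟩ := hc.exists_bound_of_continuous hh
  choose D hD0 hD using fun j => exists_betaLaplace_le (hb j).1 (hb j).2
  have hB0 : 0 ≤ B := (norm_nonneg _).trans (hB x₀)
  have hDp : 0 ≤ ∏ j, D j := Finset.prod_nonneg fun j _ => hD0 j
  refine ⟨B * ∏ j, D j, fun u hu y x => ?_⟩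
  -- `betaLaplace` is bounded at positive arguments only; where the argument might not be positive,
  -- `h` vanishes.
  by_cases hx : h x = 0
  · rw [hx, zero_mul, norm_zero]
    positivity
  · have hx' : x ∈ posDomain hnm := hpos (subset_tsupport _ hx)
    rw [norm_mul, Complex.norm_real, norm_mul, Real.norm_of_nonneg (Real.exp_nonneg _), norm_prod]
    have h1 : ∏ j, ‖betaLaplace (b j) (u * (4 * x₀ (Fin.castLE hnm j) *
        x (Fin.castLE hnm j)))‖ ≤ ∏ j, D j := by
      refine Finset.prod_le_prod (fun _ _ => norm_nonneg _) fun j _ => hD j _ ?_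
      have := hx' j
      have := hx₀ j
      positivity
    calc ‖h x‖ * (Real.exp (-‖y‖ ^ 2) * ∏ j, ‖betaLaplace (b j) (u * (4 *
          x₀ (Fin.castLE hnm j) * x (Fin.castLE hnm j)))‖)
        ≤ B * (Real.exp (-‖y‖ ^ 2) * ∏ j, D j) := by
          gcongr
          exact hB x
      _ = _ := by ring

open MeasureTheory in
lemma exists_norm_laplaceProfile_le (hx₀ : x₀ ∈ posDomain hnm)
    (hb : ∀ j, 0 < b j ∧ b j < 1) {h : EuclideanSpace ℝ (Fin m) → ℂ} (hh : Continuous h)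
    (hc : HasCompactSupport h) (hpos : tsupport h ⊆ posDomain hnm) :
    ∃ C : ℝ, ∀ u, 0 < u → ‖laplaceProfile hnm b x₀ h u‖ ≤ C := by
  obtain ⟨C, hC⟩ := exists_norm_laplaceProfile_integrand_le hx₀ hb hh hc hpos
  refine ⟨∫ y : EuclideanSpace ℝ (Fin m), C * Real.exp (-‖y‖ ^ 2), fun u hu => ?_⟩
  rw [laplaceProfile_eq h hu]
  exact norm_integral_le_of_norm_le ((integrable_exp_neg_norm_sq m).const_mul C)
    (Filter.Eventually.of_forall fun y => hC u hu y _)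

open MeasureTheory Filter Topology in
-- In the rescaled form the points tend to `x₀` and the arguments of `betaLaplace` tend to infinity,
-- so the integrand converges to a Gaussian times constants.
lemma tendsto_laplaceProfile (hx₀ : x₀ ∈ posDomain hnm)
    (hb : ∀ j, 0 < b j ∧ b j < 1) {h : EuclideanSpace ℝ (Fin m) → ℂ} (hh : Continuous h)
    (hc : HasCompactSupport h) (hpos : tsupport h ⊆ posDomain hnm) :
    Tendsto (laplaceProfile hnm b x₀ h) atTop
      (𝓝 (h x₀ * ((Real.pi ^ ((m : ℝ) / 2) *
        ∏ j, (Real.Gamma (2 * b j) / Real.Gamma (b j)) : ℝ) : ℂ))) := by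
  obtain ⟨C, hC⟩ := exists_norm_laplaceProfile_integrand_le hx₀ hb hh hc hpos
  have hlim : h x₀ * ((Real.pi ^ ((m : ℝ) / 2) *
        ∏ j, (Real.Gamma (2 * b j) / Real.Gamma (b j)) : ℝ) : ℂ) =
      ∫ y : EuclideanSpace ℝ (Fin m), h x₀ * ((Real.exp (-‖y‖ ^ 2) *
        ∏ j, (Real.Gamma (2 * b j) / Real.Gamma (b j)) : ℝ) : ℂ) := by
    have h1 := GaussianFourier.integral_rexp_neg_mul_sq_norm
      (V := EuclideanSpace ℝ (Fin m)) one_pos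
    simp only [neg_mul, one_mul, div_one, finrank_euclideanSpace_fin] at h1
    rw [integral_const_mul, integral_complex_ofReal, integral_mul_const, h1]
  rw [hlim]
  have hsq : Tendsto (fun u : ℝ => (√u)⁻¹) atTop (𝓝 0) :=
    tendsto_inv_atTop_zero.comp Real.tendsto_sqrt_atTop
  refine Tendsto.congr' (f₁ := fun u : ℝ => ∫ y, h (x₀ + (√u)⁻¹ • y) * ((Real.exp (-‖y‖ ^ 2) *
      ∏ j, betaLaplace (b j) (u * (4 * x₀ (Fin.castLE hnm j) *
        (x₀ + (√u)⁻¹ • y) (Fin.castLE hnm j))) : ℝ) : ℂ)) ?_ ?_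
  · filter_upwards [eventually_gt_atTop 0] with u hu using (laplaceProfile_eq h hu).symm
  refine tendsto_integral_filter_of_dominated_convergence (fun y => C * Real.exp (-‖y‖ ^ 2))
    (Eventually.of_forall fun u => ?_) ?_ ((integrable_exp_neg_norm_sq m).const_mul C) ?_
  · refine Measurable.aestronglyMeasurable (Measurable.mul ?_ ?_)
    · exact (hh.comp (by fun_prop)).measurable
    · refine Complex.measurable_ofReal.comp (Measurable.mul ?_ ?_)
      · exact Continuous.measurable (by fun_prop)
      · refine Finset.measurable_prod _ fun j _ => ?_
        exact (measurable_betaLaplace (hb j).1).comp (Continuous.measurable (by fun_prop))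
  · filter_upwards [eventually_gt_atTop 0] with u hu
    exact Eventually.of_forall fun y => hC u hu y _
  · refine Eventually.of_forall fun y => ?_
    have hpt : Tendsto (fun u : ℝ => x₀ + (√u)⁻¹ • y) atTop (𝓝 x₀) := by
      simpa using tendsto_const_nhds.add (hsq.smul_const y)
    refine Tendsto.mul ((hh.tendsto x₀).comp hpt)
      ((Complex.continuous_ofReal.tendsto _).comp (Tendsto.const_mul _ ?_))
    refine tendsto_finsetProd _ fun j _ => (tendsto_betaLaplace (hb j).1 (hb j).2).comp ?_
    have hx := hx₀ j
    refine Tendsto.atTop_mul_pos (C := 4 * x₀ (Fin.castLE hnm j) * x₀ (Fin.castLE hnm j))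
      (by positivity) tendsto_id (Tendsto.const_mul _ ?_)
    have hcoord : Continuous fun z : EuclideanSpace ℝ (Fin m) => z (Fin.castLE hnm j) := by
      fun_prop
    exact (hcoord.tendsto x₀).comp hpt

end

open MeasureTheory Set in
lemma integrableOn_rpow_mul_exp {s ε : ℝ} (hs : 0 < s) (hε : 0 < ε) :
    IntegrableOn (fun u : ℝ => u ^ (s - 1) * Real.exp (-(ε * u))) (Ioi 0) := by
  refine (integrableOn_rpow_mul_exp_neg_mul_rpow (p := 1) (s := s - 1) (b := ε) (by linarith)
    one_pos hε).congr_fun (fun u _ => ?_) measurableSet_Ioi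
  simp only [Real.rpow_one, neg_mul]

section
variable {m n : ℕ} {hnm : n ≤ m} {x₀ x : EuclideanSpace ℝ (Fin m)} {b : Fin n → ℝ}

open MeasureTheory in
lemma integral_exp_betaPi (y : Fin n → ℝ) (hb : ∀ j, 0 < b j) :
    ∫ t, Real.exp (-∑ j, t j * y j) ∂betaPi b =
      ∏ j, ∫ t, Real.exp (-(y j * t)) ∂ProbabilityTheory.betaMeasure (b j) (b j) := by
  have hprob := fun j => ProbabilityTheory.isProbabilityMeasureBeta (hb j) (hb j)
  rw [betaPi, ← integral_fintype_prod_eq_prod]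
  refine integral_congr_ae (Filter.Eventually.of_forall fun t => ?_)
  simp only [← Real.exp_sum, Finset.sum_neg_distrib]
  congr 2
  exact Finset.sum_congr rfl fun j _ => mul_comm _ _

open MeasureTheory Set in
/-- The Laplace representation of the leading part of the regularized kernel. -/
lemma integral_kernelArg_rpow_eq (hx₀ : x₀ ∈ posDomain hnm) (hb : ∀ j, 0 < b j)
    (hx : x ∈ posDomain hnm) {ε : ℝ} (hε : 0 < ε) {s : ℝ} (hs : 0 < s) :
    Real.Gamma s * ∫ t, (kernelArg hnm x₀ x t + ε) ^ (-s) ∂betaPi b =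
      ∫ u in Ioi (0 : ℝ), u ^ (s - 1) * Real.exp (-(ε * u)) * (Real.exp (-(u * rSq x x₀)) *
        ∏ j, ∫ t, Real.exp (-(u * (4 * x₀ (Fin.castLE hnm j) * x (Fin.castLE hnm j)) * t))
          ∂ProbabilityTheory.betaMeasure (b j) (b j)) := by
  have := isProbabilityMeasure_betaPi hb
  have h1 : ∫ t, Real.Gamma s * (kernelArg hnm x₀ x t + ε) ^ (-s) ∂betaPi b =
      ∫ t, (∫ u in Ioi (0 : ℝ), u ^ (s - 1) * Real.exp (-(ε * u)) *
        Real.exp (-(u * kernelArg hnm x₀ x t))) ∂betaPi b := by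
    refine integral_congr_ae ?_
    filter_upwards [ae_betaPi_Icc hb] with t ht
    have h2 := (rSq_nonneg x x₀).trans (rSq_le_kernelArg hx₀ hx fun j => ht.1 j)
    have h3 : 0 < kernelArg hnm x₀ x t + ε := by linarith
    have h4 := Real.integral_rpow_mul_exp_neg_mul_Ioi hs h3
    rw [one_div, Real.inv_rpow h3.le, ← Real.rpow_neg h3.le, mul_comm] at h4
    rw [← h4]
    refine setIntegral_congr_fun measurableSet_Ioi fun u _ => ?_
    simp only [mul_assoc, ← Real.exp_add]
    congr 2
    ring
  rw [← integral_const_mul, h1, integral_integral_swap]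
  · refine setIntegral_congr_fun measurableSet_Ioi fun u _ => ?_
    simp only
    rw [← integral_exp_betaPi _ hb, ← integral_const_mul, ← integral_const_mul]
    refine integral_congr_ae (Filter.Eventually.of_forall fun t => ?_)
    simp only
    rw [← Real.exp_add, kernelArg]
    congr 2
    rw [mul_add, neg_add, Finset.mul_sum]
    congr 2
    exact Finset.sum_congr rfl fun j _ => by ring
  -- The positivity of ε makes the majorant u^(s-1) e^(-εu) integrable at infinity.
  · refine Integrable.mono' ((integrable_const (1 : ℝ)).mul_prod (integrableOn_rpow_mul_exp hs hε))
      (Measurable.aestronglyMeasurable ?_) ?_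
    · refine ((measurable_snd.pow_const _).mul (Real.measurable_exp.comp
        (measurable_snd.const_mul _).neg)).mul (Real.measurable_exp.comp
          (measurable_snd.mul (Continuous.measurable ?_)).neg)
      unfold kernelArg
      fun_prop
    · have h5 : ∀ᵐ z ∂(betaPi b).prod (volume.restrict (Ioi (0 : ℝ))),
          z.1 ∈ Icc (0 : Fin n → ℝ) 1 ∧ z.2 ∈ Ioi (0 : ℝ) :=
        (Measure.quasiMeasurePreserving_fst.ae (ae_betaPi_Icc hb)).and
          (Measure.quasiMeasurePreserving_snd.ae (ae_restrict_mem measurableSet_Ioi))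
      filter_upwards [h5] with z hz
      have h2 := (rSq_nonneg x x₀).trans (rSq_le_kernelArg hx₀ hx fun j => hz.1.1 j)
      have hu : 0 < z.2 := hz.2
      rw [Function.uncurry_def, Real.norm_of_nonneg (by positivity), one_mul]
      refine mul_le_of_le_one_right (by positivity) (Real.exp_le_one_iff.2 ?_)
      exact neg_nonpos.2 (mul_nonneg hu.le h2)

/-- The power a + 1 = m/2 + ∑ b_j is split so that m/2 normalizes the Gaussian and each b_j
normalizes one beta Laplace transform. -/
lemma rpow_mul_prod_integral_exp {a : ℝ} (ha : a + 1 = m / 2 + ∑ j, b j)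
    (hx₀ : x₀ ∈ posDomain hnm) (hx : x ∈ posDomain hnm) {u : ℝ} (hu : 0 < u) :
    u ^ (a + 1) * ∏ j, ∫ t, Real.exp (-(u * (4 * x₀ (Fin.castLE hnm j) *
        x (Fin.castLE hnm j)) * t)) ∂ProbabilityTheory.betaMeasure (b j) (b j) =
      u ^ ((m : ℝ) / 2) * (∏ j, (4 * x₀ (Fin.castLE hnm j) * x (Fin.castLE hnm j)) ^ (-b j)) *
        ∏ j, betaLaplace (b j) (u * (4 * x₀ (Fin.castLE hnm j) * x (Fin.castLE hnm j))) := by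
  rw [ha, Real.rpow_add hu, Real.rpow_sum_of_pos hu, mul_assoc, mul_assoc,
    ← Finset.prod_mul_distrib, ← Finset.prod_mul_distrib]
  congr 1
  refine Finset.prod_congr rfl fun j _ => ?_
  have h1 := hx j
  have h2 := hx₀ j
  have hy : 0 < 4 * x₀ (Fin.castLE hnm j) * x (Fin.castLE hnm j) := by positivity
  rw [betaLaplace, Real.mul_rpow hu.le hy.le, Real.rpow_neg hy.le]
  field_simp

open MeasureTheory Set in
-- By Fubini in x and u, the integral against `h` is a Laplace transform evaluated at ε, the form
-- that `tendsto_mul_laplace` needs.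
lemma integral_mul_integral_kernelArg_rpow {a : ℝ} (ha : a + 1 = m / 2 + ∑ j, b j)
    (ha0 : 0 < a) (hx₀ : x₀ ∈ posDomain hnm) (hb : ∀ j, 0 < b j)
    {h : EuclideanSpace ℝ (Fin m) → ℂ} (hh : Continuous h)
    (hc : HasCompactSupport h) (hpos : tsupport h ⊆ posDomain hnm) {ε : ℝ} (hε : 0 < ε) :
    ∫ x, h x * ((Real.Gamma (a + 2) *
        ∫ t, (kernelArg hnm x₀ x t + ε) ^ (-(a + 2)) ∂betaPi b : ℝ) : ℂ) =
      ∫ u in Ioi (0 : ℝ), (Real.exp (-(ε * u)) : ℂ) * laplaceProfile hnm b x₀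
        (fun x => h x * ((∏ j, (4 * x₀ (Fin.castLE hnm j) *
          x (Fin.castLE hnm j)) ^ (-b j) : ℝ) : ℂ)) u := by
  have hprob := fun j => ProbabilityTheory.isProbabilityMeasureBeta (hb j) (hb j)
  set F : EuclideanSpace ℝ (Fin m) → ℝ → ℂ := fun x u => h x *
    ((u ^ (a + 1) * Real.exp (-(ε * u)) * (Real.exp (-(u * rSq x x₀)) *
        ∏ j, ∫ t, Real.exp (-(u * (4 * x₀ (Fin.castLE hnm j) * x (Fin.castLE hnm j)) * t))
          ∂ProbabilityTheory.betaMeasure (b j) (b j)) : ℝ) : ℂ) with hF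
  have hsupp : ∀ x, h x ≠ 0 → x ∈ posDomain hnm := fun x hx => hpos (subset_tsupport _ hx)
  have h1 : ∫ x, h x * ((Real.Gamma (a + 2) *
        ∫ t, (kernelArg hnm x₀ x t + ε) ^ (-(a + 2)) ∂betaPi b : ℝ) : ℂ) =
      ∫ x, ∫ u in Ioi (0 : ℝ), F x u := by
    refine integral_congr_ae (Filter.Eventually.of_forall fun x => ?_)
    simp only [hF]
    by_cases hx : h x = 0
    · simp [hx]
    · rw [integral_kernelArg_rpow_eq hx₀ hb (hsupp x hx) hε (by linarith : 0 < a + 2),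
        show a + 2 - 1 = a + 1 by ring, integral_const_mul, integral_complex_ofReal]
  rw [h1, integral_integral_swap]
  · refine setIntegral_congr_fun measurableSet_Ioi fun u hu => ?_
    simp only [laplaceProfile]
    rw [← integral_const_mul]
    refine integral_congr_ae (Filter.Eventually.of_forall fun x => ?_)
    simp only [hF]
    by_cases hx : h x = 0
    · simp [hx]
    · have h2 := congrArg (fun r : ℝ => h x * (Real.exp (-(ε * u)) : ℂ) *
        (Real.exp (-(u * rSq x x₀)) : ℂ) * (r : ℂ))
        (rpow_mul_prod_integral_exp ha hx₀ (hsupp x hx) hu)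
      simp only [Complex.ofReal_mul] at h2 ⊢
      linear_combination h2
  · refine Integrable.mono' ((hh.integrable_of_hasCompactSupport hc).norm.mul_prod
      (integrableOn_rpow_mul_exp (by linarith : 0 < a + 2) hε))
      (Measurable.aestronglyMeasurable ?_) ?_
    · refine (hh.measurable.comp measurable_fst).mul (Complex.measurable_ofReal.comp ?_)
      refine ((measurable_snd.pow_const _).mul (Real.measurable_exp.comp
        (measurable_snd.const_mul _).neg)).mul ((Real.measurable_exp.comp
          (measurable_snd.mul ((continuous_rSq x₀).measurable.comp measurable_fst)).neg).mul
          (Finset.measurable_prod _ fun j _ => ?_))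
      refine StronglyMeasurable.measurable (StronglyMeasurable.integral_prod_right
        (Continuous.stronglyMeasurable ?_))
      fun_prop
    · have h5 : ∀ᵐ z ∂(volume : Measure (EuclideanSpace ℝ (Fin m))).prod
          (volume.restrict (Ioi (0 : ℝ))), z.2 ∈ Ioi (0 : ℝ) :=
        Measure.quasiMeasurePreserving_snd.ae (ae_restrict_mem measurableSet_Ioi)
      filter_upwards [h5] with z hz
      have hu : 0 < z.2 := hz
      rw [Function.uncurry_def]
      simp only [hF, norm_mul, Complex.norm_real]
      by_cases hx : h z.1 = 0
      · simp [hx]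
      · have hx' := hsupp _ hx
        rw [show a + 2 - 1 = a + 1 by ring, Real.norm_of_nonneg (by positivity : 0 ≤ z.2 ^ (a + 1)),
          Real.norm_of_nonneg (Real.exp_nonneg _), Real.norm_of_nonneg (Real.exp_nonneg _),
          norm_prod]
        refine mul_le_mul_of_nonneg_left (mul_le_of_le_one_right (by positivity) ?_)
          (norm_nonneg _)
        refine mul_le_one₀ (Real.exp_le_one_iff.2 ?_) (Finset.prod_nonneg fun _ _ => norm_nonneg _)
          (Finset.prod_le_one (fun _ _ => norm_nonneg _) fun j _ => ?_)
        · exact neg_nonpos.2 (mul_nonneg hu.le (rSq_nonneg _ _))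
        · have := norm_integral_le_of_norm_le_const
            (μ := ProbabilityTheory.betaMeasure (b j) (b j)) (C := 1)
            (f := fun t => Real.exp (-(z.2 * (4 * x₀ (Fin.castLE hnm j) *
              z.1 (Fin.castLE hnm j)) * t))) (by
            filter_upwards [ae_betaMeasure (b j)] with t ht
            rw [Real.norm_of_nonneg (Real.exp_nonneg _), Real.exp_le_one_iff]
            have h6 := hx' j
            have h7 := hx₀ j
            have h8 := ht.1
            exact neg_nonpos.2 (by positivity))
          simpa using this

open MeasureTheory Filter Topology in
-- The factors (4 x_{0j} x_j)^(-b_j) are absorbed into the test function, whose value at `x₀` then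
-- appears in the limit.
lemma tendsto_integral_kernelArg_rpow {a : ℝ} (ha : a + 1 = m / 2 + ∑ j, b j)
    (ha0 : 0 < a) (hx₀ : x₀ ∈ posDomain hnm) (hb : ∀ j, 0 < b j ∧ b j < 1)
    {h : EuclideanSpace ℝ (Fin m) → ℂ} (hh : Continuous h)
    (hc : HasCompactSupport h) (hpos : tsupport h ⊆ posDomain hnm) :
    Tendsto (fun ε : ℝ => (ε : ℂ) * ∫ x, h x * ((Real.Gamma (a + 2) *
        ∫ t, (kernelArg hnm x₀ x t + ε) ^ (-(a + 2)) ∂betaPi b : ℝ) : ℂ)) (𝓝[>] 0)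
      (𝓝 (h x₀ * ((∏ j, (4 * x₀ (Fin.castLE hnm j) * x₀ (Fin.castLE hnm j)) ^ (-b j) : ℝ) : ℂ) *
        ((Real.pi ^ ((m : ℝ) / 2) *
          ∏ j, (Real.Gamma (2 * b j) / Real.Gamma (b j)) : ℝ) : ℂ))) := by
  set P : EuclideanSpace ℝ (Fin m) → ℂ := fun x =>
    ((∏ j, (4 * x₀ (Fin.castLE hnm j) * x (Fin.castLE hnm j)) ^ (-b j) : ℝ) : ℂ) with hP
  have hPc : ContinuousOn P (posDomain hnm) := by
    refine Complex.continuous_ofReal.comp_continuousOn (continuousOn_finsetProd _ fun j _ => ?_)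
    refine ContinuousOn.rpow_const (by fun_prop) fun x hx => Or.inl ?_
    have h1 := hx j
    have h2 := hx₀ j
    positivity
  have hts : tsupport (fun x => h x * P x) ⊆ tsupport h := tsupport_mul_subset_left
  have hh' : Continuous fun x => h x * P x :=
    (hh.continuousOn.mul hPc).continuous_of_tsupport_subset (isOpen_posDomain hnm)
      (hts.trans hpos)
  have hc' : HasCompactSupport fun x => h x * P x := hc.mul_right
  obtain ⟨C, hC⟩ := exists_norm_laplaceProfile_le hx₀ hb hh' hc' (hts.trans hpos)
  refine (tendsto_mul_laplace (stronglyMeasurable_laplaceProfile (fun j => (hb j).1) hh') hC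
    (tendsto_laplaceProfile hx₀ hb hh' hc' (hts.trans hpos))).congr' ?_
  filter_upwards [self_mem_nhdsWithin] with ε hε
  rw [integral_mul_integral_kernelArg_rpow ha ha0 hx₀ (fun j => (hb j).1) hh hc hpos hε]

variable {κ : ℂ}

open MeasureTheory in
-- Removing the leading part leaves O(X^(-(a+1))) with X the regularized argument, just at the
-- critical exponent m/2 + ∑ b_j. Since ε ≤ √ε √X, half a power is gained at the cost of √ε, which
-- makes the bound integrable and still vanishing with ε.
lemma exists_norm_betaPotential_sub_le {a : ℝ} (ha : a + 1 = m / 2 + ∑ j, b j)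
    (ha0 : 0 < a) (hκ : Admissible a κ) (hx₀ : x₀ ∈ posDomain hnm) (hb : ∀ j, 0 < b j)
    {K : Set (EuclideanSpace ℝ (Fin m))} (hK : IsCompact K) (hKpos : K ⊆ posDomain hnm) :
    ∃ C σ : ℝ, 0 ≤ C ∧ σ < 1 ∧ ∀ x ∈ K, x ≠ x₀ → ∀ ε : ℝ, 0 < ε → ε ≤ 1 →
      ε * ‖betaPotential hnm b (a + 2) κ (fun _ => 1) x₀ ε x -
        ((Real.Gamma (a + 2) * ∫ t, (kernelArg hnm x₀ x t + ε) ^ (-(a + 2)) ∂betaPi b : ℝ) : ℂ)‖ ≤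
        C * √ε * rSq x x₀ ^ (-(σ * (m / 2))) := by
  set σ := (a + 1 / 2) / ((m : ℝ) / 2 + ∑ j, b j) with hσ
  have hD : 0 < (m : ℝ) / 2 + ∑ j, b j := by linarith
  have hσ0 : 0 ≤ σ := by positivity
  have hσ1 : σ < 1 := by rw [hσ, div_lt_one hD]; linarith
  have hσa : σ * (m / 2 + ∑ j, b j) = a + 1 / 2 := by rw [hσ, div_mul_cancel₀ _ hD.ne']
  obtain ⟨C₁, hC₁, h1⟩ := exists_integral_kernelArg_rpow_le hx₀ hb hK hKpos hσ0 hσ1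
  obtain ⟨M, hM⟩ := exists_kernelArg_le hx₀ hK hKpos
  obtain ⟨C₂, hC₂, h2⟩ := exists_norm_besselPsi_sub_le (a + 2) κ M
  refine ⟨C₂ * C₁, σ, by positivity, hσ1, fun x hx hne ε hε0 hε1 => ?_⟩
  have h3 := h1 x hx hne ε hε0.le
  rw [hσa] at h3
  have hpos : 0 < rSq x x₀ + ε := by linarith [rSq_pos hne]
  have hi := fun s => integrable_kernelArg_rpow hx₀ hb (hKpos hx) hpos s
  have hint : Integrable (fun t => (1 : ℂ) * besselPsi (a + 2) κ
      (tubeForm t (kernelPoint hnm x₀ ε x))) (betaPi b) :=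
    integrable_betaTransform hb (by simpa [add_assoc, one_add_one_eq_two] using
      hκ.add_one.add_one) continuous_const
      (kernelPoint_mem_tubeDomain hx₀ (mem_kernelDomain_of_pos (hKpos hx) hε0))
  have hint' : Integrable (fun t => (((kernelArg hnm x₀ x t + ε) ^ (-(a + 2)) *
      Real.Gamma (a + 2) : ℝ) : ℂ)) (betaPi b) := ((hi _).mul_const _).ofReal
  have hdiff : betaPotential hnm b (a + 2) κ (fun _ => 1) x₀ ε x -
      ((Real.Gamma (a + 2) * ∫ t, (kernelArg hnm x₀ x t + ε) ^ (-(a + 2)) ∂betaPi b : ℝ) : ℂ) =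
      ∫ t, ((1 : ℂ) * besselPsi (a + 2) κ (tubeForm t (kernelPoint hnm x₀ ε x)) -
        (((kernelArg hnm x₀ x t + ε) ^ (-(a + 2)) * Real.Gamma (a + 2) : ℝ) : ℂ)) ∂betaPi b := by
    rw [integral_sub hint hint', integral_complex_ofReal, integral_mul_const,
      mul_comm (Real.Gamma _)]
    rfl
  rw [hdiff, ← Real.norm_of_nonneg hε0.le, ← Complex.norm_real, ← norm_mul, Complex.norm_real,
    Real.norm_of_nonneg hε0.le, ← integral_const_mul]
  calc ‖∫ t, (ε : ℂ) * ((1 : ℂ) * besselPsi (a + 2) κ (tubeForm t (kernelPoint hnm x₀ ε x)) -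
        (((kernelArg hnm x₀ x t + ε) ^ (-(a + 2)) * Real.Gamma (a + 2) : ℝ) : ℂ)) ∂betaPi b‖
      ≤ ∫ t, C₂ * √ε * (kernelArg hnm x₀ x t + ε) ^ (-(a + 1 / 2)) ∂betaPi b := by
        refine norm_integral_le_of_norm_le ((hi _).const_mul _) ?_
        filter_upwards [ae_betaPi_Icc hb] with t ht
        have h4 := rSq_le_kernelArg hx₀ (hKpos hx) fun j => ht.1 j
        have hX : 0 < kernelArg hnm x₀ x t + ε := by linarith
        have h5 := h2 _ hX (hM x hx t (fun j => ht.2 j) ε hε1)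
        have h6 : √ε ≤ (kernelArg hnm x₀ x t + ε) ^ (1 / 2 : ℝ) := by
          rw [← Real.sqrt_eq_rpow]
          exact Real.sqrt_le_sqrt (by linarith [rSq_nonneg x x₀])
        have h7 : (kernelArg hnm x₀ x t + ε) ^ (-(a + 1 / 2)) =
            (kernelArg hnm x₀ x t + ε) ^ (1 / 2 : ℝ) *
              (kernelArg hnm x₀ x t + ε) ^ (1 - (a + 2)) := by
          rw [← Real.rpow_add hX]
          congr 1
          ring
        rw [one_mul, tubeForm_kernelPoint_eq, norm_mul, Complex.norm_real,
          Real.norm_of_nonneg hε0.le]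
        calc ε * _ ≤ √ε * √ε * (C₂ * (kernelArg hnm x₀ x t + ε) ^ (1 - (a + 2))) := by
              rw [Real.mul_self_sqrt hε0.le]
              exact mul_le_mul_of_nonneg_left h5 hε0.le
          _ ≤ √ε * (kernelArg hnm x₀ x t + ε) ^ (1 / 2 : ℝ) *
              (C₂ * (kernelArg hnm x₀ x t + ε) ^ (1 - (a + 2))) := by gcongr
          _ = _ := by rw [h7]; ring
    _ ≤ C₂ * √ε * (C₁ * rSq x x₀ ^ (-(σ * (m / 2)))) := by
        rw [integral_const_mul]
        exact mul_le_mul_of_nonneg_left h3 (by positivity)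
    _ = _ := by ring

open MeasureTheory Filter Topology in
lemma tendsto_mul_integral_betaPotential {a : ℝ} (hm : 0 < m) (ha : a + 1 = m / 2 + ∑ j, b j)
    (hκ : Admissible a κ) (hx₀ : x₀ ∈ posDomain hnm) (hb : ∀ j, 0 < b j ∧ b j < 1)
    {h : EuclideanSpace ℝ (Fin m) → ℂ} (hh : Continuous h)
    (hc : HasCompactSupport h) (hpos : tsupport h ⊆ posDomain hnm) :
    Tendsto (fun ε : ℝ => (ε : ℂ) *
        ∫ x, h x * betaPotential hnm b (a + 2) κ (fun _ => 1) x₀ ε x) (𝓝[>] 0)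
      (𝓝 (h x₀ * ((∏ j, (4 * x₀ (Fin.castLE hnm j) * x₀ (Fin.castLE hnm j)) ^ (-b j) : ℝ) : ℂ) *
        ((Real.pi ^ ((m : ℝ) / 2) *
          ∏ j, (Real.Gamma (2 * b j) / Real.Gamma (b j)) : ℝ) : ℂ))) := by
  have : Nonempty (Fin m) := ⟨⟨0, hm⟩⟩
  have hb0 := fun j => (hb j).1
  set K := tsupport h with hKdef
  have hK : IsCompact K := hc
  obtain ⟨C, σ, hC, hσ, hle⟩ := exists_norm_betaPotential_sub_le ha hκ.1 hκ hx₀ hb0 hK hpos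
  obtain ⟨B, hB⟩ := hc.exists_bound_of_continuous hh
  have hB0 : 0 ≤ B := (norm_nonneg _).trans (hB x₀)
  have hI := integrableOn_rSq_rpow hm hσ hK x₀
  set V : ℝ → EuclideanSpace ℝ (Fin m) → ℂ := betaPotential hnm b (a + 2) κ (fun _ => 1) x₀
    with hV
  set A : ℝ → EuclideanSpace ℝ (Fin m) → ℂ := fun ε x => ((Real.Gamma (a + 2) *
    ∫ t, (kernelArg hnm x₀ x t + ε) ^ (-(a + 2)) ∂betaPi b : ℝ) : ℂ) with hA
  have hVc : ∀ ε, 0 < ε → ∀ κ, Admissible (a + 2) κ → ContinuousOn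
      (betaPotential hnm b (a + 2) κ (fun _ => 1) x₀ ε) (posDomain hnm) := fun ε hε κ hκ =>
    (contDiffOn_betaPotential hx₀ hb0 hκ continuous_const ε 0).continuousOn.mono
      fun x hx => mem_kernelDomain_of_pos hx hε
  have hint : ∀ ε, 0 < ε → ∀ κ, Admissible (a + 2) κ →
      Integrable fun x => h x * betaPotential hnm b (a + 2) κ (fun _ => 1) x₀ ε x := by
    intro ε hε κ hκ
    refine Continuous.integrable_of_hasCompactSupport ?_ hc.mul_right
    exact (hh.continuousOn.mul (hVc ε hε κ hκ)).continuous_of_tsupport_subset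
      (isOpen_posDomain hnm) (tsupport_mul_subset_left.trans hpos)
  have hadm : ∀ κ, Admissible a κ → Admissible (a + 2) κ := fun κ hκ => by
    simpa [add_assoc, one_add_one_eq_two] using hκ.add_one.add_one
  -- The leading part is itself the potential with κ = 0, so its integrability against `h` follows
  -- from that of potentials.
  have hAV : ∀ ε, 0 < ε → ∀ x ∈ posDomain hnm,
      betaPotential hnm b (a + 2) 0 (fun _ => 1) x₀ ε x = A ε x := by
    intro ε hε x hx
    simp only [hA]
    rw [← integral_const_mul, ← integral_complex_ofReal]
    refine integral_congr_ae ?_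
    filter_upwards [ae_betaPi_Icc hb0] with t ht
    have h4 := (rSq_nonneg x x₀).trans (rSq_le_kernelArg hx₀ hx fun j => ht.1 j)
    have hX : 0 ≤ kernelArg hnm x₀ x t + ε := by linarith
    rw [one_mul, tubeForm_kernelPoint_eq, besselPsi, besselPhi_zero_left, ← Complex.ofReal_neg,
      ← Complex.ofReal_cpow hX, ← Complex.ofReal_mul, mul_comm]
  have hrem : Tendsto (fun ε : ℝ => (ε : ℂ) * ∫ x, h x * (V ε x - A ε x)) (𝓝[>] 0) (𝓝 0) := by
    have hs : Tendsto (fun ε : ℝ => √ε * (B * C * ∫ x in K, rSq x x₀ ^ (-(σ * (m / 2)))))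
        (𝓝[>] 0) (𝓝 0) := by
      have h1 : Tendsto (fun ε : ℝ => √ε) (𝓝[>] 0) (𝓝 0) := by
        simpa using (Real.continuous_sqrt.tendsto 0).mono_left nhdsWithin_le_nhds
      simpa using h1.mul_const (B * C * ∫ x in K, rSq x x₀ ^ (-(σ * (m / 2))))
    refine squeeze_zero_norm' ?_ hs
    filter_upwards [Ioc_mem_nhdsGT one_pos] with ε hε
    rw [← integral_const_mul, ← setIntegral_eq_integral_of_forall_compl_eq_zero (s := K)
      (fun x hx => by rw [image_eq_zero_of_notMem_tsupport hx]; ring), ← integral_const_mul,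
      ← integral_const_mul]
    refine norm_integral_le_of_norm_le ((hI.const_mul _).const_mul _) ?_
    filter_upwards [ae_restrict_mem hK.measurableSet,
      ae_restrict_of_ae (Measure.ae_ne volume x₀)] with x hx hne
    have h2 := hle x hx hne ε hε.1 hε.2
    rw [norm_mul, norm_mul, Complex.norm_real, Real.norm_of_nonneg hε.1.le]
    calc ε * (‖h x‖ * ‖V ε x - A ε x‖) = ‖h x‖ * (ε * ‖V ε x - A ε x‖) := by ring
      _ ≤ B * (C * √ε * rSq x x₀ ^ (-(σ * (m / 2)))) :=
        mul_le_mul (hB x) h2 (mul_nonneg hε.1.le (norm_nonneg _)) hB0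
      _ = _ := by ring
  have hmain := tendsto_integral_kernelArg_rpow ha hκ.1 hx₀ hb hh hc hpos
  have := hrem.add hmain
  rw [zero_add] at this
  refine this.congr' ?_
  filter_upwards [self_mem_nhdsWithin] with ε hε
  have hAi : Integrable fun x => h x * A ε x := by
    refine (hint ε hε 0 (hadm 0 ⟨hκ.1, Or.inl rfl⟩)).congr
      (Filter.Eventually.of_forall fun x => ?_)
    by_cases hx : h x = 0
    · simp [hx]
    · simp only [hAV ε hε x (hpos (subset_tsupport _ hx))]
  rw [← mul_add, ← integral_add _ hAi]
  · simp only [mul_sub, sub_add_cancel]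
  · simp only [mul_sub]
    exact (hint ε hε κ (hadm κ hκ)).sub hAi

end

/-! ### Parameters of q_k and passage to the regularized form -/

section
variable {n : ℕ} {α : Fin n → ℝ} {k : ℕ}

/-- The exponents of the power factors of `q_k`. -/
def powerParam (α : Fin n → ℝ) (k : ℕ) (i : Fin n) : ℝ := if (i : ℕ) < k then 1 - 2 * α i else 0

lemma bParam_eq_add (α : Fin n → ℝ) (k : ℕ) : bParam α k = fun i => α i + powerParam α k i := by
  funext i
  unfold bParam powerParam
  split_ifs <;> ring

lemma cParam_eq_two_mul (α : Fin n → ℝ) (k : ℕ) : cParam α k = fun i => 2 * bParam α k i := by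
  funext i
  unfold bParam cParam
  split_ifs <;> ring

lemma bParam_mem_Ioo (hα : ∀ j, 0 < 2 * α j ∧ 2 * α j < 1) (k : ℕ) (j : Fin n) :
    0 < bParam α k j ∧ bParam α k j < 1 := by
  have := hα j
  unfold bParam
  split_ifs <;> constructor <;> linarith

lemma filter_le_eq_filter_not_lt (n k : ℕ) :
    (Finset.univ.filter fun i : Fin n => k ≤ i.val) = Finset.univ.filter fun i => ¬ i.val < k :=
  Finset.filter_congr fun _ _ => not_lt.symm

/-- This is the relation between order and dimension required by `betaPotential_pde`; `k ≤ n`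
ensures that exactly `k` indices carry 1 - α_i. -/
lemma alphaTilde_eq (m : ℕ) (α : Fin n → ℝ) (hk : k ≤ n) :
    alphaTilde m α k = (m : ℝ) / 2 - 1 + ∑ j, bParam α k j := by
  have h1 : ((Finset.univ.filter fun i : Fin n => i.val < k).card : ℝ) = k := by
    rw [Fin.card_filter_val_lt, min_eq_right hk]
  unfold alphaTilde bParam
  rw [Finset.sum_ite, Finset.sum_sub_distrib, Finset.sum_const, nsmul_eq_mul, h1,
    filter_le_eq_filter_not_lt]
  ring

lemma gammaConst_eq (m : ℕ) (α : Fin n → ℝ) (k : ℕ) :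
    gammaConst m α k = (2 : ℝ) ^ (2 * alphaTilde m α k - m) *
      (Real.Gamma (alphaTilde m α k) / Real.pi ^ ((m : ℝ) / 2)) *
      ∏ j, (Real.Gamma (bParam α k j) / Real.Gamma (2 * bParam α k j)) := by
  rw [gammaConst, filter_le_eq_filter_not_lt, mul_assoc]
  congr 1
  rw [← Finset.prod_filter_mul_prod_filter_not Finset.univ fun i : Fin n => i.val < k]
  congr 1 <;> refine Finset.prod_congr rfl fun i hi => ?_
  · rw [bParam, if_pos (Finset.mem_filter.1 hi).2]
    ring_nf
  · rw [bParam, if_neg (Finset.mem_filter.1 hi).2]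

end

section
variable {m n : ℕ} {hnm : n ≤ m} {x₀ x : EuclideanSpace ℝ (Fin m)} {α : Fin n → ℝ} {k : ℕ}

lemma prod_rpow_eq_coordPower (hx₀ : x₀ ∈ posDomain hnm) (hx : x ∈ posDomain hnm) :
    ∏ i : Fin n with i.val < k, (x (Fin.castLE hnm i) * x₀ (Fin.castLE hnm i)) ^ (1 - 2 * α i) =
      coordPower hnm (powerParam α k) x * coordPower hnm (powerParam α k) x₀ := by
  rw [coordPower, coordPower, ← Finset.prod_mul_distrib, Finset.prod_filter]
  refine Finset.prod_congr rfl fun i _ => ?_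
  unfold powerParam
  split_ifs
  · rw [Real.mul_rpow (hx i).le (hx₀ i).le]
  · simp

lemma rSq_sub_rjSq (x x₀ : EuclideanSpace ℝ (Fin m)) (j : Fin m) :
    rSq x x₀ - rjSq j x x₀ = -(4 * x₀ j * x j) := by
  rw [rSq, rjSq, ← Finset.add_sum_erase _ _ (Finset.mem_univ j)]
  ring

lemma xiArg_mem_contDomain (hx₀ : x₀ ∈ posDomain hnm) (hx : x ∈ posDomain hnm) :
    xiArg hnm x x₀ ∈ contDomain n := by
  have h : ∀ j : Fin n, max (xiArg hnm x x₀ j).re 0 = 0 := by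
    intro j
    have h1 := hx j
    have h2 := hx₀ j
    refine max_eq_right ?_
    rw [xiArg, Complex.ofReal_re, rSq_sub_rjSq]
    exact div_nonpos_of_nonpos_of_nonneg (neg_nonpos.2 (by positivity)) (rSq_nonneg _ _)
  simp [contDomain, h]

lemma alphaTilde_pos (hm : 2 ≤ m) (hn : 1 ≤ n) (hk : k ≤ n)
    (hα : ∀ j, 0 < 2 * α j ∧ 2 * α j < 1) : 0 < alphaTilde m α k := by
  have : Nonempty (Fin n) := ⟨⟨0, hn⟩⟩
  have h1 : (2 : ℝ) ≤ m := by exact_mod_cast hm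
  have h2 : 0 < ∑ j, bParam α k j :=
    Finset.sum_pos (fun j _ => (bParam_mem_Ioo hα k j).1) Finset.univ_nonempty
  rw [alphaTilde_eq m α hk]
  linarith

lemma admissible_alphaTilde (hm : 2 ≤ m) (hn : 1 ≤ n) (hk : k ≤ n)
    (hα : ∀ j, 0 < 2 * α j ∧ 2 * α j < 1) {lam : ℂ}
    (hΓ : lam = 0 ∨ ∀ N : ℕ, alphaTilde m α k ≠ N) (c : ℂ) :
    Admissible (alphaTilde m α k) (-(1 / 4) * lam ^ 2 * c) :=
  ⟨alphaTilde_pos hm hn hk hα, hΓ.imp_left fun h => by simp [h]⟩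

/-- The regularization of `q_k` by a parameter `ε`, up to a constant factor. -/
def regularizedQ (hnm : n ≤ m) (α : Fin n → ℝ) (lam : ℂ) (k : ℕ)
    (x₀ : EuclideanSpace ℝ (Fin m)) (ε : ℝ) (x : EuclideanSpace ℝ (Fin m)) : ℂ :=
  (coordPower hnm (powerParam α k) x : ℂ) *
    betaPotential hnm (bParam α k) (alphaTilde m α k) (-(1 / 4) * lam ^ 2) (fun _ => 1) x₀ ε x

/-- By the Euler integral and -r² ξ_j = 4 x_j x_{0j}, pulling r^(-2α̃_k) into the integral turns 1 -
∑ t_j ξ_j into r² + ∑ 4 t_j x_j x_{0j}. -/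
lemma q_eq_regularizedQ (hα : ∀ j, 0 < 2 * α j ∧ 2 * α j < 1) {lam : ℂ}
    (ha : ∀ c, Admissible (alphaTilde m α k) (-(1 / 4) * lam ^ 2 * c))
    (hx₀ : x₀ ∈ posDomain hnm) (hx : x ∈ posDomain hnm) (hne : x ≠ x₀) :
    q hnm α lam k x x₀ =
      ((gammaConst m α k * coordPower hnm (powerParam α k) x₀ *
        (Real.Gamma (alphaTilde m α k))⁻¹ : ℝ) : ℂ) * regularizedQ hnm α lam k x₀ 0 x := by
  have hb := fun j => (bParam_mem_Ioo hα k j).1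
  have hr := rSq_pos hne
  have h1 : betaPotential hnm (bParam α k) (alphaTilde m α k) (-(1 / 4) * lam ^ 2)
      (fun _ => 1) x₀ 0 x = ((rSq x x₀ ^ (-alphaTilde m α k) : ℝ) : ℂ) *
        betaTransform (bParam α k) (alphaTilde m α k) (etaArg lam x x₀) (fun _ => 1)
          (1, -xiArg hnm x x₀) := by
    rw [betaPotential, betaTransform, betaTransform, ← MeasureTheory.integral_const_mul]
    refine MeasureTheory.integral_congr_ae ?_
    filter_upwards [ae_betaPi_Icc hb] with t ht
    have h2 : tubeForm t (kernelPoint hnm x₀ 0 x) =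
        (rSq x x₀ : ℂ) * tubeForm t ((1 : ℂ), -xiArg hnm x x₀) := by
      rw [tubeForm_kernelPoint_eq, add_zero, kernelArg, tubeForm_apply, mul_add, mul_one,
        Finset.mul_sum]
      push_cast
      congr 1
      refine Finset.sum_congr rfl fun j _ => ?_
      have hr' : (rSq x x₀ : ℂ) ≠ 0 := by exact_mod_cast hr.ne'
      rw [Pi.neg_apply, xiArg, rSq_sub_rjSq]
      push_cast
      field_simp
    have h3 : tubeForm t ((1 : ℂ), -xiArg hnm x x₀) ≠ 0 := Complex.slitPlane_ne_zero
      (tubeForm_mem_slitPlane ht (one_neg_mem_tubeDomain (xiArg_mem_contDomain hx₀ hx)))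
    rw [h2, one_mul, one_mul, besselPsi_ofReal_mul _ _ h3 hr]
    rfl
  rw [regularizedQ, h1, q, cParam_eq_two_mul, HA_eq_eulerHA hb (η := etaArg lam x x₀) (ha _)
    (xiArg_mem_contDomain hx₀ hx), eulerHA, prod_rpow_eq_coordPower hx₀ hx]
  push_cast
  ring

lemma helmholtzOp_congr {lam : ℂ} {u v : EuclideanSpace ℝ (Fin m) → ℂ}
    (h : u =ᶠ[nhds x] v) : helmholtzOp hnm α lam u x = helmholtzOp hnm α lam v x := by
  have h1 : ∀ {u v : EuclideanSpace ℝ (Fin m) → ℂ} (i : Fin m), u =ᶠ[nhds x] v →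
      partialDeriv i u =ᶠ[nhds x] partialDeriv i v := fun i h =>
    h.fderiv.fun_comp fun F : EuclideanSpace ℝ (Fin m) →L[ℝ] ℂ => F (EuclideanSpace.single i 1)
  simp only [helmholtzOp, fun i => (h1 i (h1 i h)).eq_of_nhds, fun i => (h1 i h).eq_of_nhds,
    h.eq_of_nhds]

lemma helmholtzOp_const_mul (lam c : ℂ) (u : EuclideanSpace ℝ (Fin m) → ℂ)
    (x : EuclideanSpace ℝ (Fin m)) :
    helmholtzOp hnm α lam (fun x => c * u x) x = c * helmholtzOp hnm α lam u x := by
  have h1 : ∀ (i : Fin m) (u : EuclideanSpace ℝ (Fin m) → ℂ),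
      partialDeriv i (fun x => c * u x) = fun x => c * partialDeriv i u x := by
    intro i u
    funext x
    simp only [partialDeriv]
    rw [show (fun x => c * u x) = c • u from rfl, fderiv_const_smul_field]
    rfl
  simp only [helmholtzOp, h1]
  rw [mul_sub, mul_add, Finset.mul_sum, Finset.mul_sum]
  congr 1
  · congr 1
    exact Finset.sum_congr rfl fun j _ => by ring
  · ring

lemma helmholtzOp_eq_zero_of_notMem_tsupport (lam : ℂ) {φ : EuclideanSpace ℝ (Fin m) → ℂ}
    (hx : x ∉ tsupport φ) : helmholtzOp hnm α lam φ x = 0 := by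
  rw [helmholtzOp_congr (notMem_tsupport_iff_eventuallyEq.1 hx)]
  rw [show (0 : EuclideanSpace ℝ (Fin m) → ℂ) = fun x => 0 * φ x by ext; simp,
    helmholtzOp_const_mul, zero_mul]

lemma contDiffOn_regularizedQ (hα : ∀ j, 0 < 2 * α j ∧ 2 * α j < 1) {lam : ℂ}
    (ha : Admissible (alphaTilde m α k) (-(1 / 4) * lam ^ 2))
    (hx₀ : x₀ ∈ posDomain hnm) (ε : ℝ) (N : ℕ) :
    ContDiffOn ℝ N (regularizedQ hnm α lam k x₀ ε) (kernelDomain hnm x₀ ε) := by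
  refine ContDiffOn.mul ?_ (contDiffOn_betaPotential hx₀ (fun j => (bParam_mem_Ioo hα k j).1) ha
    continuous_const ε N)
  exact Complex.ofRealCLM.contDiff.comp_contDiffOn
    ((contDiffOn_coordPower _).mono fun x hx => hx.1)

/-- At ε = 0 the right side vanishes, giving the classical equation; for ε > 0 it is the mollified
delta mass. -/
lemma helmholtzOp_regularizedQ (hα : ∀ j, 0 < 2 * α j ∧ 2 * α j < 1) (hk : k ≤ n) {lam : ℂ}
    (ha : Admissible (alphaTilde m α k) (-(1 / 4) * lam ^ 2))
    (hx₀ : x₀ ∈ posDomain hnm) {ε : ℝ} (hx : x ∈ kernelDomain hnm x₀ ε) :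
    helmholtzOp hnm α lam (regularizedQ hnm α lam k x₀ ε) x =
      -((4 * ε : ℝ) : ℂ) * ((coordPower hnm (powerParam α k) x : ℂ) *
        betaPotential hnm (bParam α k) (alphaTilde m α k + 2) (-(1 / 4) * lam ^ 2)
          (fun _ => 1) x₀ ε x) := by
  have hb := fun j => (bParam_mem_Ioo hα k j).1
  have h1 := betaPotential_pde hx₀ hb ha (alphaTilde_eq m α hk) hx
  have h2 := helmholtzOp_coordPower_mul (hnm := hnm) (α := α) (e := powerParam α k)
    (fun j => by unfold powerParam; split_ifs <;> simp) lam (isOpen_kernelDomain hnm x₀ ε)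
    (fun x hx => hx.1) (contDiffOn_betaPotential hx₀ hb ha (continuous_const (y := 1)) ε 2) hx
  unfold regularizedQ
  rw [h2, ← bParam_eq_add, helmholtzOp_eq_sum]
  linear_combination (coordPower hnm (powerParam α k) x : ℂ) * h1

/-- The normalization of `q_k`. -/
lemma gammaConst_mul_eq_one (hα : ∀ j, 0 < 2 * α j ∧ 2 * α j < 1) (hk : k ≤ n)
    (ha : 0 < alphaTilde m α k) (hx₀ : x₀ ∈ posDomain hnm) :
    gammaConst m α k * coordPower hnm (powerParam α k) x₀ * (Real.Gamma (alphaTilde m α k))⁻¹ *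
      4 * (coordPower hnm (powerParam α k) x₀ * weight hnm α x₀) *
      (∏ j, (4 * x₀ (Fin.castLE hnm j) * x₀ (Fin.castLE hnm j)) ^ (-bParam α k j)) *
      (Real.pi ^ ((m : ℝ) / 2) *
        ∏ j, (Real.Gamma (2 * bParam α k j) / Real.Gamma (bParam α k j))) = 1 := by
  have hΓ := (Real.Gamma_pos_of_pos ha).ne'
  have hπ : Real.pi ^ ((m : ℝ) / 2) ≠ 0 := by positivity
  have h1 : (∏ j, (Real.Gamma (bParam α k j) / Real.Gamma (2 * bParam α k j))) *
      ∏ j, (Real.Gamma (2 * bParam α k j) / Real.Gamma (bParam α k j)) = 1 := by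
    rw [← Finset.prod_mul_distrib]
    refine Finset.prod_eq_one fun j _ => ?_
    have hb := (bParam_mem_Ioo hα k j).1
    have h2 := (Real.Gamma_pos_of_pos hb).ne'
    have h3 := (Real.Gamma_pos_of_pos (show 0 < 2 * bParam α k j by linarith)).ne'
    field_simp
  -- With e the exponent in `powerParam`, each coordinate of `x₀` enters with exponent 2e + 2α - 2b
  -- = 0, so only the factors 4^(-b_j) survive.
  have h2 : coordPower hnm (powerParam α k) x₀ * (coordPower hnm (powerParam α k) x₀ *
      weight hnm α x₀) *
      (∏ j, (4 * x₀ (Fin.castLE hnm j) * x₀ (Fin.castLE hnm j)) ^ (-bParam α k j)) =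
      (2 : ℝ) ^ (-(2 * ∑ j, bParam α k j)) := by
    rw [← mul_neg, ← Finset.sum_neg_distrib, Finset.mul_sum, Real.rpow_sum_of_pos two_pos,
      coordPower, weight, ← Finset.prod_mul_distrib, ← Finset.prod_mul_distrib,
      ← Finset.prod_mul_distrib]
    refine Finset.prod_congr rfl fun j _ => ?_
    have hj := hx₀ j
    set y := x₀ (Fin.castLE hnm j)
    have h3 : 4 * y * y = (2 * y) ^ (2 : ℝ) := by
      rw [Real.rpow_two]
      ring
    rw [h3, ← Real.rpow_mul (by positivity), Real.mul_rpow two_pos.le hj.le, ← Real.rpow_add hj,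
      ← Real.rpow_add hj, mul_left_comm, ← Real.rpow_add hj, bParam_eq_add]
    ring_nf
    simp
  -- The exponents of 2 add up to 2α̃_k - m + 2 - 2∑ b_j = 0.
  have h3 : (2 : ℝ) ^ (2 * alphaTilde m α k - m) * 4 *
      (2 : ℝ) ^ (-(2 * ∑ j, bParam α k j)) = 1 := by
    rw [show (4 : ℝ) = 2 ^ (2 : ℝ) by norm_num, ← Real.rpow_add two_pos, ← Real.rpow_add two_pos,
      alphaTilde_eq m α hk]
    ring_nf
    simp
  rw [gammaConst_eq]
  calc _ = ((2 : ℝ) ^ (2 * alphaTilde m α k - m) * 4 *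
        (coordPower hnm (powerParam α k) x₀ * (coordPower hnm (powerParam α k) x₀ *
          weight hnm α x₀) *
          (∏ j, (4 * x₀ (Fin.castLE hnm j) * x₀ (Fin.castLE hnm j)) ^ (-bParam α k j)))) *
        ((∏ j, (Real.Gamma (bParam α k j) / Real.Gamma (2 * bParam α k j))) *
          ∏ j, (Real.Gamma (2 * bParam α k j) / Real.Gamma (bParam α k j))) *
        (Real.Gamma (alphaTilde m α k) * (Real.Gamma (alphaTilde m α k))⁻¹) *
        (Real.pi ^ ((m : ℝ) / 2) * (Real.pi ^ ((m : ℝ) / 2))⁻¹) := by ring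
    _ = 1 := by rw [h2, h3, h1, mul_inv_cancel₀ hΓ, mul_inv_cancel₀ hπ]; norm_num

lemma isSolutionOff_q (hα : ∀ j, 0 < 2 * α j ∧ 2 * α j < 1) (hk : k ≤ n) {lam : ℂ}
    (ha : ∀ c, Admissible (alphaTilde m α k) (-(1 / 4) * lam ^ 2 * c))
    (hx₀ : x₀ ∈ posDomain hnm) :
    IsSolutionOff hnm α lam x₀ fun x => q hnm α lam k x x₀ := by
  have ha' : Admissible (alphaTilde m α k) (-(1 / 4) * lam ^ 2) := by simpa using ha 1
  have hsub : posDomain hnm \ {x₀} ⊆ kernelDomain hnm x₀ 0 := fun x hx =>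
    mem_kernelDomain_zero hx.1 hx.2
  refine ⟨?_, fun x hx => ?_⟩
  · refine ContDiffOn.congr (contDiffOn_const.mul ((contDiffOn_regularizedQ hα ha' hx₀ 0 2).mono
      hsub)) fun x hx => q_eq_regularizedQ hα ha hx₀ hx.1 hx.2
  · have h1 : (fun x => q hnm α lam k x x₀) =ᶠ[nhds x] fun x =>
        ((gammaConst m α k * coordPower hnm (powerParam α k) x₀ *
          (Real.Gamma (alphaTilde m α k))⁻¹ : ℝ) : ℂ) * regularizedQ hnm α lam k x₀ 0 x := by
      filter_upwards [((isOpen_posDomain hnm).sdiff isClosed_singleton).mem_nhds hx] with y hy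
      exact q_eq_regularizedQ hα ha hx₀ hy.1 hy.2
    rw [helmholtzOp_congr h1, helmholtzOp_const_mul,
      helmholtzOp_regularizedQ hα hk ha' hx₀ (hsub hx)]
    simp

end

/-! ### The fundamental solution property -/

section
variable {m n : ℕ} {hnm : n ≤ m} {x₀ : EuclideanSpace ℝ (Fin m)} {α : Fin n → ℝ} {k : ℕ}

lemma continuousOn_ofReal_coordPower (e : Fin n → ℝ) :
    ContinuousOn (fun x => (coordPower hnm e x : ℂ)) (posDomain hnm) :=
  Complex.continuous_ofReal.comp_continuousOn (contDiffOn_coordPower e (N := 0)).continuousOn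

open MeasureTheory in
lemma ae_eq_regularizedQ (hm : 0 < m) (hα : ∀ j, 0 < 2 * α j ∧ 2 * α j < 1) {lam : ℂ}
    (ha : ∀ c, Admissible (alphaTilde m α k) (-(1 / 4) * lam ^ 2 * c))
    (hx₀ : x₀ ∈ posDomain hnm) :
    ∀ᵐ x, x ∈ posDomain hnm → q hnm α lam k x x₀ =
      ((gammaConst m α k * coordPower hnm (powerParam α k) x₀ *
        (Real.Gamma (alphaTilde m α k))⁻¹ : ℝ) : ℂ) * regularizedQ hnm α lam k x₀ 0 x := by
  have : Nonempty (Fin m) := ⟨⟨0, hm⟩⟩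
  filter_upwards [Measure.ae_ne volume x₀] with x hne hx
  exact q_eq_regularizedQ hα ha hx₀ hx hne

open MeasureTheory in
lemma locallyIntegrableOn_q (hm : 0 < m) (hα : ∀ j, 0 < 2 * α j ∧ 2 * α j < 1) (hk : k ≤ n)
    {lam : ℂ} (ha : ∀ c, Admissible (alphaTilde m α k) (-(1 / 4) * lam ^ 2 * c))
    (hx₀ : x₀ ∈ posDomain hnm) :
    LocallyIntegrableOn (fun x => q hnm α lam k x x₀) (posDomain hnm) := by
  have ha' : Admissible (alphaTilde m α k) (-(1 / 4) * lam ^ 2) := by simpa using ha 1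
  have hb := fun j => (bParam_mem_Ioo hα k j).1
  rw [locallyIntegrableOn_iff (isOpen_posDomain hnm).isLocallyClosed]
  intro K hKpos hK
  have h1 := integrableOn_betaPotential_zero hx₀ hb ha' hm
    (by rw [alphaTilde_eq m α hk]; linarith) hK hKpos
  have h2 : IntegrableOn (fun x => ((gammaConst m α k * coordPower hnm (powerParam α k) x₀ *
        (Real.Gamma (alphaTilde m α k))⁻¹ : ℝ) : ℂ) * regularizedQ hnm α lam k x₀ 0 x) K :=
    (h1.continuousOn_mul ((continuousOn_ofReal_coordPower (powerParam α k)).mono hKpos)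
      hK).const_mul _
  refine Integrable.congr h2 ?_
  filter_upwards [ae_restrict_mem hK.measurableSet,
    ae_restrict_of_ae (ae_eq_regularizedQ hm hα ha hx₀)] with x hx h
  exact (h (hKpos hx)).symm

open MeasureTheory Filter Topology in
-- The integral of the regularized function against Lφ is followed to ε = 0 in two ways: directly by
-- domination, which gives the left side, and after moving L onto it, where the mass concentrates at
-- `x₀`.
lemma integral_q_mul_helmholtzOp (hm : 0 < m) (hα : ∀ j, 0 < 2 * α j ∧ 2 * α j < 1) (hk : k ≤ n)
    {lam : ℂ} (ha : ∀ c, Admissible (alphaTilde m α k) (-(1 / 4) * lam ^ 2 * c))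
    (hx₀ : x₀ ∈ posDomain hnm) {φ : EuclideanSpace ℝ (Fin m) → ℂ} (hφ : ContDiff ℝ (2 : ℕ) φ)
    (hφc : HasCompactSupport φ) (hφpos : tsupport φ ⊆ posDomain hnm) :
    ∫ x, q hnm α lam k x x₀ * helmholtzOp hnm α lam φ x * (weight hnm α x : ℂ) = -φ x₀ := by
  have ha' : Admissible (alphaTilde m α k) (-(1 / 4) * lam ^ 2) := by simpa using ha 1
  have hb := fun j => (bParam_mem_Ioo hα k j).1
  have hK : IsCompact (tsupport φ) := hφc
  set c : ℝ := gammaConst m α k * coordPower hnm (powerParam α k) x₀ *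
    (Real.Gamma (alphaTilde m α k))⁻¹ with hc
  set V : ℝ → EuclideanSpace ℝ (Fin m) → ℂ := betaPotential hnm (bParam α k) (alphaTilde m α k)
    (-(1 / 4) * lam ^ 2) (fun _ => 1) x₀ with hV
  set G : EuclideanSpace ℝ (Fin m) → ℂ := fun x => (coordPower hnm (powerParam α k) x : ℂ) *
    helmholtzOp hnm α lam φ x * (weight hnm α x : ℂ) with hG
  set h : EuclideanSpace ℝ (Fin m) → ℂ := fun x => φ x *
    ((coordPower hnm (powerParam α k) x : ℂ) * (weight hnm α x : ℂ)) with hh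
  have hGz : ∀ x, x ∉ tsupport φ → G x = 0 := fun x hx => by
    simp only [hG, helmholtzOp_eq_zero_of_notMem_tsupport lam hx]
    ring
  have hLφ : ContinuousOn (helmholtzOp hnm α lam φ) (posDomain hnm) := by
    have h1 : ∀ i, ContDiff ℝ (1 : ℕ) (partialDeriv i φ) := fun i =>
      contDiffOn_univ.1 (contDiffOn_partialDeriv isOpen_univ (contDiffOn_univ.2 hφ) i)
    have h2 : ∀ i, Continuous (partialDeriv i (partialDeriv i φ)) := fun i =>
      (contDiffOn_univ.1 (contDiffOn_partialDeriv isOpen_univ (N := 0)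
        (contDiffOn_univ.2 (h1 i)) i)).continuous
    refine ((continuous_finsetSum _ fun i _ => h2 i).continuousOn.add
      (continuousOn_finsetSum _ fun j _ => ContinuousOn.mul ?_ (h1 _).continuous.continuousOn)).sub
      (continuous_const.mul hφ.continuous).continuousOn
    refine Complex.continuous_ofReal.comp_continuousOn (ContinuousOn.div continuousOn_const
      (by fun_prop) fun x hx => (hx j).ne')
  have hGc : ContinuousOn G (tsupport φ) :=
    (((continuousOn_ofReal_coordPower _).mul hLφ).mul
      (continuousOn_ofReal_coordPower fun j => 2 * α j)).mono hφpos
  have hhs : tsupport h ⊆ tsupport φ := tsupport_mul_subset_left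
  have hhc : Continuous h :=
    (hφ.continuous.continuousOn.mul ((continuousOn_ofReal_coordPower _).mul
      (continuousOn_ofReal_coordPower fun j => 2 * α j))).continuous_of_tsupport_subset
      (isOpen_posDomain hnm) (hhs.trans hφpos)
  have hlim1 := (tendsto_integral_betaPotential hx₀ hb ha' hm
    (by rw [alphaTilde_eq m α hk]; linarith) hK hφpos hGc).const_mul (c : ℂ)
  have hq : ∫ x, q hnm α lam k x x₀ * helmholtzOp hnm α lam φ x * (weight hnm α x : ℂ) =
      c * ∫ x in tsupport φ, V 0 x * G x := by
    rw [setIntegral_eq_integral_of_forall_compl_eq_zero fun x hx => by rw [hGz x hx, mul_zero],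
      ← integral_const_mul]
    refine integral_congr_ae ?_
    filter_upwards [ae_eq_regularizedQ hm hα ha hx₀] with x hx
    by_cases hxs : x ∈ tsupport φ
    · rw [hx (hφpos hxs), regularizedQ]
      simp only [hG]
      ring
    · rw [hGz x hxs, helmholtzOp_eq_zero_of_notMem_tsupport lam hxs]
      ring
  -- For ε > 0 the regularized function is C² across `x₀`, so symmetry of L holds without boundary
  -- terms at the pole.
  have hε : ∀ ε : ℝ, 0 < ε → ∫ x in tsupport φ, V ε x * G x =
      -4 * ((ε : ℂ) * ∫ x, h x * betaPotential hnm (bParam α k) (alphaTilde m α k + 2)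
        (-(1 / 4) * lam ^ 2) (fun _ => 1) x₀ ε x) := by
    intro ε hε
    have hsm : ContDiffOn ℝ (2 : ℕ) (regularizedQ hnm α lam k x₀ ε) (posDomain hnm) :=
      (contDiffOn_regularizedQ hα ha' hx₀ ε 2).mono fun x hx => mem_kernelDomain_of_pos hx hε
    have h1 := integral_mul_helmholtzOp (α := α) lam hsm hφ hφc hφpos
    calc ∫ x in tsupport φ, V ε x * G x
        = ∫ x, regularizedQ hnm α lam k x₀ ε x * helmholtzOp hnm α lam φ x * weight hnm α x := by
          rw [setIntegral_eq_integral_of_forall_compl_eq_zero fun x hx => by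
            rw [hGz x hx, mul_zero]]
          refine integral_congr_ae (Eventually.of_forall fun x => ?_)
          simp only [hG, regularizedQ]
          ring
      _ = ∫ x, -4 * ((ε : ℂ) * (h x * betaPotential hnm (bParam α k) (alphaTilde m α k + 2)
            (-(1 / 4) * lam ^ 2) (fun _ => 1) x₀ ε x)) := by
          rw [h1]
          refine integral_congr_ae (Eventually.of_forall fun x => ?_)
          simp only [hh]
          by_cases hx : φ x = 0
          · simp [hx]
          · rw [helmholtzOp_regularizedQ hα hk ha' hx₀
              (mem_kernelDomain_of_pos (hφpos (subset_tsupport _ hx)) hε)]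
            push_cast
            ring
      _ = _ := by rw [integral_const_mul, integral_const_mul]
  have hlim2 := ((tendsto_mul_integral_betaPotential hm
    (by rw [alphaTilde_eq m α hk]; ring) ha' hx₀ (bParam_mem_Ioo hα k) hhc hφc.mul_right
    (hhs.trans hφpos)).const_mul (-4)).const_mul (c : ℂ)
  have hlim := tendsto_nhds_unique (hlim1.congr' (by
    filter_upwards [self_mem_nhdsWithin] with ε h
    rw [hε ε h])) hlim2
  rw [hq, hlim]
  have hone := congrArg (fun r : ℝ => (r : ℂ)) (gammaConst_mul_eq_one hα hk ha'.1 hx₀)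
  rw [← hc] at hone
  simp only [hh]
  push_cast at hone ⊢
  linear_combination (-φ x₀) * hone

end

end SingularHelmholtz

end

theorem mainTheorem1 (m n : ℕ) (hm : 2 ≤ m) (hn : 1 ≤ n) (hnm : n ≤ m)
    (α : Fin n → ℝ) (hα : ∀ j, 0 < 2 * α j ∧ 2 * α j < 1)
    (lam : ℂ) (hlam : lam.im = 0 ∨ lam.re = 0)
    (x₀ : EuclideanSpace ℝ (Fin m)) (hx₀ : x₀ ∈ SingularHelmholtz.posDomain hnm)
    (k : ℕ) (hk : k ≤ n)
    (hΓ : lam = 0 ∨ ∀ N : ℕ, SingularHelmholtz.alphaTilde m α k ≠ N) :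
    (∀ x ∈ SingularHelmholtz.posDomain hnm \ {x₀},
      SingularHelmholtz.xiArg hnm x x₀ ∈ SingularHelmholtz.contDomain n ∧
      SingularHelmholtz.IsHA (SingularHelmholtz.alphaTilde m α k)
        (SingularHelmholtz.bParam α k) (SingularHelmholtz.cParam α k)
        (SingularHelmholtz.etaArg lam x x₀)
        (fun ξ => SingularHelmholtz.HA (SingularHelmholtz.alphaTilde m α k)
          (SingularHelmholtz.bParam α k) (SingularHelmholtz.cParam α k) ξ
          (SingularHelmholtz.etaArg lam x x₀))) ∧
    SingularHelmholtz.IsSolutionOff hnm α lam x₀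
      (fun x => SingularHelmholtz.q hnm α lam k x x₀) ∧
    SingularHelmholtz.IsFundamentalSolution hnm α lam x₀
      (fun x => SingularHelmholtz.q hnm α lam k x x₀) := by
  have hm0 : 0 < m := by omega
  have ha := SingularHelmholtz.admissible_alphaTilde hm hn hk hα hΓ
  refine ⟨fun x hx => ⟨SingularHelmholtz.xiArg_mem_contDomain hx₀ hx.1, ?_⟩,
    SingularHelmholtz.isSolutionOff_q hα hk ha hx₀,
    SingularHelmholtz.locallyIntegrableOn_q hm0 hα hk ha hx₀, fun φ hφ hφc hφpos =>
    SingularHelmholtz.integral_q_mul_helmholtzOp hm0 hα hk ha hx₀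
      ((contDiff_infty.1 hφ) 2) hφc hφpos⟩
  rw [SingularHelmholtz.cParam_eq_two_mul]
  exact SingularHelmholtz.isHA_HA ⟨_, SingularHelmholtz.isHA_eulerHA
    (fun j => (SingularHelmholtz.bParam_mem_Ioo hα k j).1) (ha _)⟩
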